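/- Let $k\ge 1$, let $M\ge 1$ be odd, and let $p$ be a prime with $p\mid M$, $p^2\nmid M$. For $4\mid N$ let $S_{k+1/2}(\Gamma_0(N))$ be the space of holomorphic cusp forms $f$ on the upper half plane with $f(\gamma z)=j(\gamma,z)^{2k+1}f(z)$ for $\gamma=\begin{pmatrix}a&b\\c&d\end{pmatrix}\in\Gamma_0(N)$, where $j(\gamma,z)=\varepsilon_d^{-1}\left(\frac{c}{d}\right)(cz+d)^{1/2}$ (Shimura's symbol; $\varepsilon_d=1$ or $i$ as $d\equiv 1$ or $3 \bmod 4$; argument of the root in $(-\pi/2,\pi/2]$), and let $U_{p^2}\big(\sum a_nq^n\big)=\sum a_{p^2n}q^n$. *Double covers.* For a place $v$ of $\mathbb{Q}$ let $\widetilde{SL}_2(\mathbb{Q}_v)=SL_2(\mathbb{Q}_v)\times\{\pm1\}$ with $(g,\epsilon)(h,\epsilon')=(gh,\epsilon\epsilon'\sigma_v(g,h))$, $\sigma_v(g,h)=(\tau(gh)\tau(g),\tau(gh)\tau(h))_v\,s_v(g)s_v(h)s_v(gh)$; here $(\cdot,\cdot)_v$ is the Hilbert symbol and, for $g$ with lower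 row $(c,d)$, $\tau(g)=c$ if $c\ne0$ and $\tau(g)=d$ if $c=0$, while $s_v(g)=(c,d)_v$ if $v$ is finite, $cd\neq 0$ and $\mathrm{ord}_v(c)$ is odd, and $s_v(g)=1$ otherwise. Let $\widetilde{SL}_2(\mathbb{A})=SL_2(\mathbb{A})\times\{\pm1\}$ be the double cover with cocycle $\prod_v\sigma_v$, and $s_{\mathbb{Q}}(\alpha)=(\alpha,\prod_v s_v(\alpha))$ for $\alpha\in SL_2(\mathbb{Q})$. For $(g,\epsilon)\in\widetilde{SL}_2(\mathbb{R})$ put $J((g,\epsilon),z)=\epsilon(cz+d)^{1/2}$, argument of the root in $[-\pi/2,\pi/2)$. *From adelic to classical.* Let $N=4M$ and let $K_1(N)\subset\prod_qSL_2(\mathbb{Z}_q)$ be given by $c\equiv0$, $a\equiv d\equiv1 \bmod N$. For $f\in S_{k+1/2}(\Gamma_0(N))$ let $\Phi_f(\tilde g)=f(\tilde g_\infty i)J(\tilde g_\infty,i)^{-2k-1}$ if $\tilde g=s_{\mathbb{Q}}(\alpha)\,\tilde g_\infty\,(k_1,1)$ with $\alpha\in SL_2(\mathbb{Q})$, $\tilde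 g_\infty\in\widetilde{SL}_2(\mathbb{R})$, $k_1\in K_1(N)$. For a function $\mathcal{T}$ on $\widetilde{SL}_2(\mathbb{Q}_p)$ let $q(\mathcal{T})(f)(z)=J(\tilde g_\infty,i)^{2k+1}\int_{\widetilde{SL}_2(\mathbb{Q}_p)}\mathcal{T}(\tilde x)\Phi_f(\tilde g_\infty\tilde x)\,d\tilde x$ with $\tilde g_\infty i=z$, where the Haar measure gives the preimage $\overline{K}_0$ of $K_0(p)=\{g\in SL_2(\mathbb{Z}_p): p\mid c\}$ measure $1$. For $n\in\{0,1\}$ let $\mathcal{U}_n$ be the function supported on $\overline{K}_0(w(p^{-n}),1)\overline{K}_0$, $w(t)=\begin{pmatrix}0&t\\-t^{-1}&0\end{pmatrix}$, with $$\mathcal{U}_n\big((A,\epsilon)(w(p^{-n}),1)(A',\epsilon')\big)=\epsilon\epsilon'\,u_n\quad (A,A'\in K_0(p)),\qquad u_0=1,\quad u_1=\overline{\varepsilon_p}\left(\tfrac{-1}{p}\right).$$ Put $\widetilde{Q}_p=q(\mathcal{U}_0)$ and $\widetilde{W}_{p^2}=q(p^{-1/2}\mathcal{U}_1)$. **Claim.**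 $\widetilde{Q}_p$, $\widetilde{W}_{p^2}$ and $U_{p^2}$ are linear operators on $S_{k+1/2}(\Gamma_0(4M))$, and on this space: 1. $\widetilde{W}_{p^2}$ is an involution: $\widetilde{W}_{p^2}^2=1$. 2. $(\widetilde{Q}_p-p)(\widetilde{Q}_p+1)=0$. 3. $\widetilde{Q}_p=\left(\frac{-1}{p}\right)^kp^{1-k}\,U_{p^2}\widetilde{W}_{p^2}$. 4. $S_{k+1/2}(\Gamma_0(4M/p))\subseteq S_{k+1/2}(\Gamma_0(4M))$, and $\widetilde{Q}_p(f)=pf$ for every $f\in S_{k+1/2}(\Gamma_0(4M/p))$. -/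

import Mathlib

open scoped MatrixGroups UpperHalfPlane RestrictedProduct ComplexConjugate Manifold
open MeasureTheory

noncomputable section

namespace HalfIntegral

/-! ### Cusp forms of half-integral weight `k + 1/2` -/

/-- Shimura's quadratic symbol `(c/d)` for odd `d`. -/
def shimuraSymbol (c d : ℤ) : ℤ :=
  (if c < 0 ∧ d < 0 then -1 else 1) * jacobiSym c d.natAbs

/-- `ε_d`, equal to `1` if `d ≡ 1` and to `i` if `d ≡ 3` modulo `4`. -/
def epsilon (d : ℤ) : ℂ := if d % 4 = 1 then 1 else Complex.I

/-- The factor of automorphy `j(γ, z) = ε_d⁻¹ (c/d) (cz + d)^{1/2}`, where the argument of the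
square root lies in `(-π/2, π/2]`. -/
def thetaFactor (γ : SL(2, ℤ)) (z : ℍ) : ℂ :=
  (epsilon (γ 1 1))⁻¹ * (shimuraSymbol (γ 1 0) (γ 1 1) : ℂ) *
    (UpperHalfPlane.denom γ z) ^ (1 / 2 : ℂ)

/-- The slash operator `f|[(γ, φ)]_{k+1/2}(z) = f(γ z) φ(z)^{-2k-1}`. -/
def slash (k : ℕ) (γ : SL(2, ℤ)) (φ : ℍ → ℂ) (f : ℍ → ℂ) : ℍ → ℂ :=
  fun z => f (γ • z) * φ z ^ (-(2 * k + 1 : ℤ))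

/-- `S_{k+1/2}(Γ₀(N))` (for `4 ∣ N`): holomorphic functions on the upper half plane that are
invariant under `|[(γ, j(γ, z))]_{k+1/2}` for `γ ∈ Γ₀(N)` and vanish at every cusp. -/
def cuspForms (k N : ℕ) : Submodule ℂ (ℍ → ℂ) where
  carrier := {f | MDiff f ∧
    (∀ γ ∈ CongruenceSubgroup.Gamma0 N, slash k γ (thetaFactor γ) f = f) ∧
    ∀ γ : SL(2, ℤ), UpperHalfPlane.IsZeroAtImInfty
      (slash k γ (fun z => (UpperHalfPlane.denom γ z) ^ (1 / 2 : ℂ)) f)}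
  add_mem' := by
    rintro f g ⟨hf1, hf2, hf3⟩ ⟨hg1, hg2, hg3⟩
    have key : ∀ γ φ, slash k γ φ (f + g) = slash k γ φ f + slash k γ φ g := by
      intro γ φ; funext z; simp [slash, add_mul]
    refine ⟨hf1.add hg1, fun γ hγ => ?_, fun γ => ?_⟩
    · rw [key, hf2 γ hγ, hg2 γ hγ]
    · rw [key]; exact (hf3 γ).add (hg3 γ)
  zero_mem' := by
    have key : ∀ γ φ, slash k γ φ (0 : ℍ → ℂ) = 0 := by
      intro γ φ; funext z; simp [slash]
    refine ⟨mdifferentiable_const, fun γ _ => key _ _, fun γ => ?_⟩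
    rw [key]; exact Filter.zero_zeroAtFilter _
  smul_mem' := by
    rintro a f ⟨hf1, hf2, hf3⟩
    have key : ∀ γ φ, slash k γ φ (a • f) = a • slash k γ φ f := by
      intro γ φ; funext z; simp [slash, mul_assoc]
    refine ⟨hf1.const_smul a, fun γ hγ => ?_, fun γ => ?_⟩
    · rw [key, hf2 γ hγ]
    · rw [key]; exact (hf3 γ).smul a

/-- `U_m (∑ a_n q^n) = ∑ a_{mn} q^n`, with `q = e^{2πiz}`. -/
def heckeUm (m : ℕ) (f : ℍ → ℂ) : ℍ → ℂ := fun z =>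
  ∑' n : ℕ, (UpperHalfPlane.qExpansion 1 f).coeff (m * n) *
    (Function.Periodic.qParam 1 z) ^ n

/-! ### Hilbert symbols and the local double covers of `SL₂` -/

instance factPrime (q : Nat.Primes) : Fact (q : ℕ).Prime := ⟨q.2⟩

section Local

variable {q : Nat.Primes}

/-- The unit part `u` of `x = q^n u ≠ 0`. -/
def unitPart (x : ℚ_[q]) : ℤ_[q] :=
  if h : ‖x * ((q : ℕ) : ℚ_[q]) ^ (-x.valuation)‖ ≤ 1 then
    ⟨x * ((q : ℕ) : ℚ_[q]) ^ (-x.valuation), h⟩ else 0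

/-- The quadratic residue symbol of a unit of `ℤ_q`, for odd `q`. -/
def unitResidue (u : ℤ_[q]) : ℤˣ := if IsSquare (PadicInt.toZMod u) then 1 else -1

/-- The symbol `(2/u) = (-1)^{(u²-1)/8}` of a unit `u` of `ℤ_2`. -/
def unitTwo (u : ℤ_[q]) : ℤˣ :=
  if PadicInt.toZModPow 3 u = 1 ∨ PadicInt.toZModPow 3 u = 7 then 1 else -1

/-- `(-1)^{(u-1)(v-1)/4}` for units `u`, `v` of `ℤ_2`. -/
def unitFour (u v : ℤ_[q]) : ℤˣ :=
  if PadicInt.toZModPow 2 u = 3 ∧ PadicInt.toZModPow 2 v = 3 then -1 else 1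

/-- The Hilbert symbol on `ℚ_qˣ`. With `a = q^s u` and `b = q^t v` it is
`(-1/q)^{st} (u/q)^t (v/q)^s` for odd `q` and `(-1)^{(u-1)(v-1)/4} (2/u)^t (2/v)^s` for `q = 2`. -/
def hilbert (a b : ℚ_[q]) : ℤˣ :=
  if (q : ℕ) = 2 then
    unitFour (unitPart a) (unitPart b) * unitTwo (unitPart a) ^ b.valuation *
      unitTwo (unitPart b) ^ a.valuation
  else
    unitResidue (-1 : ℤ_[q]) ^ (a.valuation * b.valuation) *
      unitResidue (unitPart a) ^ b.valuation * unitResidue (unitPart b) ^ a.valuation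

/-- The Hilbert symbol on `ℝˣ`. -/
def hilbertReal (a b : ℝ) : ℤˣ := if a < 0 ∧ b < 0 then -1 else 1

/-- `τ(g) = c` if `c ≠ 0`, and `d` otherwise. -/
def tau {K : Type*} [Field K] (g : SL(2, K)) : K :=
  open scoped Classical in if g 1 0 ≠ 0 then g 1 0 else g 1 1

/-- `s_q(g) = (c, d)_q` if `cd ≠ 0` and `ord_q(c)` is odd, and `1` otherwise. -/
def sLocal (g : SL(2, ℚ_[q])) : ℤˣ :=
  open scoped Classical in
  if g 1 0 * g 1 1 ≠ 0 ∧ Odd (g 1 0).valuation then hilbert (g 1 0) (g 1 1) else 1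

/-- The cocycle `σ_q` at a finite place. -/
def cocycle (g h : SL(2, ℚ_[q])) : ℤˣ :=
  hilbert (tau (g * h) * tau g) (tau (g * h) * tau h) * sLocal g * sLocal h * sLocal (g * h)

/-- The cocycle `σ_∞` at the real place. -/
def cocycleReal (g h : SL(2, ℝ)) : ℤˣ :=
  hilbertReal (tau (g * h) * tau g) (tau (g * h) * tau h)

end Local

/-- The double cover of `SL₂(ℚ_q)`. -/
@[ext]
structure LocalCover (q : Nat.Primes) where
  mat : SL(2, ℚ_[q])
  sgn : ℤˣ

instance (q : Nat.Primes) : Mul (LocalCover q) :=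
  ⟨fun x y => ⟨x.mat * y.mat, x.sgn * y.sgn * cocycle x.mat y.mat⟩⟩

/-- The underlying set of the double cover of `SL₂(ℝ)`. -/
@[ext]
structure RealCover where
  mat : SL(2, ℝ)
  sgn : ℤˣ

/-- The automorphy factor `J((g, ε), z) = ε (cz + d)^{1/2}` on the double cover of `SL₂(ℝ)`. The
argument of the square root lies in `[-π/2, π/2)`: this is the branch for which
`J(gh, z) = J(g, hz) J(h, z)` with respect to the cocycle `σ_∞`. -/
def realFactor (g : RealCover) (z : ℍ) : ℂ :=
  ((g.sgn : ℤ) : ℂ) * conj ((conj (UpperHalfPlane.denom g.mat z)) ^ (1 / 2 : ℂ))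

/-! ### The adelic double cover -/

/-- `SL₂(ℤ_q)` as a subgroup of `SL₂(ℚ_q)`. -/
def integralSL (q : Nat.Primes) : Subgroup SL(2, ℚ_[q]) :=
  (Matrix.SpecialLinearGroup.map (n := Fin 2) (PadicInt.Coe.ringHom (p := q))).range

theorem mem_integralSL {q : Nat.Primes} {g : SL(2, ℚ_[q])} :
    g ∈ integralSL q ↔ ∀ i j, ‖g i j‖ ≤ 1 := by
  constructor
  · rintro ⟨h, rfl⟩ i j
    exact (h i j).2
  · intro h
    refine ⟨⟨Matrix.of fun i j => (⟨g i j, h i j⟩ : ℤ_[q]), ?_⟩, ?_⟩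
    · apply Subtype.ext
      have := g.det_coe
      rw [Matrix.det_fin_two] at this ⊢
      exact this
    · ext i j
      rfl

/-- `SL₂` of the finite adeles of `ℚ`. -/
abbrev FiniteSL : Type := Πʳ q : Nat.Primes, [SL(2, ℚ_[q]), integralSL q]

/-- The double cover of `SL₂(𝔸)`. -/
@[ext]
structure AdelicCover where
  inf : SL(2, ℝ)
  fin : FiniteSL
  sgn : ℤˣ

/-- The group law `(g, ε)(h, ε') = (gh, ε ε' ∏_ν σ_ν(g_ν, h_ν))`. -/
instance : Mul AdelicCover :=
  ⟨fun x y => ⟨x.inf * y.inf, x.fin * y.fin,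
    x.sgn * y.sgn * (cocycleReal x.inf y.inf * ∏ᶠ q, cocycle (x.fin q) (y.fin q))⟩⟩

theorem rat_integral (x : ℚ) :
    ∀ᶠ q : Nat.Primes in Filter.cofinite, ‖(x : ℚ_[q])‖ ≤ 1 := by
  have hfin : {q : Nat.Primes | (q : ℕ) ∣ x.den}.Finite := by
    refine Set.Finite.of_finite_image (f := fun q : Nat.Primes => (q : ℕ)) ?_
      (fun a _ b _ h => Subtype.ext h)
    refine (Set.finite_Iic x.den).subset ?_
    rintro _ ⟨q, hq, rfl⟩
    exact Nat.le_of_dvd x.den_pos hq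
  refine Filter.mem_of_superset hfin.compl_mem_cofinite ?_
  intro q hq
  exact Padic.norm_rat_le_one hq

/-- The diagonal image of `SL₂(ℚ)` in `SL₂` of the finite adeles. -/
def diagFinite (α : SL(2, ℚ)) : FiniteSL :=
  ⟨fun q => Matrix.SpecialLinearGroup.map (algebraMap ℚ ℚ_[q]) α, by
    have h : ∀ᶠ q : Nat.Primes in Filter.cofinite, ∀ i j, ‖(α i j : ℚ_[q])‖ ≤ 1 :=
      Filter.eventually_all.2 fun i => Filter.eventually_all.2 fun j => rat_integral (α i j)
    filter_upwards [h] with q hq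
    exact mem_integralSL.2 fun i j => by simpa using hq i j⟩

/-- The splitting `s_ℚ(α) = (α, ∏_ν s_ν(α))` over `SL₂(ℚ)`. -/
def rationalSection (α : SL(2, ℚ)) : AdelicCover where
  inf := Matrix.SpecialLinearGroup.map (algebraMap ℚ ℝ) α
  fin := diagFinite α
  sgn := ∏ᶠ q, sLocal (diagFinite α q)

/-- The embedding of the real component. -/
def ofReal (g : RealCover) : AdelicCover := ⟨g.mat, 1, g.sgn⟩

/-- The embedding of the component at `q`. -/
def ofLocal {q : Nat.Primes} (x : LocalCover q) : AdelicCover :=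
  ⟨1, open scoped Classical in
    RestrictedProduct.mulSingle (fun r : Nat.Primes => integralSL r) q x.mat, x.sgn⟩

/-- The element `(k, 1)` for `k` in `SL₂` of the finite adeles. -/
def ofFinite (k : FiniteSL) : AdelicCover := ⟨1, k, 1⟩

/-- `K₁(N)`: all components integral, with `c ≡ 0` and `a, d ≡ 1` modulo `N ℤ_q` for all `q`. -/
def K1 (N : ℕ) : Set FiniteSL :=
  {k | ∀ q : Nat.Primes, k q ∈ integralSL q ∧ ‖k q 1 0‖ ≤ ‖(N : ℚ_[q])‖ ∧
    ‖k q 0 0 - 1‖ ≤ ‖(N : ℚ_[q])‖ ∧ ‖k q 1 1 - 1‖ ≤ ‖(N : ℚ_[q])‖}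

/-- The decomposition `g = s_ℚ(α) g_∞ (k, 1)` of strong approximation. -/
def IsDecomposition (N : ℕ) (g : AdelicCover) (t : SL(2, ℚ) × RealCover × FiniteSL) : Prop :=
  t.2.2 ∈ K1 N ∧ g = rationalSection t.1 * ofReal t.2.1 * ofFinite t.2.2

/-- The function `Φ_f` on the adelic double cover attached to a form `f` of level `N`:
`Φ_f(g) = f(g_∞ i) J(g_∞, i)^{-2k-1}` for `g = s_ℚ(α) g_∞ (k, 1)`. -/
def adelicLift (k N : ℕ) (f : ℍ → ℂ) (g : AdelicCover) : ℂ :=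
  open scoped Classical in
  if h : ∃ t, IsDecomposition N g t then
    f (h.choose.2.1.mat • UpperHalfPlane.I) *
      realFactor h.choose.2.1 UpperHalfPlane.I ^ (-(2 * k + 1 : ℤ))
  else 0

/-- The element `(√y, x/√y; 0, 1/√y)` of `SL₂(ℝ)`, which maps `i` to `z = x + iy`. -/
def pointMatrix (z : ℍ) : SL(2, ℝ) :=
  ⟨!![√z.im, z.re / √z.im; 0, 1 / √z.im], by
    have : √z.im ≠ 0 := (Real.sqrt_pos.2 z.im_pos).ne'
    simp [Matrix.det_fin_two, this]⟩

/-- The function `f_Φ(z) = Φ(g_∞) J(g_∞, i)^{2k+1}`, where `g_∞ i = z`. -/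
def classicalForm (k : ℕ) (Φ : AdelicCover → ℂ) (z : ℍ) : ℂ :=
  Φ (ofReal ⟨pointMatrix z, 1⟩) * realFactor ⟨pointMatrix z, 1⟩ UpperHalfPlane.I ^ (2 * k + 1)

/-! ### The genuine Iwahori Hecke algebra at `p` -/

/-- The Iwahori subgroup `K₀(p)` of `SL₂(ℤ_p)`. -/
def iwahori (p : Nat.Primes) : Set SL(2, ℚ_[p]) :=
  {g | g ∈ integralSL p ∧ ‖g 1 0‖ ≤ ‖((p : ℕ) : ℚ_[p])‖}

theorem continuous_entry (p : Nat.Primes) (i j : Fin 2) :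
    Continuous fun g : SL(2, ℚ_[p]) => g i j :=
  (continuous_apply j).comp ((continuous_apply i).comp continuous_subtype_val)

theorem isCompact_iwahori (p : Nat.Primes) : IsCompact (iwahori p) := by
  have hc : CompactSpace SL(2, ℤ_[p]) := by
    have : CompactSpace (Matrix (Fin 2) (Fin 2) ℤ_[p]) :=
      inferInstanceAs (CompactSpace (Fin 2 → Fin 2 → ℤ_[p]))
    exact (Matrix.SpecialLinearGroup.isClosedEmbedding_val
      (n := Fin 2) (R := ℤ_[p])).compactSpace
  have h1 : IsCompact (integralSL p : Set SL(2, ℚ_[p])) := by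
    rw [integralSL, MonoidHom.coe_range]
    refine isCompact_range ?_
    exact Continuous.specialLinearGroup_map (f := PadicInt.Coe.ringHom) continuous_subtype_val
  exact h1.inter_right (isClosed_le
    (continuous_norm.comp (continuous_entry p 1 0)) continuous_const)

theorem interior_iwahori_nonempty (p : Nat.Primes) : (interior (iwahori p)).Nonempty := by
  have hopen : IsOpen (iwahori p) := by
    have hb : ∀ r : ℝ, r ≠ 0 → IsOpen {x : ℚ_[p] | ‖x‖ ≤ r} := by
      intro r hr
      have := IsUltrametricDist.isOpen_closedBall (0 : ℚ_[p]) hr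
      simpa [Metric.closedBall] using this
    have he : iwahori p =
        (⋂ i : Fin 2, ⋂ j : Fin 2, {g : SL(2, ℚ_[p]) | ‖g i j‖ ≤ 1}) ∩
          {g : SL(2, ℚ_[p]) | ‖g 1 0‖ ≤ ‖((p : ℕ) : ℚ_[p])‖} := by
      ext g
      simp [iwahori, mem_integralSL]
    rw [he]
    refine IsOpen.inter (isOpen_iInter_of_finite fun i => isOpen_iInter_of_finite fun j => ?_) ?_
    · exact (hb 1 one_ne_zero).preimage (continuous_entry p i j)
    · refine (hb _ ?_).preimage (continuous_entry p 1 0)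
      exact norm_ne_zero_iff.2 (by exact_mod_cast p.2.ne_zero)
  rw [hopen.interior_eq]
  exact ⟨1, one_mem _, by simp⟩

instance (p : Nat.Primes) : MeasurableSpace SL(2, ℚ_[p]) := borel _

instance (p : Nat.Primes) : BorelSpace SL(2, ℚ_[p]) := ⟨rfl⟩

/-- The Haar measure on `SL₂(ℚ_p)` for which `K₀(p)` has measure `1`. -/
def haarSL (p : Nat.Primes) : Measure SL(2, ℚ_[p]) :=
  Measure.haarMeasure
    ⟨⟨iwahori p, isCompact_iwahori p⟩, interior_iwahori_nonempty p⟩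

/-- The integral over the double cover of `SL₂(ℚ_p)` for the Haar measure that gives the full
preimage of `K₀(p)` measure `1`, i.e. each of the two sheets carries one half of `haarSL p`. -/
def coverIntegral (p : Nat.Primes) (F : LocalCover p → ℂ) : ℂ :=
  (1 / 2) * ∑ ε : ℤˣ, ∫ x, F ⟨x, ε⟩ ∂(haarSL p)

/-- `w(t) = (0, t; -t⁻¹, 0)`. -/
def wMatrix {p : Nat.Primes} (t : ℚ_[p]ˣ) : SL(2, ℚ_[p]) :=
  ⟨!![0, (t : ℚ_[p]); -((t⁻¹ : ℚ_[p]ˣ) : ℚ_[p]), 0], by simp [Matrix.det_fin_two]⟩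

/-- The prime `p` as a unit of `ℚ_p`. -/
def primeUnit (p : Nat.Primes) : ℚ_[p]ˣ :=
  Units.mk0 ((p : ℕ) : ℚ_[p]) (by exact_mod_cast p.2.ne_zero)

/-- The genuine character `γ(A, ε) = ε` of the preimage of `K₀(p)` that is trivial on `K₀(p)`. -/
def gamma {p : Nat.Primes} (x : LocalCover p) : ℂ := ((x.sgn : ℤ) : ℂ)

/-- The extension of `γ` to the elements `(w(t), 1)`: for `t = p^n u` it is `1` if `n` is even and
`ε_p (-u/p)` if `n` is odd. -/
def gammaW {p : Nat.Primes} (t : ℚ_[p]ˣ) : ℂ :=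
  if Even (t : ℚ_[p]).valuation then 1
  else epsilon (p : ℕ) * ((unitResidue (-unitPart (t : ℚ_[p])) : ℤ) : ℂ)

/-- The element `𝒰_n` of the genuine Iwahori Hecke algebra: it is supported on the double coset of
`(w(p^{-n}), 1)`, where its value at `k (w(p^{-n}), 1) k'` is the complex conjugate of
`γ(k) γ((w(p^{-n}), 1)) γ(k')`. -/
def heckeElement (p : Nat.Primes) (n : ℤ) (x : LocalCover p) : ℂ :=
  open scoped Classical in
  if h : ∃ κ : LocalCover p × LocalCover p, κ.1.mat ∈ iwahori p ∧ κ.2.mat ∈ iwahori p ∧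
      x = κ.1 * ⟨wMatrix (primeUnit p ^ (-n)), 1⟩ * κ.2 then
    conj (gamma h.choose.1) * conj (gammaW (primeUnit p ^ (-n))) * conj (gamma h.choose.2)
  else 0

/-- The action `𝒯(Φ)(g) = ∫ 𝒯(x) Φ(g x) dx` of a function on the double cover of `SL₂(ℚ_p)`. -/
def heckeAction {p : Nat.Primes} (T : LocalCover p → ℂ) (Φ : AdelicCover → ℂ) :
    AdelicCover → ℂ :=
  fun g => coverIntegral p fun x => T x * Φ (g * ofLocal x)

/-- The classical operator `q(𝒯)(f) = f_{𝒯(Φ_f)}` on forms of weight `k + 1/2` and level `N`. -/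
def classicalOperator {p : Nat.Primes} (k N : ℕ) (T : LocalCover p → ℂ) (f : ℍ → ℂ) : ℍ → ℂ :=
  classicalForm k (heckeAction T (adelicLift k N f))

/-- `Q̃_p = q(𝒰_0)` at level `4M`. -/
def Qtilde (k M : ℕ) (p : Nat.Primes) (f : ℍ → ℂ) : ℍ → ℂ :=
  classicalOperator k (4 * M) (heckeElement p 0) f

/-- `W̃_{p²} = q(p^{-1/2} 𝒰_1)` at level `4M`. -/
def Wtilde (k M : ℕ) (p : Nat.Primes) (f : ℍ → ℂ) : ℍ → ℂ :=
  classicalOperator k (4 * M) (fun x => ((Real.sqrt (p : ℕ) : ℝ) : ℂ)⁻¹ * heckeElement p 1 x) f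

end HalfIntegral

end

/-! The adelic operators are integrals over double cosets of K₀(p). The plan is to turn them into
finite sums of classical slash operators and to read the relations off from the geometry of ℙ¹(𝔽_p).
Write 4M = pn, so that 4 ∣ n, p ∤ n and p is odd, and let x(b), y(c) be the upper and lower
unipotent matrices.

Signs. The Hilbert symbol is symmetric, bilinear and satisfies the Steinberg relation; this alone
makes Kubota's expression a cocycle (`kubota_assoc`), and the factors s_q only add a coboundary. The
cocycle σ_q is trivial on SL₂(ℤ_q) for odd q and on K₁(4) for q = 2 (`clog_eq_zero_of_odd`,
`IsGood.clog_eq_zero`). The product formula `globalSymbol_eq_zero`, which is quadratic reciprocity,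
makes s_ℚ multiplicative. Combined with the branch of the real square root this gives
`ratFactor_mul`: the automorphy factor of a rational matrix is multiplicative up to σ_p. On integral
matrices with 4 ∣ c and d ≡ 1 mod 4 it is Shimura's factor (`IsGamma14.thetaFactor_eq`). Signs are
written additively in `ZMod 2`, where such identities become linear algebra.

Operators. On a coset α K₀(p), with α rational and in K₁(pn) away from p, the lift Φ_f is a genuine
sign times a slash of f (`adelicLift_coset`). The functions 𝒰_0 and 𝒰_1 carry the same sign on their
cosets, so the integrand is constant there and the integral is a sum over cosets
(`classicalOperator_apply`). The representatives x(s) y(n) and y(pns) x(1/p), for s mod p, lead to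
`Qtilde_formula` and `Wtilde_formula`.

Relations. For γ in Γ₀(n) with d ≡ 1 mod 4, f|γ depends only on the bottom row of γ as a point of
ℙ¹(𝔽_p). The first operator sums over all points but the base point, and counting pairs gives Q² = p
+ (p - 1) Q. After the rescaling F(z) = f(z/p) the second operator has the same shape with top rows,
now twisted by the quadratic character χ mod p. The same count applies (`sum_sum_eq`), but Σ χ = 0
kills the linear term and leaves W² = 1. If f already has level n, every term of Q f is f.

The operator U. In Q W f each term is f|x(-1/p) y(-n(1 + pr)) x(-s). An element of Γ₀(pn) turns it
into a constant times f((z + v)/p²), and v runs over all residues mod p² (`lowerSum_opW`). By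
orthogonality of roots of unity this is a multiple of U_{p²} f, and W² = 1 converts Q W = C U into Q
= C U W. Preservation of cusp forms by U then comes from that by Q and W. -/

namespace HalfIntegral

/-! ### Signs as elements of `ZMod 2` -/

/-- The additive form of a sign. -/
def signLog (u : ℤˣ) : ZMod 2 := if u = 1 then 0 else 1

theorem signLog_mul (u v : ℤˣ) : signLog (u * v) = signLog u + signLog v := by
  revert u v; decide

@[simp] theorem signLog_one : signLog 1 = 0 := rfl

theorem signLog_injective : Function.Injective signLog := by
  intro u v; revert u v; decide

theorem signLog_eq_zero {u : ℤˣ} : signLog u = 0 ↔ u = 1 := by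
  revert u; decide

theorem signLog_zpow (u : ℤˣ) (n : ℤ) : signLog (u ^ n) = n * signLog u := by
  have h2 : ∀ x : ZMod 2, x + x = 0 := by decide
  rcases Int.even_or_odd' n with ⟨m, rfl | rfl⟩
  · rw [two_mul, zpow_add, signLog_mul, h2]
    push_cast; rw [h2, zero_mul]
  · rw [two_mul, zpow_add, zpow_add, signLog_mul, signLog_mul, h2, zpow_one]
    push_cast; rw [h2]; simp

section Local

variable {q : Nat.Primes}

/-! ### Units -/

theorem toZMod_ne_zero_of_isUnit {u : ℤ_[q]} (hu : IsUnit u) : PadicInt.toZMod u ≠ 0 :=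
  (hu.map PadicInt.toZMod).ne_zero

theorem unitResidue_eq (u : ℤ_[q]) (hu : IsUnit u) :
    ((unitResidue u : ℤˣ) : ℤ) = quadraticChar (ZMod q) (PadicInt.toZMod u) := by
  have h := toZMod_ne_zero_of_isUnit hu
  simp only [unitResidue, quadraticChar_apply, quadraticCharFun, h, if_false]
  split_ifs <;> simp

theorem unitResidue_mul {u v : ℤ_[q]} (hu : IsUnit u) (hv : IsUnit v) :
    unitResidue (u * v) = unitResidue u * unitResidue v := by
  ext
  rw [unitResidue_eq _ (hu.mul hv), Units.val_mul, unitResidue_eq _ hu, unitResidue_eq _ hv,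
    map_mul, map_mul]

theorem unitResidue_of_toZMod_eq_one {u : ℤ_[q]} (h : PadicInt.toZMod u = 1) :
    unitResidue u = 1 := by simp [unitResidue, h]

theorem eq_two (h : (q : ℕ) = 2) : q = ⟨2, Nat.prime_two⟩ := Subtype.ext h

theorem unitTwo_mul (h : (q : ℕ) = 2) {u v : ℤ_[q]} (hu : IsUnit u) (hv : IsUnit v) :
    unitTwo (u * v) = unitTwo u * unitTwo v := by
  obtain rfl := eq_two h
  have hu := hu.map (PadicInt.toZModPow 3)
  have hv := hv.map (PadicInt.toZModPow 3)
  simp only [unitTwo, map_mul]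
  generalize PadicInt.toZModPow 3 u = x at *
  generalize PadicInt.toZModPow 3 v = y at *
  change ZMod 8 at x y
  revert x y
  decide

theorem unitFour_mul (h : (q : ℕ) = 2) {u v : ℤ_[q]} (hu : IsUnit u) (hv : IsUnit v)
    (w : ℤ_[q]) : unitFour (u * v) w = unitFour u w * unitFour v w := by
  obtain rfl := eq_two h
  have hu := hu.map (PadicInt.toZModPow 2)
  have hv := hv.map (PadicInt.toZModPow 2)
  simp only [unitFour, map_mul]
  generalize PadicInt.toZModPow 2 u = x at *
  generalize PadicInt.toZModPow 2 v = y at *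
  change ZMod 4 at x y
  by_cases hw : PadicInt.toZModPow 2 w = 3
  · simp only [hw, and_true]
    revert x y
    decide
  · simp [hw]

theorem unitFour_comm (u v : ℤ_[q]) : unitFour u v = unitFour v u := by
  simp [unitFour, and_comm]

theorem primeCast_ne_zero (q : Nat.Primes) : ((q : ℕ) : ℚ_[q]) ≠ 0 := by
  exact_mod_cast q.2.ne_zero

theorem unit_coe_ne_zero {u : ℤ_[q]} (hu : IsUnit u) : (u : ℚ_[q]) ≠ 0 := by
  simpa using hu.ne_zero

theorem valuation_unit {u : ℤ_[q]} (hu : IsUnit u) : (u : ℚ_[q]).valuation = 0 := by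
  have h1 : ‖(u : ℚ_[q])‖ = 1 := PadicInt.isUnit_iff.1 hu
  rw [Padic.norm_eq_zpow_neg_valuation (unit_coe_ne_zero hu)] at h1
  have hq : (1 : ℝ) < (q : ℕ) := by exact_mod_cast q.2.one_lt
  have := (zpow_eq_one_iff_right₀ (by positivity) hq.ne').1 h1
  omega

theorem valuation_unit_mul_zpow {u : ℤ_[q]} (hu : IsUnit u) (s : ℤ) :
    ((u : ℚ_[q]) * ((q : ℕ) : ℚ_[q]) ^ s).valuation = s := by
  rw [Padic.valuation_mul (unit_coe_ne_zero hu) (zpow_ne_zero _ (primeCast_ne_zero q)),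
    valuation_unit hu, Padic.valuation_zpow, Padic.valuation_p]
  simp

theorem unitPart_unit_mul_zpow {u : ℤ_[q]} (hu : IsUnit u) (s : ℤ) :
    unitPart ((u : ℚ_[q]) * ((q : ℕ) : ℚ_[q]) ^ s) = u := by
  have h : (u : ℚ_[q]) * ((q : ℕ) : ℚ_[q]) ^ s * ((q : ℕ) : ℚ_[q]) ^ (-s) = u := by
    rw [mul_assoc, ← zpow_add₀ (primeCast_ne_zero q)]; simp
  have h2 : ‖(u : ℚ_[q]) * ((q : ℕ) : ℚ_[q]) ^ s *
      ((q : ℕ) : ℚ_[q]) ^ (-((u : ℚ_[q]) * ((q : ℕ) : ℚ_[q]) ^ s).valuation)‖ ≤ 1 := by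
    rw [valuation_unit_mul_zpow hu, h]; exact u.2
  refine (dif_pos h2).trans (Subtype.ext ?_)
  change (u : ℚ_[q]) * ((q : ℕ) : ℚ_[q]) ^ s *
      ((q : ℕ) : ℚ_[q]) ^ (-((u : ℚ_[q]) * ((q : ℕ) : ℚ_[q]) ^ s).valuation) = u
  rw [valuation_unit_mul_zpow hu, h]

theorem exists_unit_mul_zpow {x : ℚ_[q]} (hx : x ≠ 0) :
    ∃ u : ℤ_[q], IsUnit u ∧ x = (u : ℚ_[q]) * ((q : ℕ) : ℚ_[q]) ^ x.valuation := by
  have h0 := primeCast_ne_zero q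
  have hn : ‖x * ((q : ℕ) : ℚ_[q]) ^ (-x.valuation)‖ = 1 := by
    rw [norm_mul, norm_zpow, Padic.norm_p, Padic.norm_eq_zpow_neg_valuation hx, inv_zpow, zpow_neg,
      inv_inv, inv_mul_cancel₀]
    exact zpow_ne_zero _ (by exact_mod_cast q.2.ne_zero)
  refine ⟨⟨_, hn.le⟩, PadicInt.isUnit_iff.2 hn, ?_⟩
  rw [mul_assoc, ← zpow_add₀ h0]; simp

/-! ### The Hilbert symbol -/

/-- The additive form of the Hilbert symbol. -/
noncomputable def hlog (a b : ℚ_[q]) : ZMod 2 := signLog (hilbert a b)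

theorem hlog_odd (hq : (q : ℕ) ≠ 2) {u v : ℤ_[q]} (hu : IsUnit u) (hv : IsUnit v) (s t : ℤ) :
    hlog ((u : ℚ_[q]) * ((q : ℕ) : ℚ_[q]) ^ s) ((v : ℚ_[q]) * ((q : ℕ) : ℚ_[q]) ^ t) =
      s * t * signLog (unitResidue (-1 : ℤ_[q])) + t * signLog (unitResidue u) +
        s * signLog (unitResidue v) := by
  simp only [hlog, hilbert, hq, if_false, unitPart_unit_mul_zpow hu, unitPart_unit_mul_zpow hv,
    valuation_unit_mul_zpow hu, valuation_unit_mul_zpow hv, signLog_mul, signLog_zpow]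
  push_cast; rfl

theorem hlog_two (hq : (q : ℕ) = 2) {u v : ℤ_[q]} (hu : IsUnit u) (hv : IsUnit v) (s t : ℤ) :
    hlog ((u : ℚ_[q]) * ((q : ℕ) : ℚ_[q]) ^ s) ((v : ℚ_[q]) * ((q : ℕ) : ℚ_[q]) ^ t) =
      signLog (unitFour u v) + t * signLog (unitTwo u) + s * signLog (unitTwo v) := by
  simp only [hlog, hilbert, hq, if_true]
  simp only [← hq, unitPart_unit_mul_zpow hu, unitPart_unit_mul_zpow hv,
    valuation_unit_mul_zpow hu, valuation_unit_mul_zpow hv, signLog_mul, signLog_zpow]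

theorem hlog_comm (a b : ℚ_[q]) : hlog a b = hlog b a := by
  simp only [hlog, hilbert]
  split_ifs
  · rw [unitFour_comm, mul_assoc, mul_assoc, mul_comm (unitTwo _ ^ _)]
  · rw [mul_comm a.valuation, mul_assoc, mul_assoc, mul_comm (unitResidue _ ^ a.valuation)]

theorem hlog_mul_left {a b c : ℚ_[q]} (ha : a ≠ 0) (hb : b ≠ 0) (hc : c ≠ 0) :
    hlog (a * b) c = hlog a c + hlog b c := by
  obtain ⟨u, hu, ea⟩ := exists_unit_mul_zpow ha
  obtain ⟨v, hv, eb⟩ := exists_unit_mul_zpow hb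
  obtain ⟨w, hw, ec⟩ := exists_unit_mul_zpow hc
  generalize a.valuation = s at ea
  generalize b.valuation = t at eb
  generalize c.valuation = r at ec
  subst ea eb ec
  have e : (u : ℚ_[q]) * ((q : ℕ) : ℚ_[q]) ^ s * ((v : ℚ_[q]) * ((q : ℕ) : ℚ_[q]) ^ t) =
      ((u * v : ℤ_[q]) : ℚ_[q]) * ((q : ℕ) : ℚ_[q]) ^ (s + t) := by
    rw [zpow_add₀ (primeCast_ne_zero q)]; push_cast; ring
  rw [e]
  by_cases hq : (q : ℕ) = 2
  · rw [hlog_two hq (hu.mul hv) hw, hlog_two hq hu hw, hlog_two hq hv hw, unitFour_mul hq hu hv w,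
      unitTwo_mul hq hu hv, signLog_mul, signLog_mul]
    push_cast; ring
  · rw [hlog_odd hq (hu.mul hv) hw, hlog_odd hq hu hw, hlog_odd hq hv hw, unitResidue_mul hu hv,
      signLog_mul]
    push_cast; ring

theorem two_mul_zmod_two (x : ZMod 2) : x + x = 0 := by revert x; decide

theorem toZMod_of_norm_lt {x : ℤ_[q]} (h : ‖x‖ < 1) : PadicInt.toZMod x = 0 := by
  rw [← RingHom.mem_ker, PadicInt.ker_toZMod]
  exact PadicInt.mem_nonunits.2 h

/-- The Steinberg relation when `a` is integral and not a unit. -/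
theorem hlog_steinberg_of_pos {u : ℤ_[q]} (hu : IsUnit u) (n : ℕ) :
    hlog ((u : ℚ_[q]) * ((q : ℕ) : ℚ_[q]) ^ ((n + 1 : ℕ) : ℤ))
      (1 - (u : ℚ_[q]) * ((q : ℕ) : ℚ_[q]) ^ ((n + 1 : ℕ) : ℤ)) = 0 := by
  set x : ℤ_[q] := u * ((q : ℕ) : ℤ_[q]) ^ (n + 1) with hx
  have hxn : ‖x‖ < 1 := by
    rw [hx, norm_mul, PadicInt.isUnit_iff.1 hu, one_mul, norm_pow, PadicInt.norm_p]
    exact pow_lt_one₀ (by positivity) (inv_lt_one_of_one_lt₀ (by exact_mod_cast q.2.one_lt))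
      (by omega)
  have hv : IsUnit (1 - x) := IsLocalRing.isUnit_one_sub_self_of_mem_nonunits _
    (PadicInt.mem_nonunits.2 hxn)
  have e : (1 - (u : ℚ_[q]) * ((q : ℕ) : ℚ_[q]) ^ ((n + 1 : ℕ) : ℤ)) =
      ((1 - x : ℤ_[q]) : ℚ_[q]) * ((q : ℕ) : ℚ_[q]) ^ (0 : ℤ) := by
    rw [zpow_natCast, hx]; push_cast; simp
  rw [e]
  by_cases hq : (q : ℕ) = 2
  · rw [hlog_two hq hu hv]
    obtain rfl := eq_two hq
    have hu8 := hu.map (PadicInt.toZModPow 3)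
    have h8 : PadicInt.toZModPow 3 (1 - x) = 1 - PadicInt.toZModPow 3 u * 2 ^ (n + 1) := by
      rw [map_sub, map_one, hx, map_mul, map_pow]
      congr 3
      exact map_ofNat (PadicInt.toZModPow (p := 2) 3) 2
    have h4 : PadicInt.toZModPow 2 (1 - x) = (PadicInt.toZModPow 3 (1 - x)).cast :=
      (PadicInt.cast_toZModPow 2 3 (by norm_num) _).symm
    have h4' : PadicInt.toZModPow 2 u = (PadicInt.toZModPow 3 u).cast :=
      (PadicInt.cast_toZModPow 2 3 (by norm_num) _).symm
    simp only [unitFour, unitTwo, h4, h4', h8]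
    generalize PadicInt.toZModPow 3 u = y at *
    change ZMod 8 at y
    clear h8 h4 h4' e hv hxn hx x
    -- For q = 2 everything depends on u and 1 - x modulo 8. Valuations 1 and 2 are finite checks;
    -- from valuation 3 on, 1 - x ≡ 1 mod 8 and all symbols vanish.
    rcases n with _ | _ | n
    · revert y; decide
    · revert y; decide
    · have h0 : y * (2 : ZMod 8) ^ (n + 1 + 1 + 1) = 0 := by
        have : (2 : ZMod 8) ^ 3 = 0 := by decide
        rw [show n + 1 + 1 + 1 = n + 3 by ring, pow_add, this, mul_zero, mul_zero]
      have h1 : 1 - y * (2 : ZMod 8) ^ (n + 1 + 1 + 1) = 1 := by rw [h0, sub_zero]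
      generalize 1 - y * (2 : ZMod 8) ^ (n + 1 + 1 + 1) = z at h1
      subst h1
      have e4 : ¬ ((1 : ZMod 8).cast : ZMod 4) = 3 := by decide
      have t4 : ∀ P : Prop, ∀ [Decidable P], (if P ∧ ((1 : ZMod 8).cast : ZMod 4) = 3 then
          (-1 : ℤˣ) else 1) = 1 := fun P _ => if_neg (fun h => e4 h.2)
      have t8 : (if (1 : ZMod 8) = 1 ∨ (1 : ZMod 8) = 7 then (1 : ℤˣ) else -1) = 1 := by decide
      refine (congrArg₂ (· + ·) (congrArg₂ (· + ·) (congrArg signLog (t4 _)) rfl)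
        (congrArg (_ * signLog ·) t8)).trans ?_
      simp
  · rw [hlog_odd hq hu hv]
    have : unitResidue (1 - x) = 1 := unitResidue_of_toZMod_eq_one (by
      rw [map_sub, map_one, toZMod_of_norm_lt hxn, sub_zero])
    simp [this]

theorem isUnit_neg_one : IsUnit (-1 : ℤ_[q]) := isUnit_one.neg

theorem hlog_neg_self {a : ℚ_[q]} (ha : a ≠ 0) : hlog a (-a) = 0 := by
  obtain ⟨u, hu, ea⟩ := exists_unit_mul_zpow ha
  generalize a.valuation = s at ea
  subst ea
  have e : -((u : ℚ_[q]) * ((q : ℕ) : ℚ_[q]) ^ s) =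
      ((-1 * u : ℤ_[q]) : ℚ_[q]) * ((q : ℕ) : ℚ_[q]) ^ s := by push_cast; ring
  rw [e]
  have hv := isUnit_neg_one.mul hu
  by_cases hq : (q : ℕ) = 2
  · have h : unitFour u (-1 * u) = 1 := by
      obtain rfl := eq_two hq
      have hu := hu.map (PadicInt.toZModPow 2)
      simp only [unitFour, map_mul, map_neg, map_one]
      generalize PadicInt.toZModPow 2 u = x at *
      change ZMod 4 at x
      revert x; decide
    have h' : unitTwo (-1 : ℤ_[q]) = 1 := by
      obtain rfl := eq_two hq
      simp only [unitTwo, map_neg, map_one]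
      exact if_pos (Or.inr (by decide))
    rw [hlog_two hq hu hv, h, unitTwo_mul hq isUnit_neg_one hu, h']
    simp [two_mul_zmod_two]
  · rw [hlog_odd hq hu hv, unitResidue_mul isUnit_neg_one hu, signLog_mul]
    -- Since s² ≡ s mod 2, the diagonal term s² (-1/q) cancels the contribution of -1 in the second
    -- argument.
    have hs : (s : ZMod 2) * s = s := by generalize (s : ZMod 2) = x; revert x; decide
    rw [hs]
    generalize (s : ZMod 2) = x
    generalize signLog (unitResidue u) = y
    generalize signLog (unitResidue (-1 : ℤ_[q])) = z
    revert x y z; decide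

theorem hlog_inv_left {a b : ℚ_[q]} (ha : a ≠ 0) (hb : b ≠ 0) : hlog a⁻¹ b = hlog a b := by
  have h2 : ∀ x y z : ZMod 2, x = y + z → y + (x + z) = 0 := by decide
  have h1 : hlog (1 : ℚ_[q]) b = 0 := by
    have := hlog_mul_left (one_ne_zero (α := ℚ_[q])) one_ne_zero hb
    rw [mul_one] at this
    revert this
    generalize hlog (1 : ℚ_[q]) b = x
    revert x; decide
  have := hlog_mul_left (inv_ne_zero ha) ha hb
  rw [inv_mul_cancel₀ ha, h1] at this
  revert this
  generalize hlog a⁻¹ b = x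
  generalize hlog a b = y
  revert x y; decide

/-- Positive valuation is the computation above. For negative valuation, 1 - a = -a (1 - a⁻¹) and
(a, -a) = 1 reduce to a⁻¹. For a unit a, either 1 - a has positive valuation and the roles are
exchanged, or both are units; the latter is harmless for odd q and impossible for q = 2, whose
residue field has only one nonzero element. -/
theorem hlog_steinberg {a : ℚ_[q]} (ha : a ≠ 0) (ha1 : 1 - a ≠ 0) : hlog a (1 - a) = 0 := by
  have pos : ∀ a : ℚ_[q], a ≠ 0 → 0 < a.valuation → hlog a (1 - a) = 0 := by
    intro a ha h
    obtain ⟨u, hu, ea⟩ := exists_unit_mul_zpow ha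
    obtain ⟨n, hn⟩ := Int.eq_succ_of_zero_lt h
    rw [hn] at ea
    rw [ea]
    exact hlog_steinberg_of_pos hu n
  rcases lt_trichotomy a.valuation 0 with h | h | h
  · have h' := pos a⁻¹ (inv_ne_zero ha) (by rw [Padic.valuation_inv]; omega)
    have e : 1 - a = -a * (1 - a⁻¹) := by field_simp; ring
    have h1 : 1 - a⁻¹ ≠ 0 := by
      intro h0; rw [h0, mul_zero] at e; exact ha1 e
    rw [e, hlog_comm, hlog_mul_left (neg_ne_zero.2 ha) h1 ha, hlog_comm, hlog_neg_self ha,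
      hlog_comm, ← hlog_inv_left ha h1, h', add_zero]
  · by_cases h0 : (1 - a).valuation = 0
    · obtain ⟨u, hu, ea⟩ := exists_unit_mul_zpow ha
      obtain ⟨v, hv, eb⟩ := exists_unit_mul_zpow ha1
      rw [h] at ea
      rw [h0] at eb
      by_cases hq : (q : ℕ) = 2
      · exfalso
        have huv : u + v = 1 := by
          apply Subtype.ext
          have : (u : ℚ_[q]) + v = 1 := by
            simp only [zpow_zero, mul_one] at ea eb
            rw [← ea, ← eb]; ring
          exact this
        have h1 := congrArg PadicInt.toZMod huv
        have hu := hu.map (PadicInt.toZMod (p := q))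
        have hv := hv.map (PadicInt.toZMod (p := q))
        rw [map_add, map_one] at h1
        obtain rfl := eq_two hq
        generalize PadicInt.toZMod u = x at *
        generalize PadicInt.toZMod v = y at *
        change ZMod 2 at x y
        clear eb ea huv
        revert x y; decide
      · rw [ea] at *
        rw [eb, hlog_odd hq hu hv]; simp
    · have hp : 0 < (1 - a).valuation := by
        have h1 : ‖(1 : ℚ_[q]) - a‖ ≤ 1 := by
          rw [sub_eq_add_neg]
          refine (Padic.nonarchimedean _ _).trans ?_
          rw [norm_neg, norm_one, Padic.norm_eq_zpow_neg_valuation ha, h]; simp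
        have := (Padic.norm_le_one_iff_val_nonneg _).1 h1
        omega
      have := pos (1 - a) ha1 hp
      rw [hlog_comm, sub_sub_cancel] at this
      exact this
  · exact pos a ha h

end Local

/-! ### Symbols and Kubota cocycles -/

/-- Symmetric bilinear symbols of order two on a field that satisfy the Steinberg relation. -/
structure IsSymbol {K : Type*} [Field K] (H : K → K → ZMod 2) : Prop where
  mul_left : ∀ {a b c}, a ≠ 0 → b ≠ 0 → c ≠ 0 → H (a * b) c = H a c + H b c
  comm : ∀ a b, H a b = H b a
  neg_self : ∀ {a}, a ≠ 0 → H a (-a) = 0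
  steinberg : ∀ {a}, a ≠ 0 → 1 - a ≠ 0 → H a (1 - a) = 0

theorem isSymbol_hlog (q : Nat.Primes) : IsSymbol (hlog (q := q)) :=
  ⟨hlog_mul_left, hlog_comm, hlog_neg_self, hlog_steinberg⟩

namespace IsSymbol

variable {K : Type*} [Field K] {H : K → K → ZMod 2}

theorem mul_right (hH : IsSymbol H) {a b c : K} (ha : a ≠ 0) (hb : b ≠ 0) (hc : c ≠ 0) :
    H a (b * c) = H a b + H a c := by
  rw [hH.comm, hH.mul_left hb hc ha, hH.comm b, hH.comm c]

theorem one_left (hH : IsSymbol H) {a : K} (ha : a ≠ 0) : H 1 a = 0 := by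
  have := hH.mul_left one_ne_zero one_ne_zero ha
  rw [mul_one] at this
  revert this; generalize H 1 a = x; revert x; decide

theorem one_right (hH : IsSymbol H) {a : K} (ha : a ≠ 0) : H a 1 = 0 := by rw [hH.comm, hH.one_left ha]

theorem self (hH : IsSymbol H) {a : K} (ha : a ≠ 0) : H a a = H a (-1) := by
  have := hH.neg_self ha
  rw [← neg_one_mul, hH.mul_right ha (by simp) ha] at this
  revert this; generalize H a a = x; generalize H a (-1) = y; revert x y; decide

theorem inv_left (hH : IsSymbol H) {a b : K} (ha : a ≠ 0) (hb : b ≠ 0) : H a⁻¹ b = H a b := by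
  have := hH.mul_left (inv_ne_zero ha) ha hb
  rw [inv_mul_cancel₀ ha, hH.one_left hb] at this
  revert this; generalize H a⁻¹ b = x; generalize H a b = y; revert x y; decide

theorem inv_right (hH : IsSymbol H) {a b : K} (ha : a ≠ 0) (hb : b ≠ 0) : H b a⁻¹ = H b a := by
  rw [hH.comm, hH.inv_left ha hb, hH.comm]

/-- The additive form of Kubota's cocycle is an expression in values of `τ`. -/
theorem cocycle_generic (hH : IsSymbol H) {a b e Y Z : K} (ha : a ≠ 0) (hb : b ≠ 0) (he : e ≠ 0) (hY : Y ≠ 0)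
    (hZ : Z ≠ 0) (hX : Y * Z - 1 ≠ 0) {p q r : K} (hp : p = a * Y) (hq : q = e * Z)
    (hr : r = a * e * b⁻¹ * (Y * Z - 1)) :
    H (p * a) (p * b) + H (r * p) (r * e) = H (r * a) (r * q) + H (q * b) (q * e) := by
  have h1 : (-1 : K) ≠ 0 := by simp
  have hb' := inv_ne_zero hb
  -- Once the identity is expanded bilinearly, with (a, a) = (a, -1), what remains is this one
  -- Steinberg relation for YZ and 1 - YZ = -X.
  have st := hH.steinberg (mul_ne_zero hY hZ) (by
    rw [show 1 - Y * Z = -1 * (Y * Z - 1) by ring]; exact mul_ne_zero h1 hX)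
  rw [show 1 - Y * Z = -1 * (Y * Z - 1) by ring] at st
  generalize Y * Z - 1 = X at *
  subst hp hq hr
  simp only [hH.mul_left, hH.mul_right, hH.inv_left, hH.inv_right, hH.self, ha, hb, hb', he, hY,
    hZ, hX, h1, mul_ne_zero_iff, ne_eq, not_false_eq_true, and_self] at st ⊢
  simp only [hH.comm b a, hH.comm e a, hH.comm Y a, hH.comm X a, hH.comm e b,
    hH.comm Y b, hH.comm X b, hH.comm Y e, hH.comm Z e, hH.comm X e, hH.comm X Z] at st ⊢
  grind

end IsSymbol
end HalfIntegral

namespace HalfIntegral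

/-! ### Entries of products and inverses in SL₂. -/

section Entries

variable {R : Type*} [CommRing R] (g h : SL(2, R))

theorem sl_mul_zero_zero : (g * h) 0 0 = g 0 0 * h 0 0 + g 0 1 * h 1 0 := by
  simp [Matrix.mul_apply, Fin.sum_univ_two]

theorem sl_mul_zero_one : (g * h) 0 1 = g 0 0 * h 0 1 + g 0 1 * h 1 1 := by
  simp [Matrix.mul_apply, Fin.sum_univ_two]

theorem sl_mul_one_zero : (g * h) 1 0 = g 1 0 * h 0 0 + g 1 1 * h 1 0 := by
  simp [Matrix.mul_apply, Fin.sum_univ_two]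

theorem sl_mul_one_one : (g * h) 1 1 = g 1 0 * h 0 1 + g 1 1 * h 1 1 := by
  simp [Matrix.mul_apply, Fin.sum_univ_two]

theorem sl_det : g 0 0 * g 1 1 - g 0 1 * g 1 0 = 1 := by
  have := g.det_coe
  rwa [Matrix.det_fin_two] at this

theorem sl_inv_zero_zero : g⁻¹ 0 0 = g 1 1 := by
  simp [Matrix.SpecialLinearGroup.coe_inv, Matrix.adjugate_fin_two]

theorem sl_inv_zero_one : g⁻¹ 0 1 = -g 0 1 := by
  simp [Matrix.SpecialLinearGroup.coe_inv, Matrix.adjugate_fin_two]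

theorem sl_inv_one_zero : g⁻¹ 1 0 = -g 1 0 := by
  simp [Matrix.SpecialLinearGroup.coe_inv, Matrix.adjugate_fin_two]

theorem sl_inv_one_one : g⁻¹ 1 1 = g 0 0 := by
  simp [Matrix.SpecialLinearGroup.coe_inv, Matrix.adjugate_fin_two]

theorem sl_ext {g h : SL(2, R)} (h00 : g 0 0 = h 0 0) (h01 : g 0 1 = h 0 1) (h10 : g 1 0 = h 1 0)
    (h11 : g 1 1 = h 1 1) : g = h := by
  ext i j
  fin_cases i <;> fin_cases j <;> assumption

end Entries

/-! ### The function τ and Kubota's cocycle over a field. -/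

section Kubota

variable {K : Type*} [Field K] {H : K → K → ZMod 2}

theorem tau_of_ne {g : SL(2, K)} (hg : g 1 0 ≠ 0) : tau g = g 1 0 := if_pos hg

theorem tau_of_eq {g : SL(2, K)} (hg : g 1 0 = 0) : tau g = g 1 1 := if_neg (not_not.2 hg)

theorem tau_ne_zero (g : SL(2, K)) : tau g ≠ 0 := by
  by_cases hg : g 1 0 = 0
  · rw [tau_of_eq hg]
    intro h
    have := sl_det g
    rw [hg, h] at this
    simp at this
  · rwa [tau_of_ne hg]

@[simp] theorem tau_one : tau (1 : SL(2, K)) = 1 := by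
  rw [tau_of_eq (by simp)]; simp

theorem tau_mul_of_left {g : SL(2, K)} (hg : g 1 0 = 0) (h : SL(2, K)) :
    tau (g * h) = tau g * tau h := by
  have e0 := sl_mul_one_zero g h
  have e1 := sl_mul_one_one g h
  have hg1 := tau_ne_zero g
  rw [tau_of_eq hg] at hg1 ⊢
  rw [hg, zero_mul, zero_add] at e0 e1
  by_cases hh : h 1 0 = 0
  · rw [tau_of_eq hh, tau_of_eq (by rw [e0, hh, mul_zero]), e1]
  · rw [tau_of_ne hh, tau_of_ne (by rw [e0]; exact mul_ne_zero hg1 hh), e0]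

/-- Against an upper triangular factor on the right, τ is multiplicative only up to a square,
because h 0 0 = (h 1 1)⁻¹ is h 1 1 times a square. A symbol of order two does not see squares. -/
theorem tau_mul_of_right (g : SL(2, K)) {h : SL(2, K)} (hh : h 1 0 = 0) :
    ∃ s : K, s ≠ 0 ∧ tau (g * h) = tau g * tau h * (s * s) := by
  have e0 := sl_mul_one_zero g h
  have e1 := sl_mul_one_one g h
  have d := sl_det h
  have hh1 := tau_ne_zero h
  rw [tau_of_eq hh] at hh1 ⊢
  rw [hh, mul_zero, add_zero] at e0
  rw [hh, mul_zero, sub_zero] at d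
  by_cases hg : g 1 0 = 0
  · rw [hg, zero_mul] at e0
    rw [hg, zero_mul, zero_add] at e1
    exact ⟨1, one_ne_zero, by rw [tau_of_eq e0, tau_of_eq hg, e1]; ring⟩
  · refine ⟨h 0 0, fun h0 => ?_, ?_⟩
    · rw [h0] at d; simp at d
    · rw [tau_of_ne hg, tau_of_ne, e0]
      · linear_combination (-g 1 0 * h 0 0) * d
      · rw [e0]; exact mul_ne_zero hg (fun h0 => by rw [h0] at d; simp at d)

/-- The additive form of Kubota's cocycle. -/
noncomputable def kubota (H : K → K → ZMod 2) (g h : SL(2, K)) : ZMod 2 :=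
  H (tau (g * h) * tau g) (tau (g * h) * tau h)

-- Whenever one of the six lower left entries vanishes, the values of τ satisfy a multiplicative
-- relation up to squares and signs, and bilinearity suffices. In the remaining generic case the
-- relation is additive and the Steinberg relation enters through `IsSymbol.cocycle_generic`.
set_option linter.unusedSimpArgs false in
theorem kubota_assoc (hH : IsSymbol H) (g h k : SL(2, K)) :
    kubota H g h + kubota H (g * h) k = kubota H g (h * k) + kubota H h k := by
  have ha := tau_ne_zero g
  have hb := tau_ne_zero h
  have he := tau_ne_zero k
  have hp := tau_ne_zero (g * h)
  have hq := tau_ne_zero (h * k)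
  have hr := tau_ne_zero (g * h * k)
  have h1 : (-1 : K) ≠ 0 := by simp
  simp only [kubota, ← mul_assoc g h k]
  by_cases hg0 : g 1 0 = 0
  · rw [mul_assoc g h k, tau_mul_of_left hg0, tau_mul_of_left hg0]
    generalize tau g = a at *
    generalize tau h = b at *
    generalize tau k = e at *
    generalize tau (h * k) = q at *
    simp only [hH.mul_left, hH.mul_right, hH.self, ha, hb, he, hq, h1, mul_ne_zero_iff, ne_eq,
      not_false_eq_true, and_self]
    simp only [hH.comm b a, hH.comm e a, hH.comm e b, hH.comm q a, hH.comm q b, hH.comm q e]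
    grind
  by_cases hh0 : h 1 0 = 0
  · obtain ⟨s, hs, e1⟩ := tau_mul_of_right g hh0
    rw [e1, tau_mul_of_left hh0 k]
    generalize tau g = a at *
    generalize tau h = b at *
    generalize tau k = e at *
    generalize tau (g * h * k) = r at *
    simp only [hH.mul_left, hH.mul_right, hH.self, ha, hb, he, hr, hs, h1, mul_ne_zero_iff, ne_eq,
      not_false_eq_true, and_self]
    simp only [hH.comm b a, hH.comm e a, hH.comm e b, hH.comm r a, hH.comm r b, hH.comm r e,
      hH.comm s a, hH.comm s b, hH.comm s e, hH.comm s r]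
    grind
  by_cases hk0 : k 1 0 = 0
  · obtain ⟨s, hs, e1⟩ := tau_mul_of_right (g * h) hk0
    obtain ⟨t, ht, e2⟩ := tau_mul_of_right h hk0
    rw [e1, e2]
    generalize tau g = a at *
    generalize tau h = b at *
    generalize tau k = e at *
    generalize tau (g * h) = p at *
    simp only [hH.mul_left, hH.mul_right, hH.self, ha, hb, he, hp, hs, ht, h1, mul_ne_zero_iff,
      ne_eq, not_false_eq_true, and_self]
    simp only [hH.comm b a, hH.comm e a, hH.comm e b, hH.comm p a, hH.comm p b, hH.comm p e,
      hH.comm s a, hH.comm s b, hH.comm s e, hH.comm s p, hH.comm t a, hH.comm t b, hH.comm t e,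
      hH.comm t p, hH.comm t s]
    grind
  have d := sl_det h
  by_cases hp0 : (g * h) 1 0 = 0
  · rw [tau_mul_of_left hp0]
    have e1 : tau g = -1 * (tau (g * h) * tau h) := by
      rw [tau_of_ne hg0, tau_of_ne hh0, tau_of_eq hp0, sl_mul_one_one]
      rw [sl_mul_one_zero] at hp0
      linear_combination (-g 1 0) * d + h 1 1 * hp0
    rw [e1]
    generalize tau (g * h) = p at *
    generalize tau h = b at *
    generalize tau k = e at *
    generalize tau (h * k) = q at *
    simp only [hH.mul_left, hH.mul_right, hH.self, hb, he, hp, hq, h1, mul_ne_zero_iff,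
      ne_eq, not_false_eq_true, and_self]
    simp only [hH.comm p (-1), hH.comm b (-1), hH.comm e (-1), hH.comm q (-1), hH.comm b p,
      hH.comm e p, hH.comm q p, hH.comm e b, hH.comm q b, hH.comm q e]
    grind
  by_cases hq0 : (h * k) 1 0 = 0
  · obtain ⟨s, hs, e2⟩ := tau_mul_of_right g hq0
    have e1 : tau h = -1 * (tau (h * k) * tau k) := by
      rw [tau_of_ne hk0, tau_of_ne hh0, tau_of_eq hq0, sl_mul_one_one]
      rw [sl_mul_one_zero] at hq0
      linear_combination (-h 1 0) * sl_det k + k 1 1 * hq0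
    rw [mul_assoc g h k, e2, e1]
    generalize tau g = a at *
    generalize tau (g * h) = p at *
    generalize tau k = e at *
    generalize tau (h * k) = q at *
    simp only [hH.mul_left, hH.mul_right, hH.self, ha, he, hp, hq, hs, h1, mul_ne_zero_iff,
      ne_eq, not_false_eq_true, and_self]
    simp only [hH.comm p (-1), hH.comm a (-1), hH.comm e (-1), hH.comm q (-1), hH.comm s (-1),
      hH.comm p a, hH.comm q a, hH.comm e a, hH.comm s a, hH.comm e p, hH.comm q p, hH.comm s p,
      hH.comm q e, hH.comm s e, hH.comm s q]
    grind
  by_cases hr0 : (g * h * k) 1 0 = 0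
  · have hr0' := hr0
    rw [mul_assoc] at hr0'
    have e1 : tau (g * h) = -1 * (tau (g * h * k) * tau k) := by
      rw [tau_of_ne hk0, tau_of_ne hp0, tau_of_eq hr0, sl_mul_one_one (g * h) k]
      rw [sl_mul_one_zero (g * h) k] at hr0
      linear_combination (-(g * h) 1 0) * sl_det k + k 1 1 * hr0
    have e2 : tau g = -1 * (tau (g * h * k) * tau (h * k)) := by
      rw [tau_of_ne hg0, tau_of_ne hq0, tau_of_eq hr0, mul_assoc, sl_mul_one_one g (h * k)]
      rw [sl_mul_one_zero g (h * k)] at hr0'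
      linear_combination (-g 1 0) * sl_det (h * k) + (h * k) 1 1 * hr0'
    rw [e1, e2]
    generalize tau (g * h * k) = r at *
    generalize tau h = b at *
    generalize tau k = e at *
    generalize tau (h * k) = q at *
    simp only [hH.mul_left, hH.mul_right, hH.self, hb, he, hr, hq, h1, mul_ne_zero_iff,
      ne_eq, not_false_eq_true, and_self]
    simp only [hH.comm r (-1), hH.comm b (-1), hH.comm e (-1), hH.comm q (-1), hH.comm b r,
      hH.comm e r, hH.comm q r, hH.comm e b, hH.comm q b, hH.comm q e]
    grind
  -- A consequence of det h = 1. With Y = τ(gh)/τ(g) and Z = τ(hk)/τ(k) it identifies YZ - 1 with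
  -- τ(ghk) τ(h) / (τ(g) τ(k)), which is the input of the generic case.
  have e : tau (g * h * k) * tau h = tau (g * h) * tau (h * k) - tau g * tau k := by
    rw [tau_of_ne hr0, tau_of_ne hh0, tau_of_ne hp0, tau_of_ne hq0, tau_of_ne hg0, tau_of_ne hk0]
    simp only [sl_mul_one_zero, sl_mul_one_one]
    linear_combination (-g 1 0 * k 1 0) * d
  refine hH.cocycle_generic ha hb he (Y := tau (g * h) / tau g) (Z := tau (h * k) / tau k)
    (div_ne_zero hp ha) (div_ne_zero hq he) ?_ (by field_simp) (by field_simp) ?_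
  · intro h0
    have : tau (g * h * k) * tau h = 0 := by
      rw [e]; field_simp at h0; linear_combination h0
    exact mul_ne_zero hr hb this
  · field_simp
    linear_combination e

set_option linter.unusedSimpArgs false in
theorem kubota_left (hH : IsSymbol H) {g : SL(2, K)} (h0 : g 1 0 = 0) (h : SL(2, K)) :
    kubota H g h = H (tau h) (tau g) := by
  have ha := tau_ne_zero g
  have hb := tau_ne_zero h
  rw [kubota, tau_mul_of_left h0]
  generalize tau g = a at *
  generalize tau h = b at *
  have h1 : (-1 : K) ≠ 0 := by simp
  simp only [hH.mul_left, hH.mul_right, hH.self, ha, hb, h1, mul_ne_zero_iff, ne_eq,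
      not_false_eq_true, and_self]
  simp only [hH.comm b a]
  grind

end Kubota

/-! ### The local cocycle -/

section Local

variable {q : Nat.Primes}

/-- The additive form of `s_q`. -/
noncomputable def slog (g : SL(2, ℚ_[q])) : ZMod 2 := signLog (sLocal g)

/-- The additive form of `σ_q`. -/
noncomputable def clog (g h : SL(2, ℚ_[q])) : ZMod 2 := signLog (cocycle g h)

theorem clog_eq (g h : SL(2, ℚ_[q])) :
    clog g h = kubota hlog g h + slog g + slog h + slog (g * h) := by
  simp only [clog, cocycle, signLog_mul, slog, kubota, hlog]

/-- The factors s_q form a coboundary, so the cocycle relation is inherited from `kubota_assoc`. -/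
theorem clog_assoc (g h k : SL(2, ℚ_[q])) :
    clog g h + clog (g * h) k = clog g (h * k) + clog h k := by
  have := kubota_assoc (isSymbol_hlog q) g h k
  simp only [clog_eq, mul_assoc]
  grind

theorem slog_of_zero {g : SL(2, ℚ_[q])} (h : g 1 0 = 0 ∨ g 1 1 = 0) : slog g = 0 := by
  rw [slog, sLocal, if_neg]
  · rfl
  · rintro ⟨h1, -⟩
    rcases h with h | h <;> simp [h] at h1

theorem slog_of_even {g : SL(2, ℚ_[q])} (h : Even (g 1 0).valuation) : slog g = 0 := by
  rw [slog, sLocal, if_neg]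
  · rfl
  · rintro ⟨-, h1⟩
    exact Int.not_even_iff_odd.2 h1 h

theorem slog_of_odd {g : SL(2, ℚ_[q])} (h : Odd (g 1 0).valuation) (h1 : g 1 1 ≠ 0) :
    slog g = hlog (g 1 0) (g 1 1) := by
  rw [slog, sLocal, if_pos]
  · rfl
  · refine ⟨mul_ne_zero (fun h0 => ?_) h1, h⟩
    rw [h0] at h
    simp at h

theorem clog_one_left (g : SL(2, ℚ_[q])) : clog 1 g = 0 := by
  rw [clog_eq, kubota_left (isSymbol_hlog q) (by simp), one_mul, slog_of_zero (g := 1) (by simp),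
    tau_one, (isSymbol_hlog q).one_right (tau_ne_zero g)]
  simp [two_mul_zmod_two]

theorem clog_one_right (g : SL(2, ℚ_[q])) : clog g 1 = 0 := by
  have h := clog_assoc g 1 g⁻¹
  rw [clog_one_left] at h
  simp only [one_mul, mul_one, add_zero] at h
  simpa using h

end Local
end HalfIntegral

namespace HalfIntegral

section Local

variable {q : Nat.Primes}

/-! ### Vanishing of Hilbert symbols -/

/-- Units of `ℤ_q`, required to be `1` modulo `4` if `q = 2`. -/
def IsGoodUnit (x : ℚ_[q]) : Prop := ‖x‖ = 1 ∧ ((q : ℕ) = 2 → ‖x - 1‖ ≤ 1 / 4)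

/-- Elements of the maximal ideal of `ℤ_q`, required to be `0` modulo `4` if `q = 2`. -/
def IsGoodLower (x : ℚ_[q]) : Prop := ‖x‖ < 1 ∧ ((q : ℕ) = 2 → ‖x‖ ≤ 1 / 4)

theorem IsGoodUnit.ne_zero {x : ℚ_[q]} (h : IsGoodUnit x) : x ≠ 0 := by
  rintro rfl
  simpa using h.1

theorem norm_le_of_add {x y : ℚ_[q]} {r : ℝ} (hx : ‖x‖ ≤ r) (hy : ‖y‖ ≤ r) : ‖x + y‖ ≤ r :=
  (Padic.nonarchimedean _ _).trans (max_le hx hy)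

theorem norm_lt_of_add {x y : ℚ_[q]} {r : ℝ} (hx : ‖x‖ < r) (hy : ‖y‖ < r) : ‖x + y‖ < r :=
  (Padic.nonarchimedean _ _).trans_lt (max_lt hx hy)

theorem isGoodUnit_one : IsGoodUnit (1 : ℚ_[q]) := ⟨norm_one, fun _ => by simp⟩

theorem isGoodLower_zero : IsGoodLower (0 : ℚ_[q]) := ⟨by simp, fun _ => by simp⟩

theorem IsGoodLower.mul_left {x y : ℚ_[q]} (hy : IsGoodLower y) (hx : ‖x‖ ≤ 1) :
    IsGoodLower (x * y) := by
  constructor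
  · rw [norm_mul]; exact (mul_le_of_le_one_left (norm_nonneg _) hx).trans_lt hy.1
  · intro h; rw [norm_mul]; exact (mul_le_of_le_one_left (norm_nonneg _) hx).trans (hy.2 h)

theorem IsGoodLower.mul_right {x y : ℚ_[q]} (hx : IsGoodLower x) (hy : ‖y‖ ≤ 1) :
    IsGoodLower (x * y) := by rw [mul_comm]; exact hx.mul_left hy

theorem IsGoodLower.add {x y : ℚ_[q]} (hx : IsGoodLower x) (hy : IsGoodLower y) :
    IsGoodLower (x + y) :=
  ⟨norm_lt_of_add hx.1 hy.1, fun h => norm_le_of_add (hx.2 h) (hy.2 h)⟩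

theorem IsGoodLower.neg {x : ℚ_[q]} (hx : IsGoodLower x) : IsGoodLower (-x) := by
  simpa [IsGoodLower] using hx

theorem IsGoodUnit.add {x y : ℚ_[q]} (hx : IsGoodUnit x) (hy : IsGoodLower y) :
    IsGoodUnit (x + y) := by
  constructor
  · rw [Padic.add_eq_max_of_ne (by rw [hx.1]; exact hy.1.ne'), hx.1, max_eq_left hy.1.le]
  · intro h
    rw [show x + y - 1 = (x - 1) + y by ring]
    exact norm_le_of_add (hx.2 h) (hy.2 h)

theorem IsGoodUnit.mul {x y : ℚ_[q]} (hx : IsGoodUnit x) (hy : IsGoodUnit y) :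
    IsGoodUnit (x * y) := by
  constructor
  · rw [norm_mul, hx.1, hy.1, mul_one]
  · intro h
    rw [show x * y - 1 = x * (y - 1) + (x - 1) by ring]
    refine norm_le_of_add ?_ (hx.2 h)
    rw [norm_mul, hx.1, one_mul]; exact hy.2 h

theorem IsGoodUnit.inv {x : ℚ_[q]} (hx : IsGoodUnit x) : IsGoodUnit x⁻¹ := by
  constructor
  · rw [norm_inv, hx.1, inv_one]
  · intro h
    rw [show x⁻¹ - 1 = -(x⁻¹ * (x - 1)) by have := hx.ne_zero; field_simp; ring, norm_neg, norm_mul,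
      norm_inv, hx.1, inv_one, one_mul]
    exact hx.2 h

theorem valuation_eq_zero_of_norm {x : ℚ_[q]} (hx : ‖x‖ = 1) : x.valuation = 0 :=
  valuation_unit (u := ⟨x, hx.le⟩) (PadicInt.isUnit_iff.2 hx)

/-- An integral element of `ℚ_q` as an element of `ℤ_q`. -/
def toIntegral (x : ℚ_[q]) (hx : ‖x‖ ≤ 1) : ℤ_[q] := ⟨x, hx⟩

@[simp] theorem coe_toIntegral (x : ℚ_[q]) (hx : ‖x‖ ≤ 1) : (toIntegral x hx : ℚ_[q]) = x := rfl

theorem norm_toIntegral (x : ℚ_[q]) (hx : ‖x‖ ≤ 1) : ‖toIntegral x hx‖ = ‖x‖ := rfl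

theorem norm_le_two_pow {x : ℚ_[q]} (hq : (q : ℕ) = 2) (hx : ‖x‖ ≤ 1) (n : ℕ) :
    ‖x‖ ≤ (1 / 2) ^ n ↔ PadicInt.toZModPow n (toIntegral x hx) = 0 := by
  rw [← RingHom.mem_ker, PadicInt.ker_toZModPow, ← PadicInt.norm_le_pow_iff_mem_span_pow]
  have hqr : ((q : ℕ) : ℝ) = 2 := by rw [hq]; norm_num
  rw [norm_toIntegral, zpow_neg, zpow_natCast, hqr, one_div, inv_pow]

/-- A unit pairs with y only through the parity of the valuation of y. At 2 there is the extra
factor (-1)^{(u-1)(v-1)/4}, which the condition x ≡ 1 mod 4 removes. -/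
theorem hlog_eq_zero_of_even {x y : ℚ_[q]} (hx : IsGoodUnit x) (hy : y ≠ 0)
    (h : Even y.valuation) : hlog x y = 0 := by
  have hu : IsUnit (toIntegral x hx.1.le) := PadicInt.isUnit_iff.2 hx.1
  obtain ⟨v, hv, ey⟩ := exists_unit_mul_zpow hy
  generalize y.valuation = t at ey h
  have ex : x = (toIntegral x hx.1.le : ℚ_[q]) * ((q : ℕ) : ℚ_[q]) ^ (0 : ℤ) := by simp
  have ht : (t : ZMod 2) = 0 := (ZMod.intCast_zmod_eq_zero_iff_dvd t 2).2 h.two_dvd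
  by_cases hq : (q : ℕ) = 2
  · have h4 : unitFour (toIntegral x hx.1.le) v = 1 := by
      have h1 : ‖x - 1‖ ≤ (1 / 2) ^ 2 := by have := hx.2 hq; norm_num at this ⊢; exact this
      have h1' : ‖x - 1‖ ≤ 1 := h1.trans (by norm_num)
      have h2 := (norm_le_two_pow hq h1' 2).1 h1
      have h3 : toIntegral (x - 1) h1' = toIntegral x hx.1.le - 1 := rfl
      rw [h3, map_sub, map_one, sub_eq_zero] at h2
      rw [unitFour, h2, if_neg]
      rintro ⟨h, -⟩
      obtain rfl := eq_two hq
      exact absurd h (by decide : (1 : ZMod 4) ≠ 3)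
    rw [ex, ey, hlog_two hq hu hv, h4, ht]; simp
  · rw [ex, ey, hlog_odd hq hu hv, ht]; simp

/-- The element 1 + bc is congruent to 1 modulo q, and modulo 8 if q = 2, so it behaves like a
square and is orthogonal to everything. -/
theorem hlog_one_add_mul {b c y : ℚ_[q]} (hc : IsGoodLower c) (ho : Odd c.valuation)
    (hb : ‖b‖ ≤ 1) (hy : y ≠ 0) : hlog (1 + b * c) y = 0 := by
  have hbc := hc.mul_left hb
  have hx := isGoodUnit_one.add hbc
  have hu : IsUnit (toIntegral (1 + b * c) hx.1.le) := PadicInt.isUnit_iff.2 hx.1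
  obtain ⟨v, hv, ey⟩ := exists_unit_mul_zpow hy
  generalize y.valuation = t at ey
  have ex : 1 + b * c =
    (toIntegral (1 + b * c) hx.1.le : ℚ_[q]) * ((q : ℕ) : ℚ_[q]) ^ (0 : ℤ) := by simp
  have h3 : toIntegral (1 + b * c) hx.1.le = 1 + toIntegral (b * c) hbc.1.le := rfl
  by_cases hq : (q : ℕ) = 2
  · have hc0 : c ≠ 0 := by rintro rfl; simp at ho
    -- The valuation of c is at least 2 and odd, hence at least 3.
    have hc8 : ‖c‖ ≤ (1 / 2) ^ 3 := by
      have h4 := hc.2 hq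
      have hqr : ((q : ℕ) : ℝ) = 2 := by rw [hq]; norm_num
      rw [Padic.norm_eq_zpow_neg_valuation hc0, hqr] at h4 ⊢
      have e2 : (1 / 4 : ℝ) = (2 : ℝ) ^ (-2 : ℤ) := by norm_num
      have e3 : (1 / 2 : ℝ) ^ 3 = (2 : ℝ) ^ (-3 : ℤ) := by norm_num
      rw [e2] at h4
      rw [e3]
      have h1 : (1 : ℝ) < 2 := by norm_num
      rw [zpow_le_zpow_iff_right₀ h1] at h4 ⊢
      obtain ⟨m, hm⟩ := ho
      omega
    have h8 : ‖b * c‖ ≤ (1 / 2) ^ 3 := by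
      rw [norm_mul]; exact (mul_le_of_le_one_left (norm_nonneg _) hb).trans hc8
    have h2 := (norm_le_two_pow hq hbc.1.le 3).1 h8
    have h4 : unitTwo (toIntegral (1 + b * c) hx.1.le) = 1 := by
      rw [unitTwo, h3, map_add, h2, map_one, add_zero, if_pos (Or.inl rfl)]
    have h5 : unitFour (toIntegral (1 + b * c) hx.1.le) v = 1 := by
      have := (norm_le_two_pow hq hbc.1.le 2).1 (h8.trans (by norm_num))
      rw [unitFour, h3, map_add, this, map_one, add_zero, if_neg]
      rintro ⟨h, -⟩
      obtain rfl := eq_two hq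
      exact absurd h (by decide : (1 : ZMod 4) ≠ 3)
    rw [ex, ey, hlog_two hq hu hv, h4, h5]; simp
  · have : unitResidue (toIntegral (1 + b * c) hx.1.le) = 1 := by
      refine unitResidue_of_toZMod_eq_one ?_
      rw [h3, map_add, map_one, toZMod_of_norm_lt (x := toIntegral (b * c) hbc.1.le) hbc.1, add_zero]
    rw [ex, ey, hlog_odd hq hu hv, this]; simp

/-! ### The cocycle on congruence subgroups -/

/-- The lower triangular matrix `(1, 0; u, 1)`. -/
def lowerSL {R : Type*} [CommRing R] (u : R) : SL(2, R) :=
  ⟨!![1, 0; u, 1], by simp [Matrix.det_fin_two]⟩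

/-- The upper triangular matrix `(1, u; 0, 1)`. -/
def upperSL {R : Type*} [CommRing R] (u : R) : SL(2, R) :=
  ⟨!![1, u; 0, 1], by simp [Matrix.det_fin_two]⟩

/-- The diagonal matrix `(t⁻¹, 0; 0, t)`. -/
def torusSL {K : Type*} [Field K] (t : K) (ht : t ≠ 0) : SL(2, K) :=
  ⟨!![t⁻¹, 0; 0, t], by simp [Matrix.det_fin_two, ht]⟩

/-- The matrix `(0, 1; -1, 0)`. -/
def weylSL {R : Type*} [CommRing R] : SL(2, R) :=
  ⟨!![0, 1; -1, 0], by simp [Matrix.det_fin_two]⟩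

section Entries

variable {R : Type*} [CommRing R] (u : R)

@[simp] theorem lowerSL_zero_zero : lowerSL u 0 0 = 1 := rfl
@[simp] theorem lowerSL_zero_one : lowerSL u 0 1 = 0 := rfl
@[simp] theorem lowerSL_one_zero : lowerSL u 1 0 = u := rfl
@[simp] theorem lowerSL_one_one : lowerSL u 1 1 = 1 := rfl
@[simp] theorem upperSL_zero_zero : upperSL u 0 0 = 1 := rfl
@[simp] theorem upperSL_zero_one : upperSL u 0 1 = u := rfl
@[simp] theorem upperSL_one_zero : upperSL u 1 0 = 0 := rfl
@[simp] theorem upperSL_one_one : upperSL u 1 1 = 1 := rfl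
@[simp] theorem weylSL_zero_zero : (weylSL : SL(2, R)) 0 0 = 0 := rfl
@[simp] theorem weylSL_zero_one : (weylSL : SL(2, R)) 0 1 = 1 := rfl
@[simp] theorem weylSL_one_zero : (weylSL : SL(2, R)) 1 0 = -1 := rfl
@[simp] theorem weylSL_one_one : (weylSL : SL(2, R)) 1 1 = 0 := rfl

variable {K : Type*} [Field K] (t : K) (ht : t ≠ 0)

@[simp] theorem torusSL_zero_zero : torusSL t ht 0 0 = t⁻¹ := rfl
@[simp] theorem torusSL_zero_one : torusSL t ht 0 1 = 0 := rfl
@[simp] theorem torusSL_one_zero : torusSL t ht 1 0 = 0 := rfl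
@[simp] theorem torusSL_one_one : torusSL t ht 1 1 = t := rfl

end Entries

theorem slog_congr {g h : SL(2, ℚ_[q])} (h0 : g 1 0 = h 1 0) (h1 : g 1 1 = h 1 1) :
    slog g = slog h := by
  rw [slog, slog, sLocal, sLocal, h0, h1]

theorem clog_upper (b : ℚ_[q]) (h : SL(2, ℚ_[q])) : clog (upperSL b) h = 0 := by
  have e0 : (upperSL b * h) 1 0 = h 1 0 := by rw [sl_mul_one_zero]; simp
  have e1 : (upperSL b * h) 1 1 = h 1 1 := by rw [sl_mul_one_one]; simp
  have e2 : slog (upperSL b * h) = slog h := slog_congr e0 e1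
  rw [clog_eq, kubota_left (isSymbol_hlog q) (by simp), e2,
    slog_of_zero (g := upperSL b) (by simp), tau_of_eq (g := upperSL b) (by simp),
    upperSL_one_one, (isSymbol_hlog q).one_right (tau_ne_zero h), add_zero, zero_add, two_mul_zmod_two]

/-- The Iwahori subgroup at odd `q`, and `K₁(4)` at `q = 2`. -/
structure IsGood (g : SL(2, ℚ_[q])) : Prop where
  zero_zero : IsGoodUnit (g 0 0)
  one_one : IsGoodUnit (g 1 1)
  one_zero : IsGoodLower (g 1 0)
  zero_one : ‖g 0 1‖ ≤ 1

theorem IsGood.mul {g h : SL(2, ℚ_[q])} (hg : IsGood g) (hh : IsGood h) : IsGood (g * h) where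
  zero_zero := by
    rw [sl_mul_zero_zero]
    exact (hg.zero_zero.mul hh.zero_zero).add (hh.one_zero.mul_left hg.zero_one)
  one_one := by
    rw [sl_mul_one_one, add_comm]
    exact (hg.one_one.mul hh.one_one).add (hg.one_zero.mul_right hh.zero_one)
  one_zero := by
    rw [sl_mul_one_zero]
    exact (hg.one_zero.mul_right hh.zero_zero.1.le).add (hh.one_zero.mul_left hg.one_one.1.le)
  zero_one := by
    rw [sl_mul_zero_one]
    refine norm_le_of_add ?_ ?_
    · rw [norm_mul, hg.zero_zero.1, one_mul]; exact hh.zero_one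
    · rw [norm_mul, hh.one_one.1, mul_one]; exact hg.zero_one

theorem IsGood.inv {g : SL(2, ℚ_[q])} (hg : IsGood g) : IsGood g⁻¹ where
  zero_zero := by rw [sl_inv_zero_zero]; exact hg.one_one
  one_one := by rw [sl_inv_one_one]; exact hg.zero_zero
  one_zero := by rw [sl_inv_one_zero]; exact hg.one_zero.neg
  zero_one := by rw [sl_inv_zero_one, norm_neg]; exact hg.zero_one

theorem isGood_lower {u : ℚ_[q]} (hu : IsGoodLower u) : IsGood (lowerSL u) :=
  ⟨by simpa using isGoodUnit_one, by simpa using isGoodUnit_one,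
    by simpa using hu, by simp⟩

theorem isGood_torus {t : ℚ_[q]} (ht : IsGoodUnit t) : IsGood (torusSL t ht.ne_zero) :=
  ⟨by simpa using ht.inv, by simpa using ht,
    by simpa using isGoodLower_zero, by simp⟩

/-- This removes the parity condition from the definition of s_q. For even ord(c) the symbol (a, c)
vanishes anyway; for odd ord(c), ad = 1 + bc is orthogonal to c, so (d, c) = (a, c). -/
theorem IsGood.slog_eq {g : SL(2, ℚ_[q])} (hg : IsGood g) (hc : g 1 0 ≠ 0) :
    slog g = hlog (g 0 0) (g 1 0) := by
  rcases Int.even_or_odd (g 1 0).valuation with h | h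
  · rw [slog_of_even h, hlog_eq_zero_of_even hg.zero_zero hc h]
  · rw [slog_of_odd h hg.one_one.ne_zero]
    have e := hlog_one_add_mul (b := g 0 1) hg.one_zero h hg.zero_one hc
    rw [show 1 + g 0 1 * g 1 0 = g 0 0 * g 1 1 by linear_combination -(sl_det g),
      hlog_mul_left hg.zero_zero.ne_zero hg.one_one.ne_zero hc] at e
    rw [hlog_comm]
    revert e
    generalize hlog (g 0 0) (g 1 0) = x
    generalize hlog (g 1 1) (g 1 0) = y
    revert x y; decide

theorem hlog_neg_one_of_good {a : ℚ_[q]} (ha : IsGoodUnit a) : hlog a (-1) = 0 :=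
  hlog_eq_zero_of_even ha (by simp)
    (by rw [valuation_eq_zero_of_norm (by simp)]; exact Even.zero)

-- Left multiplication by y(u) keeps the entry a and replaces c by c' = ua + c. Since s_q is the
-- symbol (a, c) on these groups, the claim becomes an identity between symbols of a, u, c, c', and
-- generically it follows from the Steinberg relation for ua/c' and c/c'.
set_option linter.unusedSimpArgs false in
theorem clog_lower {u : ℚ_[q]} (hu : IsGoodLower u) {h : SL(2, ℚ_[q])} (hh : IsGood h) :
    clog (lowerSL u) h = 0 := by
  have hH := isSymbol_hlog q
  by_cases hu0 : u = 0
  · have : lowerSL u = 1 := by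
      subst hu0; ext i j; fin_cases i <;> fin_cases j <;> rfl
    rw [this, clog_one_left]
  have e0 : (lowerSL u * h) 1 0 = u * h 0 0 + h 1 0 := by rw [sl_mul_one_zero]; simp
  have e00 : (lowerSL u * h) 0 0 = h 0 0 := by rw [sl_mul_zero_zero]; simp
  have hy := (isGood_lower hu).mul hh
  have ha := hh.zero_zero.ne_zero
  have ha1 := hlog_neg_one_of_good hh.zero_zero
  have ty : tau (lowerSL u) = u := tau_of_ne (by simpa using hu0)
  have sy : slog (lowerSL u) = 0 := by
    rw [(isGood_lower hu).slog_eq (by simpa using hu0)]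
    exact hH.one_left hu0
  rw [clog_eq, kubota, ty, sy]
  have h1 : (-1 : ℚ_[q]) ≠ 0 := by simp
  by_cases hc : h 1 0 = 0
  · have d := sl_det h
    rw [hc, mul_zero, sub_zero] at d
    rw [hc, add_zero] at e0
    have hc' : (lowerSL u * h) 1 0 ≠ 0 := by rw [e0]; exact mul_ne_zero hu0 ha
    rw [slog_of_zero (Or.inl hc), hy.slog_eq hc', tau_of_ne hc', e0, e00, tau_of_eq hc,
      eq_inv_of_mul_eq_one_right d]
    generalize h 0 0 = a at *
    simp only [hH.mul_left, hH.mul_right, hH.inv_left, hH.inv_right, hH.self, ha, hu0, h1,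
      mul_ne_zero_iff, inv_ne_zero, ne_eq, not_false_eq_true, and_self] at ha1 ⊢
    simp only [hH.comm u a, hH.comm u (-1)] at ha1 ⊢
    grind
  by_cases hc' : (lowerSL u * h) 1 0 = 0
  · rw [e0] at hc'
    have d := sl_det (lowerSL u * h)
    rw [e0, hc', mul_zero, sub_zero, e00] at d
    rw [slog_of_zero (Or.inl (e0.trans hc')), hh.slog_eq hc, tau_of_eq (e0.trans hc'), tau_of_ne hc,
      eq_inv_of_mul_eq_one_right d, show h 1 0 = -1 * u * h 0 0 by linear_combination hc']
    generalize h 0 0 = a at *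
    simp only [hH.mul_left, hH.mul_right, hH.inv_left, hH.inv_right, hH.self, ha, hu0, h1,
      mul_ne_zero_iff, inv_ne_zero, ne_eq, not_false_eq_true, and_self] at ha1 ⊢
    simp only [hH.comm u a, hH.comm u (-1)] at ha1 ⊢
    grind
  rw [hh.slog_eq hc, hy.slog_eq hc', tau_of_ne hc', tau_of_ne hc, e00]
  have st := hH.steinberg (a := u * h 0 0 * ((lowerSL u * h) 1 0)⁻¹)
    (mul_ne_zero (mul_ne_zero hu0 ha) (inv_ne_zero hc'))
  have e2 : 1 - u * h 0 0 * ((lowerSL u * h) 1 0)⁻¹ = h 1 0 * ((lowerSL u * h) 1 0)⁻¹ := by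
    field_simp
    rw [e0]; ring
  rw [e2] at st
  have st := st (mul_ne_zero hc (inv_ne_zero hc'))
  clear e2 e0 e00
  generalize h 0 0 = a at *
  generalize h 1 0 = c at *
  generalize (lowerSL u * h) 1 0 = c' at *
  simp only [hH.mul_left, hH.mul_right, hH.inv_left, hH.inv_right, hH.self, ha, hu0, h1, hc, hc',
      mul_ne_zero_iff, inv_ne_zero, ne_eq, not_false_eq_true, and_self] at st ha1 ⊢
  simp only [hH.comm u a, hH.comm u (-1), hH.comm c a, hH.comm c' a, hH.comm c u, hH.comm c' u,
    hH.comm c' c, hH.comm c (-1), hH.comm c' (-1)] at st ha1 ⊢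
  grind

theorem torus_mul_one_zero {K : Type*} [Field K] {t : K} (ht : t ≠ 0) (h : SL(2, K)) :
    (torusSL t ht * h) 1 0 = t * h 1 0 := by rw [sl_mul_one_zero]; simp

set_option linter.unusedSimpArgs false in
theorem clog_torus {t : ℚ_[q]} (ht : IsGoodUnit t) {h : SL(2, ℚ_[q])} (hh : IsGood h) :
    clog (torusSL t ht.ne_zero) h = 0 := by
  have hH := isSymbol_hlog q
  have e0 := torus_mul_one_zero ht.ne_zero h
  have e00 : (torusSL t ht.ne_zero * h) 0 0 = t⁻¹ * h 0 0 := by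
    rw [sl_mul_zero_zero]; simp
  have hy := (isGood_torus ht).mul hh
  have ht0 := ht.ne_zero
  have tt : tau (torusSL t ht.ne_zero) = t := by rw [tau_of_eq (by simp)]; simp
  rw [clog_eq, kubota_left hH (by simp), slog_of_zero (g := torusSL t _) (by simp),
    tt]
  by_cases hc : h 1 0 = 0
  · rw [slog_of_zero (Or.inl hc), slog_of_zero (Or.inl (by rw [e0, hc, mul_zero])), tau_of_eq hc,
      hlog_eq_zero_of_even hh.one_one ht.ne_zero (by rw [valuation_eq_zero_of_norm ht.1]; exact Even.zero)]
    simp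
  · rw [hh.slog_eq hc, hy.slog_eq (by rw [e0]; exact mul_ne_zero ht.ne_zero hc), e0, e00, tau_of_ne hc]
    have ha := hh.zero_zero.ne_zero
    have e1 := hlog_neg_one_of_good ht
    have e2 := hlog_eq_zero_of_even hh.zero_zero ht.ne_zero
      (by rw [valuation_eq_zero_of_norm ht.1]; exact Even.zero)
    generalize h 0 0 = a at *
    generalize h 1 0 = c at *
    simp only [hH.mul_left, hH.mul_right, hH.inv_left, hH.inv_right, hH.self, ha, hc, ht0,
      mul_ne_zero_iff, inv_ne_zero, ne_eq, not_false_eq_true, and_self] at e1 e2 ⊢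
    simp only [hH.comm t a, hH.comm c a, hH.comm t c] at e1 e2 ⊢
    grind

theorem IsGood.decomposition {g : SL(2, ℚ_[q])} (hg : IsGood g) :
    g = upperSL (g 0 1 / g 1 1) * (torusSL (g 1 1) hg.one_one.ne_zero * lowerSL (g 1 0 / g 1 1)) := by
  have hd := hg.one_one.ne_zero
  have d := sl_det g
  apply sl_ext <;> simp only [sl_mul_zero_zero, sl_mul_zero_one, sl_mul_one_one, sl_mul_one_zero,
    upperSL_zero_zero, upperSL_zero_one, upperSL_one_zero, upperSL_one_one, torusSL_zero_zero,
    torusSL_zero_one, torusSL_one_zero, torusSL_one_one, lowerSL_zero_zero, lowerSL_zero_one,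
    lowerSL_one_zero, lowerSL_one_one] <;> field_simp
  · linear_combination d
  all_goals ring

/-- The cocycle `σ_q` is trivial on the Iwahori subgroup if `q` is odd, and on `K₁(4)` if
`q = 2`. -/
theorem IsGood.clog_eq_zero {g h : SL(2, ℚ_[q])} (hg : IsGood g) (hh : IsGood h) :
    clog g h = 0 := by
  have hu : IsGoodLower (g 1 0 / g 1 1) := by
    rw [div_eq_mul_inv]; exact hg.one_zero.mul_right hg.one_one.inv.1.le
  -- By the cocycle relation, triviality against all good h passes from two factors to their
  -- product, so it suffices to treat the unipotent and diagonal factors of g.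
  have key : ∀ h, IsGood h → clog (torusSL (g 1 1) hg.one_one.ne_zero * lowerSL (g 1 0 / g 1 1)) h
      = 0 := by
    intro h hh
    have := clog_assoc (torusSL (g 1 1) hg.one_one.ne_zero) (lowerSL (g 1 0 / g 1 1)) h
    rwa [clog_torus hg.one_one (isGood_lower hu), clog_torus hg.one_one ((isGood_lower hu).mul hh),
      clog_lower hu hh, zero_add, zero_add] at this
  have := clog_assoc (upperSL (g 0 1 / g 1 1))
    (torusSL (g 1 1) hg.one_one.ne_zero * lowerSL (g 1 0 / g 1 1)) h
  rw [clog_upper, clog_upper, key h hh, zero_add, zero_add, ← hg.decomposition] at this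
  exact this


/-! ### The cocycle on `SL₂(ℤ_q)` for odd `q` -/

theorem isGoodUnit_of_odd (hq : (q : ℕ) ≠ 2) {x : ℚ_[q]} (hx : ‖x‖ = 1) : IsGoodUnit x :=
  ⟨hx, fun h => absurd h hq⟩

theorem isGoodLower_of_odd (hq : (q : ℕ) ≠ 2) {x : ℚ_[q]} (hx : ‖x‖ < 1) : IsGoodLower x :=
  ⟨hx, fun h => absurd h hq⟩

theorem isGood_of_odd (hq : (q : ℕ) ≠ 2) {g : SL(2, ℚ_[q])} (hg : g ∈ integralSL q)
    (hc : ‖g 1 0‖ < 1) : IsGood g := by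
  have hg := mem_integralSL.1 hg
  have h1 : ‖g 0 0 * g 1 1‖ = 1 := by
    rw [show g 0 0 * g 1 1 = 1 + g 0 1 * g 1 0 by linear_combination sl_det g]
    have : ‖g 0 1 * g 1 0‖ < 1 := by
      rw [norm_mul]; exact (mul_le_of_le_one_left (norm_nonneg _) (hg 0 1)).trans_lt hc
    rw [Padic.add_eq_max_of_ne (by rw [norm_one]; exact this.ne'), norm_one, max_eq_left this.le]
  rw [norm_mul] at h1
  have h0 := hg 0 0
  have h2 := hg 1 1
  have := norm_nonneg (g 0 0)
  have := norm_nonneg (g 1 1)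
  refine ⟨isGoodUnit_of_odd hq ?_, isGoodUnit_of_odd hq ?_, isGoodLower_of_odd hq hc, hg 0 1⟩ <;>
    nlinarith

theorem even_valuation_of_norm {x : ℚ_[q]} (hx : ‖x‖ = 1) : Even x.valuation := by
  rw [valuation_eq_zero_of_norm hx]; exact Even.zero

set_option linter.unusedSimpArgs false in
theorem clog_torus_of_odd (hq : (q : ℕ) ≠ 2) {t : ℚ_[q]} (ht : ‖t‖ = 1) (ht0 : t ≠ 0)
    {h : SL(2, ℚ_[q])} (hh : h ∈ integralSL q) : clog (torusSL t ht0) h = 0 := by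
  have hi := mem_integralSL.1 hh
  rcases lt_or_eq_of_le (hi 1 0) with hc | hc
  · exact clog_torus (isGoodUnit_of_odd hq ht) (isGood_of_odd hq hh hc)
  have hc0 : h 1 0 ≠ 0 := fun h0 => by rw [h0] at hc; simp at hc
  have e0 := torus_mul_one_zero ht0 h
  rw [clog_eq, kubota_left (isSymbol_hlog q) (by simp), slog_of_zero (g := torusSL t _) (by simp),
    slog_of_even (even_valuation_of_norm hc),
    slog_of_even (even_valuation_of_norm (by rw [e0, norm_mul, ht, hc, one_mul])),
    tau_of_ne hc0, tau_of_eq (by simp), torusSL_one_one,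
    hlog_eq_zero_of_even (isGoodUnit_of_odd hq hc) ht0 (even_valuation_of_norm ht)]
  simp

set_option linter.unusedSimpArgs false in
theorem clog_weyl (hq : (q : ℕ) ≠ 2) {h : SL(2, ℚ_[q])} (hh : h ∈ integralSL q) :
    clog weylSL h = 0 := by
  have hH := isSymbol_hlog q
  have hi := mem_integralSL.1 hh
  have d := sl_det h
  have e0 : ((weylSL : SL(2, ℚ_[q])) * h) 1 0 = -h 0 0 := by rw [sl_mul_one_zero]; simp
  have e1 : ((weylSL : SL(2, ℚ_[q])) * h) 1 1 = -h 0 1 := by rw [sl_mul_one_one]; simp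
  have f0 : ((weylSL : SL(2, ℚ_[q])) * h) 0 0 = h 1 0 := by rw [sl_mul_zero_zero]; simp
  have f1 : ((weylSL : SL(2, ℚ_[q])) * h) 0 1 = h 1 1 := by rw [sl_mul_zero_one]; simp
  have hm : (-1 : ℚ_[q]) ≠ 0 := by simp
  have tw : tau (weylSL : SL(2, ℚ_[q])) = -1 := by rw [tau_of_ne (by simp)]; simp
  have hw : weylSL * h ∈ integralSL q := mem_integralSL.2 fun i j => by
    fin_cases i <;> fin_cases j
    · exact f0 ▸ hi 1 0
    · exact f1 ▸ hi 1 1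
    · change ‖((weylSL : SL(2, ℚ_[q])) * h) 1 0‖ ≤ 1; rw [e0, norm_neg]; exact hi 0 0
    · change ‖((weylSL : SL(2, ℚ_[q])) * h) 1 1‖ ≤ 1; rw [e1, norm_neg]; exact hi 0 1
  have unit_of : ∀ x y : ℚ_[q], ‖x‖ ≤ 1 → ‖y‖ ≤ 1 → ‖x * y‖ = 1 → ‖x‖ = 1 ∧ ‖y‖ = 1 := by
    intro x y hx hy hxy
    rw [norm_mul] at hxy
    have := norm_nonneg x
    have := norm_nonneg y
    constructor <;> nlinarith
  rw [clog_eq, kubota, tw, slog_of_zero (g := weylSL) (by simp)]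
  by_cases hc : h 1 0 = 0
  · rw [hc, mul_zero, sub_zero] at d
    obtain ⟨ua, ud⟩ := unit_of _ _ (hi 0 0) (hi 1 1) (by rw [d, norm_one])
    have ha0 : h 0 0 ≠ 0 := fun h0 => by rw [h0] at ua; simp at ua
    have hd0 : h 1 1 ≠ 0 := fun h0 => by rw [h0] at ud; simp at ud
    rw [slog_of_zero (Or.inl hc), slog_of_even (even_valuation_of_norm (by rwa [e0, norm_neg])),
      tau_of_eq hc, tau_of_ne (by rw [e0]; exact neg_ne_zero.2 ha0), e0,
      hlog_eq_zero_of_even (isGoodUnit_of_odd hq (by simpa using ua))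
        (mul_ne_zero (neg_ne_zero.2 ha0) hd0) (even_valuation_of_norm (by simp [ua, ud]))]
    simp
  by_cases ha : h 0 0 = 0
  · rw [ha, zero_mul, zero_sub] at d
    obtain ⟨ub, uc⟩ := unit_of _ _ (hi 0 1) (hi 1 0) (by rw [← norm_neg, d, norm_one])
    have hb0 : h 0 1 ≠ 0 := fun h0 => by rw [h0] at ub; simp at ub
    rw [slog_of_even (even_valuation_of_norm uc), slog_of_zero (Or.inl (by rw [e0, ha, neg_zero])),
      tau_of_ne hc, tau_of_eq (by rw [e0, ha, neg_zero]), e1,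
      hlog_eq_zero_of_even (isGoodUnit_of_odd hq (by simpa using ub))
        (mul_ne_zero (neg_ne_zero.2 hb0) hc) (even_valuation_of_norm (by simp [ub, uc]))]
    simp
  have hc' : ((weylSL : SL(2, ℚ_[q])) * h) 1 0 ≠ 0 := by rw [e0]; exact neg_ne_zero.2 ha
  rw [tau_of_ne hc', tau_of_ne hc, e0]
  have main : hlog (-h 0 0 * -1) (-h 0 0 * h 1 0) = hlog (h 0 0) (h 1 0) := by
    have := hH.self ha
    generalize h 0 0 = a at *
    generalize h 1 0 = c at *
    rw [show -a * -1 = a by ring, show -a * c = -1 * (a * c) by ring, hH.mul_right ha hm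
      (mul_ne_zero ha hc), hH.mul_right ha ha hc, this]
    generalize hlog a (-1) = x
    generalize hlog a c = y
    revert x y; decide
  rw [main, add_zero]
  -- As ad - bc = 1, one of a and c is a unit. If c is not, s_q(h) = (a, c) cancels the Kubota term;
  -- if a is not, s_q of the product does so; if both are units, every symbol is trivial.
  have u1 : ‖h 0 0 * h 1 1 - h 0 1 * h 1 0‖ ≤ max ‖h 0 0‖ ‖h 1 0‖ := by
    rw [sub_eq_add_neg]
    refine (Padic.nonarchimedean _ _).trans (max_le_max ?_ ?_)
    · rw [norm_mul]; exact mul_le_of_le_one_right (norm_nonneg _) (hi 1 1)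
    · rw [norm_neg, norm_mul]; exact mul_le_of_le_one_left (norm_nonneg _) (hi 0 1)
  rw [d, norm_one] at u1
  rcases lt_or_eq_of_le (hi 1 0) with hcl | hcu
  · have hau : ‖h 0 0‖ = 1 := by
      rcases le_max_iff.1 u1 with h' | h'
      · exact le_antisymm (hi 0 0) h'
      · exact absurd h' (not_le.2 hcl)
    rw [(isGood_of_odd hq hh hcl).slog_eq hc,
      slog_of_even (even_valuation_of_norm (by rwa [e0, norm_neg])), add_zero, two_mul_zmod_two]
  rw [slog_of_even (even_valuation_of_norm hcu), add_zero]
  rcases lt_or_eq_of_le (hi 0 0) with hal | hau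
  · rw [(isGood_of_odd hq hw (by rwa [e0, norm_neg])).slog_eq hc', e0, f0,
      show -h 0 0 = h 0 0 * -1 by ring, hH.mul_right hc ha hm,
      hlog_neg_one_of_good (isGoodUnit_of_odd hq hcu), add_zero, hlog_comm, two_mul_zmod_two]
  · rw [slog_of_even (even_valuation_of_norm (by rwa [e0, norm_neg])),
      hlog_eq_zero_of_even (isGoodUnit_of_odd hq hau) hc (even_valuation_of_norm hcu), add_zero]

theorem clog_mul_eq_zero {g₁ g₂ : SL(2, ℚ_[q])} (h₁ : ∀ h ∈ integralSL q, clog g₁ h = 0)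
    (h₂ : ∀ h ∈ integralSL q, clog g₂ h = 0) (m₂ : g₂ ∈ integralSL q) :
    ∀ h ∈ integralSL q, clog (g₁ * g₂) h = 0 := by
  intro h hh
  have := clog_assoc g₁ g₂ h
  rwa [h₁ _ m₂, h₁ _ (mul_mem m₂ hh), h₂ h hh, zero_add, zero_add] at this

theorem upper_mem_integralSL {b : ℚ_[q]} (hb : ‖b‖ ≤ 1) : upperSL b ∈ integralSL q :=
  mem_integralSL.2 fun i j => by fin_cases i <;> fin_cases j <;> simp [upperSL, hb]

theorem torus_mem_integralSL {t : ℚ_[q]} (ht : ‖t‖ = 1) (ht0 : t ≠ 0) :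
    torusSL t ht0 ∈ integralSL q :=
  mem_integralSL.2 fun i j => by fin_cases i <;> fin_cases j <;> simp [torusSL, ht]

theorem weyl_mem_integralSL : weylSL ∈ integralSL q :=
  mem_integralSL.2 fun i j => by fin_cases i <;> fin_cases j <;> simp [weylSL]

/-- The cocycle `σ_q` is trivial on `SL₂(ℤ_q)` for odd `q`. -/
theorem clog_eq_zero_of_odd (hq : (q : ℕ) ≠ 2) {g : SL(2, ℚ_[q])} (hg : g ∈ integralSL q) :
    ∀ h ∈ integralSL q, clog g h = 0 := by
  -- If c is a unit, the Bruhat decomposition of g has integral factors, and the cocycle is trivial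
  -- on each of them.
  have key : ∀ g ∈ integralSL q, ‖g 1 0‖ = 1 → ∀ h ∈ integralSL q, clog g h = 0 := by
    intro g hg hc
    have hi := mem_integralSL.1 hg
    have hc0 : g 1 0 ≠ 0 := fun h0 => by rw [h0] at hc; simp at hc
    have hn : ‖-g 1 0‖ = 1 := by rwa [norm_neg]
    have hd : ‖g 1 1 / g 1 0‖ ≤ 1 := by rw [norm_div, hc, div_one]; exact hi 1 1
    have e : g = upperSL (g 0 0 / g 1 0) * (torusSL (-g 1 0) (neg_ne_zero.2 hc0) *
        (weylSL * upperSL (g 1 1 / g 1 0))) := by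
      have d := sl_det g
      apply sl_ext <;> simp only [sl_mul_zero_zero, sl_mul_zero_one, sl_mul_one_one,
        sl_mul_one_zero, upperSL_zero_zero, upperSL_zero_one, upperSL_one_zero, upperSL_one_one,
        torusSL_zero_zero, torusSL_zero_one, torusSL_one_zero, torusSL_one_one, weylSL_zero_zero,
        weylSL_zero_one, weylSL_one_zero, weylSL_one_one] <;> field_simp
      · ring
      · linear_combination (-g 1 0) * d
      all_goals ring
    rw [e]
    have m3 := upper_mem_integralSL hd
    have m2 := mul_mem (weyl_mem_integralSL (q := q)) m3
    exact clog_mul_eq_zero (fun h _ => clog_upper _ h) (clog_mul_eq_zero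
      (fun h => clog_torus_of_odd hq hn _) (clog_mul_eq_zero (fun h => clog_weyl hq)
        (fun h _ => clog_upper _ h) m3) m2)
      (mul_mem (torus_mem_integralSL hn _) m2)
  have hi := mem_integralSL.1 hg
  rcases lt_or_eq_of_le (hi 1 0) with hcl | hcu
  · have hw := mul_mem (weyl_mem_integralSL (q := q)) hg
    have ha := (isGood_of_odd hq hg hcl).zero_zero.1
    have kw := key _ hw (by rw [sl_mul_one_zero]; simpa using ha)
    have m1 : weylSL ∈ integralSL q := weyl_mem_integralSL
    -- If c is not a unit, then a is, so wg falls under the first case. The same holds for w³, and g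
    -- = w³ (wg) because w⁴ = 1.
    have k1 := key (weylSL * (weylSL * weylSL)) (mul_mem m1 (mul_mem m1 m1)) (by
      simp [sl_mul_one_zero, sl_mul_zero_zero])
    have e : g = weylSL * (weylSL * weylSL) * (weylSL * g) := by
      apply sl_ext <;> simp [sl_mul_zero_zero, sl_mul_zero_one, sl_mul_one_one, sl_mul_one_zero]
    rw [e]
    exact clog_mul_eq_zero k1 kw hw
  · exact key g hg hcu

end Local
end HalfIntegral

namespace HalfIntegral

/-! ### The product formula for the Hilbert symbol -/

/-- The additive form of the real Hilbert symbol. -/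
noncomputable def rlog (a b : ℝ) : ZMod 2 := signLog (hilbertReal a b)

theorem rlog_eq (a b : ℝ) : rlog a b = if a < 0 ∧ b < 0 then 1 else 0 := by
  rw [rlog, hilbertReal]
  split_ifs <;> rfl

theorem rlog_comm (a b : ℝ) : rlog a b = rlog b a := by
  simp only [rlog_eq, and_comm]

theorem rlog_mul_left {a b c : ℝ} (ha : a ≠ 0) (hb : b ≠ 0) (_ : c ≠ 0) :
    rlog (a * b) c = rlog a c + rlog b c := by
  simp only [rlog_eq]
  rcases lt_or_gt_of_ne ha with h1 | h1 <;> rcases lt_or_gt_of_ne hb with h2 | h2 <;>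
    by_cases h3 : c < 0
  · rw [if_neg (fun h => (mul_pos_of_neg_of_neg h1 h2).not_gt h.1), if_pos ⟨h1, h3⟩,
      if_pos ⟨h2, h3⟩]
    rfl
  · simp [h3]
  · simp [h1, h2.le, h3, mul_neg_of_neg_of_pos h1 h2]
  · simp [h3]
  · simp [h1.le, h2, h3, mul_neg_of_pos_of_neg h1 h2]
  · simp [h3]
  · rw [if_neg (fun h => (mul_pos h1 h2).not_gt h.1), if_neg (fun h => h1.not_gt h.1),
      if_neg (fun h => h2.not_gt h.1), add_zero]
  · simp [h3]

theorem rlog_neg_self {a : ℝ} (_ : a ≠ 0) : rlog a (-a) = 0 := by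
  rw [rlog_eq, if_neg]; rintro ⟨h1, h2⟩; linarith

theorem rlog_steinberg {a : ℝ} (_ : a ≠ 0) (_ : 1 - a ≠ 0) : rlog a (1 - a) = 0 := by
  rw [rlog_eq, if_neg]; rintro ⟨h1, h2⟩; linarith

theorem isSymbol_rlog : IsSymbol rlog := ⟨rlog_mul_left, rlog_comm, rlog_neg_self, rlog_steinberg⟩

theorem hlog_eq_zero_of_units {q : Nat.Primes} (hq : (q : ℕ) ≠ 2) {a b : ℚ_[q]} (ha : ‖a‖ = 1)
    (hb : ‖b‖ = 1) : hlog a b = 0 :=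
  hlog_eq_zero_of_even (isGoodUnit_of_odd hq ha) (fun h => by rw [h] at hb; simp at hb)
    (even_valuation_of_norm hb)

theorem eventually_norm_eq_one {a : ℚ} (ha : a ≠ 0) :
    ∀ᶠ q : Nat.Primes in Filter.cofinite, ‖(a : ℚ_[q])‖ = 1 := by
  filter_upwards [rat_integral a, rat_integral a⁻¹] with q h1 h2
  refine le_antisymm h1 ?_
  have h0 : (a : ℚ_[q]) ≠ 0 := by exact_mod_cast ha
  rw [Rat.cast_inv, norm_inv] at h2
  exact (inv_le_one₀ (norm_pos_iff.2 h0)).1 h2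

theorem eventually_odd : ∀ᶠ q : Nat.Primes in Filter.cofinite, (q : ℕ) ≠ 2 := by
  have : {q : Nat.Primes | (q : ℕ) = 2}.Finite :=
    (Set.finite_singleton (⟨2, Nat.prime_two⟩ : Nat.Primes)).subset fun q hq => eq_two hq
  exact this.compl_mem_cofinite

theorem finite_support_hlog {a b : ℚ} (ha : a ≠ 0) (hb : b ≠ 0) :
    (Function.support fun q : Nat.Primes => hlog (a : ℚ_[q]) (b : ℚ_[q])).Finite := by
  have : ∀ᶠ q : Nat.Primes in Filter.cofinite, hlog (a : ℚ_[q]) (b : ℚ_[q]) = 0 := by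
    filter_upwards [eventually_norm_eq_one ha, eventually_norm_eq_one hb, eventually_odd]
      with q h1 h2 h3
    exact hlog_eq_zero_of_units h3 h1 h2
  exact this

/-- The sum of the local Hilbert symbols over all places. -/
noncomputable def globalSymbol (a b : ℚ) : ZMod 2 :=
  rlog a b + ∑ᶠ q : Nat.Primes, hlog (a : ℚ_[q]) (b : ℚ_[q])

theorem globalSymbol_mul_left {a b c : ℚ} (ha : a ≠ 0) (hb : b ≠ 0) (hc : c ≠ 0) :
    globalSymbol (a * b) c = globalSymbol a c + globalSymbol b c := by
  have hf : ∀ q : Nat.Primes, hlog ((a * b : ℚ) : ℚ_[q]) (c : ℚ_[q]) =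
      hlog (a : ℚ_[q]) (c : ℚ_[q]) + hlog (b : ℚ_[q]) (c : ℚ_[q]) := fun q => by
    rw [Rat.cast_mul, hlog_mul_left] <;> exact_mod_cast ‹_›
  have hr : rlog ((a * b : ℚ) : ℝ) c = rlog a c + rlog b c := by
    rw [Rat.cast_mul, rlog_mul_left] <;> exact_mod_cast ‹_›
  rw [globalSymbol, hr, finsum_congr hf, finsum_add_distrib (finite_support_hlog ha hc)
    (finite_support_hlog hb hc), globalSymbol, globalSymbol]
  ring

theorem globalSymbol_comm (a b : ℚ) : globalSymbol a b = globalSymbol b a := by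
  rw [globalSymbol, globalSymbol, rlog_comm]
  exact congrArg _ (finsum_congr fun q => hlog_comm _ _)

theorem globalSymbol_self {a : ℚ} (ha : a ≠ 0) : globalSymbol a a = globalSymbol a (-1) := by
  rw [globalSymbol, globalSymbol, isSymbol_rlog.self (by exact_mod_cast ha)]
  congr 1
  · norm_num
  · exact finsum_congr fun q => by
      rw [(isSymbol_hlog q).self (by exact_mod_cast ha)]; norm_num

theorem globalSymbol_inv_left {a b : ℚ} (ha : a ≠ 0) (hb : b ≠ 0) :
    globalSymbol a⁻¹ b = globalSymbol a b := by
  have h1 := globalSymbol_mul_left (one_ne_zero) (one_ne_zero (α := ℚ)) hb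
  have h2 := globalSymbol_mul_left (inv_ne_zero ha) ha hb
  rw [mul_one] at h1
  rw [inv_mul_cancel₀ ha] at h2
  revert h1 h2
  generalize globalSymbol 1 b = x
  generalize globalSymbol a⁻¹ b = y
  generalize globalSymbol a b = z
  revert x y z; decide

theorem rat_induction {P : ℚ → Prop} (neg_one : P (-1)) (prime : ∀ q : Nat.Primes, P (q : ℕ))
    (mul : ∀ a b, a ≠ 0 → b ≠ 0 → P a → P b → P (a * b)) (inv : ∀ a, a ≠ 0 → P a → P a⁻¹)
    (a : ℚ) (ha : a ≠ 0) : P a := by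
  have one : P 1 := by
    have := mul _ _ (by norm_num) (by norm_num) neg_one neg_one
    norm_num at this; exact this
  have nat : ∀ n : ℕ, n ≠ 0 → P n := by
    intro n
    induction n using Nat.recOnMul with
    | zero => intro h; exact absurd rfl h
    | one => intro _; simpa using one
    | prime p hp => intro _; exact prime ⟨p, hp⟩
    | mul a b iha ihb =>
      intro h
      have h1 := left_ne_zero_of_mul h
      have h2 := right_ne_zero_of_mul h
      push_cast
      exact mul _ _ (by exact_mod_cast h1) (by exact_mod_cast h2) (iha h1) (ihb h2)
  have int : ∀ n : ℤ, n ≠ 0 → P n := by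
    intro n hn
    have hn' := nat n.natAbs (Int.natAbs_ne_zero.2 hn)
    rcases Int.natAbs_eq n with h | h
    · rw [h, Int.cast_natCast]; exact hn'
    · have := mul _ _ (by norm_num) (by exact_mod_cast Int.natAbs_ne_zero.2 hn) neg_one hn'
      rw [h, Int.cast_neg, Int.cast_natCast]
      rwa [neg_one_mul] at this
  have hd : (a.den : ℚ) ≠ 0 := by exact_mod_cast a.den_ne_zero
  rw [← Rat.num_div_den a, div_eq_mul_inv]
  exact mul _ _ (by exact_mod_cast Rat.num_ne_zero.2 ha) (inv_ne_zero hd)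
    (int _ (Rat.num_ne_zero.2 ha)) (inv _ hd (nat _ a.den_ne_zero))

/-! ### Hilbert symbols of integers. -/

section Values

variable {q : Nat.Primes}

theorem isUnit_intCast {n : ℤ} (hn : ¬ ((q : ℕ) : ℤ) ∣ n) : IsUnit (n : ℤ_[q]) := by
  rw [PadicInt.isUnit_iff]
  refine le_antisymm (PadicInt.norm_le_one _) (not_lt.1 fun h => hn ?_)
  exact PadicInt.norm_int_lt_one_iff_dvd _ |>.1 h

theorem unitResidue_intCast {n : ℤ} (hn : ¬ ((q : ℕ) : ℤ) ∣ n) :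
    ((unitResidue (n : ℤ_[q]) : ℤˣ) : ℤ) = legendreSym q n := by
  rw [unitResidue_eq _ (isUnit_intCast hn), legendreSym, map_intCast]

theorem hlog_intCast_prime (hq : (q : ℕ) ≠ 2) {n : ℤ} (hn : ¬ ((q : ℕ) : ℤ) ∣ n) :
    hlog (n : ℚ_[q]) ((q : ℕ) : ℚ_[q]) = signLog (unitResidue (n : ℤ_[q])) := by
  have := hlog_odd hq (isUnit_intCast hn) isUnit_one 0 1
  simpa using this

theorem norm_intCast_eq_one {n : ℤ} (hn : ¬ ((q : ℕ) : ℤ) ∣ n) : ‖(n : ℚ_[q])‖ = 1 := by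
  have := PadicInt.isUnit_iff.1 (isUnit_intCast hn)
  simpa [PadicInt.norm_def] using this

theorem hlog_two_intCast (hq : (q : ℕ) = 2) {m n : ℤ} (hm : ¬ (2 : ℤ) ∣ m) (hn : ¬ (2 : ℤ) ∣ n) :
    hlog (m : ℚ_[q]) (n : ℚ_[q]) = if m % 4 = 3 ∧ n % 4 = 3 then 1 else 0 := by
  have hq' : ((q : ℕ) : ℤ) = 2 := by exact_mod_cast hq
  have := hlog_two hq (isUnit_intCast (q := q) (n := m) (by rwa [hq'])) (isUnit_intCast (q := q) (n := n)
    (by rwa [hq'])) 0 0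
  simp only [zpow_zero, mul_one, Int.cast_zero, zero_mul, add_zero, PadicInt.coe_intCast] at this
  rw [this]
  have e : ∀ k : ℤ, PadicInt.toZModPow 2 (k : ℤ_[q]) = 3 ↔ k % 4 = 3 := by
    intro k
    rw [map_intCast]
    obtain rfl := eq_two hq
    have h3 : ((3 : ℤ) : ZMod ((2 : ℕ) ^ 2)) = 3 := by norm_num
    change (k : ZMod ((2 : ℕ) ^ 2)) = 3 ↔ _
    rw [← h3, ZMod.intCast_eq_intCast_iff_dvd_sub]
    push_cast
    omega
  simp only [unitFour, e]
  split_ifs <;> rfl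

theorem hlog_two_intCast_prime (hq : (q : ℕ) = 2) {m : ℤ} (hm : ¬ (2 : ℤ) ∣ m) :
    hlog (m : ℚ_[q]) ((q : ℕ) : ℚ_[q]) = if m % 8 = 1 ∨ m % 8 = 7 then 0 else 1 := by
  have hq' : ((q : ℕ) : ℤ) = 2 := by exact_mod_cast hq
  have := hlog_two hq (isUnit_intCast (q := q) (n := m) (by rwa [hq'])) isUnit_one 0 1
  simp only [zpow_zero, mul_one, Int.cast_zero, zero_mul, add_zero, PadicInt.coe_intCast,
    PadicInt.coe_one, zpow_one, one_mul, Int.cast_one] at this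
  rw [this]
  have e : ∀ k l : ℤ, PadicInt.toZModPow 3 (k : ℤ_[q]) = (l : ZMod _) ↔ k % 8 = l % 8 := by
    intro k l
    rw [map_intCast]
    obtain rfl := eq_two hq
    change (k : ZMod ((2 : ℕ) ^ 3)) = l ↔ _
    rw [ZMod.intCast_eq_intCast_iff_dvd_sub]
    push_cast
    omega
  have e1 := e m 1
  have e7 := e m 7
  push_cast at e1 e7
  have f : PadicInt.toZModPow 2 (1 : ℤ_[q]) ≠ 3 := by
    rw [map_one]
    obtain rfl := eq_two hq
    exact (by decide : (1 : ZMod 4) ≠ 3)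
  simp only [unitFour, f, and_false, if_false, unitTwo, e1, e7]
  norm_num
  split_ifs <;> rfl

end Values

theorem not_prime_dvd {q r : Nat.Primes} (h : q ≠ r) : ¬ ((q : ℕ) : ℤ) ∣ ((r : ℕ) : ℤ) := by
  intro hd
  exact h (Subtype.ext ((Nat.prime_dvd_prime_iff_eq q.2 r.2).1 (by exact_mod_cast hd)))

theorem not_prime_dvd_neg_one (q : Nat.Primes) : ¬ ((q : ℕ) : ℤ) ∣ -1 := by
  rw [dvd_neg]
  intro hd
  exact q.2.one_lt.ne' (by exact_mod_cast Int.eq_one_of_dvd_one (by positivity) hd)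

theorem hlog_eq_zero_away {q : Nat.Primes} (hq : (q : ℕ) ≠ 2) {m n : ℤ}
    (hm : ¬ ((q : ℕ) : ℤ) ∣ m) (hn : ¬ ((q : ℕ) : ℤ) ∣ n) : hlog (m : ℚ_[q]) (n : ℚ_[q]) = 0 :=
  hlog_eq_zero_of_units hq (norm_intCast_eq_one hm) (norm_intCast_eq_one hn)

/-- The prime `2`. -/
def twoPrime : Nat.Primes := ⟨2, Nat.prime_two⟩

theorem finsum_eq_three {f : Nat.Primes → ZMod 2} {r s : Nat.Primes} (hr : r ≠ twoPrime)
    (hs : s ≠ twoPrime) (hrs : r ≠ s) (hf : ∀ q, q ≠ twoPrime → q ≠ r → q ≠ s → f q = 0) :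
    ∑ᶠ q, f q = f twoPrime + f r + f s := by
  rw [finsum_eq_sum_of_support_subset (s := {twoPrime, r, s})]
  · rw [Finset.sum_insert (by simp [hr.symm, hs.symm]), Finset.sum_pair hrs, add_assoc]
  · intro q hq
    by_contra h
    simp only [Finset.coe_insert, Finset.coe_singleton, Set.mem_insert_iff, Set.mem_singleton_iff,
      not_or] at h
    exact hq (hf q h.1 h.2.1 h.2.2)

theorem finsum_eq_two {f : Nat.Primes → ZMod 2} {r : Nat.Primes} (hr : r ≠ twoPrime)
    (hf : ∀ q, q ≠ twoPrime → q ≠ r → f q = 0) :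
    ∑ᶠ q, f q = f twoPrime + f r := by
  rw [finsum_eq_sum_of_support_subset (s := {twoPrime, r})]
  · rw [Finset.sum_pair hr.symm]
  · intro q hq
    by_contra h
    simp only [Finset.coe_insert, Finset.coe_singleton, Set.mem_insert_iff, Set.mem_singleton_iff,
      not_or] at h
    exact hq (hf q h.1 h.2)

theorem odd_of_ne_two {q : Nat.Primes} (h : q ≠ twoPrime) : (q : ℕ) ≠ 2 := fun h' => h (eq_two h')

theorem int_odd_of_ne_two {q : Nat.Primes} (h : q ≠ twoPrime) : ¬ (2 : ℤ) ∣ ((q : ℕ) : ℤ) :=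
  not_prime_dvd (q := twoPrime) h.symm

theorem globalSymbol_intCast (m n : ℤ) : globalSymbol m n =
    rlog m n + ∑ᶠ q : Nat.Primes, hlog (m : ℚ_[q]) (n : ℚ_[q]) := by
  rw [globalSymbol]; norm_num

theorem globalSymbol_neg_one_neg_one : globalSymbol (-1) (-1) = 0 := by
  have := globalSymbol_intCast (-1) (-1)
  rw [finsum_eq_single _ twoPrime (fun q hq => hlog_eq_zero_away (odd_of_ne_two hq)
    (not_prime_dvd_neg_one q) (not_prime_dvd_neg_one q)), hlog_two_intCast rfl (by norm_num)
    (by norm_num), rlog_eq, if_pos (by norm_num), if_pos (by norm_num)] at this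
  norm_num at this
  rw [this]; rfl

theorem signLog_eq_ite (u : ℤˣ) : signLog u = if (u : ℤ) = 1 then 0 else 1 := by
  revert u; decide

/-- For odd r only the places 2 and r contribute, and their product is the first supplementary law.
For r = 2 the single contribution is trivial because -1 ≡ 7 mod 8. -/
theorem globalSymbol_neg_one_prime (r : Nat.Primes) : globalSymbol (-1) (r : ℕ) = 0 := by
  have h := globalSymbol_intCast (-1) (r : ℕ)
  push_cast at h
  rw [h, rlog_eq, if_neg (by simp)]
  by_cases hr : r = twoPrime
  · subst hr
    rw [finsum_eq_single _ twoPrime (fun q hq => ?_)]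
    · have := hlog_two_intCast_prime (q := twoPrime) rfl (m := -1) (by norm_num)
      push_cast at this
      rw [this]; simp
    · have := hlog_eq_zero_away (odd_of_ne_two hq) (not_prime_dvd_neg_one q) (not_prime_dvd hq)
      exact_mod_cast this
  · rw [finsum_eq_two hr (fun q hq hqr => ?_)]
    · have h2 := hlog_two_intCast (q := twoPrime) rfl (m := -1) (by norm_num) (int_odd_of_ne_two hr)
      have h3 := hlog_intCast_prime (odd_of_ne_two hr) (not_prime_dvd_neg_one r)
      push_cast at h2 h3
      have h4 := unitResidue_intCast (not_prime_dvd_neg_one r)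
      push_cast at h4
      rw [h2, h3, signLog_eq_ite, h4, legendreSym.at_neg_one (odd_of_ne_two hr),
        ZMod.χ₄_nat_eq_if_mod_four]
      have := int_odd_of_ne_two hr
      have h5 : (r : ℕ) % 4 = 1 ∨ (r : ℕ) % 4 = 3 := by omega
      rcases h5 with h5 | h5
      · have : ((r : ℕ) : ℤ) % 4 ≠ 3 := by omega
        simp [h5, this, show (r : ℕ) % 2 ≠ 0 by omega]
      · have : ((r : ℕ) : ℤ) % 4 = 3 := by omega
        simp [h5, this, show (r : ℕ) % 2 ≠ 0 by omega]; rfl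
    · have := hlog_eq_zero_away (odd_of_ne_two hq) (not_prime_dvd_neg_one q) (not_prime_dvd hqr)
      exact_mod_cast this

/-- The second supplementary law: the symbol at 2 is read off from r mod 8, and the symbol at r is
(2/r). -/
theorem globalSymbol_prime_two {r : Nat.Primes} (hr : r ≠ twoPrime) :
    globalSymbol (r : ℕ) ((twoPrime : Nat.Primes) : ℕ) = 0 := by
  have h := globalSymbol_intCast (r : ℕ) ((twoPrime : Nat.Primes) : ℕ)
  push_cast at h
  rw [h, rlog_eq, if_neg (by simp), finsum_eq_two hr (fun q hq hqr => ?_)]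
  · have h2 := hlog_two_intCast_prime (q := twoPrime) rfl (int_odd_of_ne_two hr)
    have hn : ¬ ((r : ℕ) : ℤ) ∣ (((twoPrime : Nat.Primes) : ℕ) : ℤ) := not_prime_dvd hr
    have h3 := hlog_intCast_prime (odd_of_ne_two hr) hn
    push_cast at h2 h3
    have h4 := unitResidue_intCast hn
    have h5 := legendreSym.at_two (odd_of_ne_two hr)
    rw [h2, hlog_comm, h3, signLog_eq_ite]
    push_cast at h4
    rw [h4]
    change _ + (_ + if legendreSym r 2 = 1 then _ else _) = _
    rw [h5, ZMod.χ₈_nat_eq_if_mod_eight]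
    have := int_odd_of_ne_two hr
    by_cases h6 : (r : ℕ) % 8 = 1 ∨ (r : ℕ) % 8 = 7
    · have : ((r : ℕ) : ℤ) % 8 = 1 ∨ ((r : ℕ) : ℤ) % 8 = 7 := by omega
      simp [h6, this, show (r : ℕ) % 2 ≠ 0 by omega]
    · have : ¬ (((r : ℕ) : ℤ) % 8 = 1 ∨ ((r : ℕ) : ℤ) % 8 = 7) := by omega
      simp [h6, this, show (r : ℕ) % 2 ≠ 0 by omega]; rfl
  · have := hlog_eq_zero_away (odd_of_ne_two hq) (not_prime_dvd hqr) (not_prime_dvd hq)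
    exact_mod_cast this

/-- Quadratic reciprocity: the places r and s give the two Legendre symbols, and the place 2 gives
the sign. -/
theorem globalSymbol_odd_primes {r s : Nat.Primes} (hr : r ≠ twoPrime) (hs : s ≠ twoPrime)
    (hrs : r ≠ s) : globalSymbol (r : ℕ) (s : ℕ) = 0 := by
  have h := globalSymbol_intCast (r : ℕ) (s : ℕ)
  push_cast at h
  rw [h, rlog_eq, if_neg (by simp), finsum_eq_three hr hs hrs (fun q hq hqr hqs => ?_)]
  · have h2 := hlog_two_intCast (q := twoPrime) rfl (int_odd_of_ne_two hr) (int_odd_of_ne_two hs)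
    have h3 := hlog_intCast_prime (odd_of_ne_two hr) (not_prime_dvd hrs)
    have h4 := hlog_intCast_prime (odd_of_ne_two hs) (not_prime_dvd hrs.symm)
    have h5 := unitResidue_intCast (not_prime_dvd hrs)
    have h6 := unitResidue_intCast (not_prime_dvd hrs.symm)
    push_cast at h2 h3 h4 h5 h6
    rw [h2, hlog_comm (q := r), h3, h4]
    have recip := legendreSym.quadratic_reciprocity (p := (r : ℕ)) (q := (s : ℕ)) (odd_of_ne_two hr)
      (odd_of_ne_two hs) (fun h => hrs (Subtype.ext h))
    rw [← h5, ← h6] at recip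
    have o1 := int_odd_of_ne_two hr
    have o2 := int_odd_of_ne_two hs
    generalize unitResidue ((s : ℕ) : ℤ_[r]) = x at *
    generalize unitResidue ((r : ℕ) : ℤ_[s]) = y at *
    have e : ((-1 : ℤ) ^ ((r : ℕ) / 2 * ((s : ℕ) / 2))) =
        if ((r : ℕ) : ℤ) % 4 = 3 ∧ ((s : ℕ) : ℤ) % 4 = 3 then -1 else 1 := by
      rw [pow_mul]
      rcases (show (r : ℕ) % 4 = 1 ∨ (r : ℕ) % 4 = 3 by omega) with h7 | h7
      · rw [Even.neg_one_pow (by rw [Nat.even_iff]; omega), one_pow, if_neg (by omega)]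
      · rw [Odd.neg_one_pow (by rw [Nat.odd_iff]; omega)]
        rcases (show (s : ℕ) % 4 = 1 ∨ (s : ℕ) % 4 = 3 by omega) with h8 | h8
        · rw [Even.neg_one_pow (by rw [Nat.even_iff]; omega), if_neg (by omega)]
        · rw [Odd.neg_one_pow (by rw [Nat.odd_iff]; omega), if_pos (by omega)]
    rw [e] at recip
    clear e h2 h3 h4 h5 h6
    split_ifs at recip ⊢ <;> (revert x y; decide)
  · have := hlog_eq_zero_away (odd_of_ne_two hq) (not_prime_dvd hqr) (not_prime_dvd hqs)
    exact_mod_cast this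

/-- The product formula for the Hilbert symbol. -/
theorem globalSymbol_eq_zero {a b : ℚ} (ha : a ≠ 0) (hb : b ≠ 0) : globalSymbol a b = 0 := by
  have hp : ∀ q : Nat.Primes, ((q : ℕ) : ℚ) ≠ 0 := fun q => by exact_mod_cast q.2.ne_zero
  -- By bilinearity it suffices to let each argument run over -1 and the primes. Equal primes reduce
  -- to (r, -1) through (r, r) = (r, -1).
  have ind : ∀ b : ℚ, b ≠ 0 → globalSymbol (-1) b = 0 →
      (∀ q : Nat.Primes, globalSymbol (q : ℕ) b = 0) → ∀ a : ℚ, a ≠ 0 → globalSymbol a b = 0 :=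
    fun b hb h1 h2 => rat_induction h1 h2
      (fun a a' ha ha' e e' => by rw [globalSymbol_mul_left ha ha' hb, e, e', add_zero])
      (fun a ha e => by rw [globalSymbol_inv_left ha hb, e])
  have neg_one : ∀ a : ℚ, a ≠ 0 → globalSymbol a (-1) = 0 :=
    ind _ (by norm_num) globalSymbol_neg_one_neg_one
      (fun q => by rw [globalSymbol_comm, globalSymbol_neg_one_prime])
  refine ind b hb (by rw [globalSymbol_comm, neg_one b hb]) (fun q => ?_) a ha
  rw [globalSymbol_comm]
  refine ind _ (hp q) (globalSymbol_neg_one_prime q) (fun r => ?_) b hb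
  by_cases hrq : r = q
  · subst hrq
    rw [globalSymbol_self (hp r), neg_one _ (hp r)]
  by_cases hr : r = twoPrime
  · subst hr
    rw [globalSymbol_comm, globalSymbol_prime_two (Ne.symm hrq)]
  by_cases hq : q = twoPrime
  · subst hq
    exact globalSymbol_prime_two hr
  · exact globalSymbol_odd_primes hr hq hrq

end HalfIntegral

namespace HalfIntegral

/-! ### The splitting over `SL₂(ℚ)` -/

/-- The image of a rational matrix at the place `q`. -/
noncomputable def atPlace (q : Nat.Primes) : SL(2, ℚ) →* SL(2, ℚ_[q]) :=
  Matrix.SpecialLinearGroup.map (algebraMap ℚ ℚ_[q])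

/-- The image of a rational matrix at the real place. -/
noncomputable def atReal : SL(2, ℚ) →* SL(2, ℝ) :=
  Matrix.SpecialLinearGroup.map (algebraMap ℚ ℝ)

@[simp] theorem atPlace_apply (q : Nat.Primes) (α : SL(2, ℚ)) (i j : Fin 2) :
    atPlace q α i j = (α i j : ℚ_[q]) := by simp [atPlace]

@[simp] theorem atReal_apply (α : SL(2, ℚ)) (i j : Fin 2) :
    atReal α i j = (α i j : ℝ) := by simp [atReal]

theorem tau_atPlace (q : Nat.Primes) (α : SL(2, ℚ)) : tau (atPlace q α) = ((tau α : ℚ) : ℚ_[q]) := by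
  by_cases h : α 1 0 = 0
  · rw [tau_of_eq h, tau_of_eq (by rw [atPlace_apply, h, Rat.cast_zero]), atPlace_apply]
  · rw [tau_of_ne h, tau_of_ne (by rw [atPlace_apply]; exact_mod_cast h), atPlace_apply]

theorem tau_atReal (α : SL(2, ℚ)) : tau (atReal α) = ((tau α : ℚ) : ℝ) := by
  by_cases h : α 1 0 = 0
  · rw [tau_of_eq h, tau_of_eq (by rw [atReal_apply, h, Rat.cast_zero]), atReal_apply]
  · rw [tau_of_ne h, tau_of_ne (by rw [atReal_apply]; exact_mod_cast h), atReal_apply]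

/-- The additive form of the sign of `s_ℚ(α)`. -/
noncomputable def tlog (α : SL(2, ℚ)) : ZMod 2 := ∑ᶠ q, slog (atPlace q α)

theorem finite_support_slog (α : SL(2, ℚ)) :
    (Function.support fun q : Nat.Primes => slog (atPlace q α)).Finite := by
  have : ∀ᶠ q : Nat.Primes in Filter.cofinite, slog (atPlace q α) = 0 := by
    by_cases h : α 1 0 = 0
    · exact Filter.Eventually.of_forall fun q => slog_of_zero (Or.inl (by simp [h]))
    · filter_upwards [eventually_norm_eq_one h] with q hq
      exact slog_of_even (even_valuation_of_norm (by rwa [atPlace_apply]))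
  exact this

theorem signLog_finprod {ι : Type*} {f : ι → ℤˣ}
    (hf : (Function.support fun i => signLog (f i)).Finite) :
    signLog (∏ᶠ i, f i) = ∑ᶠ i, signLog (f i) := by
  rw [finsum_eq_sum_of_support_subset (s := hf.toFinset) _ (by simp),
    finprod_eq_prod_of_mulSupport_subset (s := hf.toFinset)]
  · generalize hf.toFinset = s
    classical
    induction s using Finset.induction_on with
    | empty => simp
    | insert a s ha ih => rw [Finset.prod_insert ha, Finset.sum_insert ha, signLog_mul, ih]
  · intro i hi
    simp only [Set.Finite.coe_toFinset, Function.mem_support, ne_eq, signLog_eq_zero]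
    exact hi

theorem signLog_rationalSection (α : SL(2, ℚ)) : signLog (rationalSection α).sgn = tlog α :=
  signLog_finprod (finite_support_slog α)

/-- The additive form of the real cocycle. -/
noncomputable def rclog (g h : SL(2, ℝ)) : ZMod 2 := signLog (cocycleReal g h)

theorem rclog_eq (g h : SL(2, ℝ)) : rclog g h = kubota rlog g h := rfl

/-- Summed over all places, the Kubota parts of σ_v cancel by the product formula, and what is left
of the sum of the σ_q is the defect of multiplicativity of ∏ s_q. Only the real place and p can
contribute to that defect. -/
theorem tlog_mul {p : Nat.Primes} {α β : SL(2, ℚ)}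
    (h : ∀ q, q ≠ p → clog (atPlace q α) (atPlace q β) = 0) :
    tlog (α * β) = tlog α + tlog β + rclog (atReal α) (atReal β) +
      clog (atPlace p α) (atPlace p β) := by
  have h1 : ∑ᶠ q, clog (atPlace q α) (atPlace q β) = clog (atPlace p α) (atPlace p β) :=
    finsum_eq_single _ p h
  have n1 := mul_ne_zero (tau_ne_zero (α * β)) (tau_ne_zero α)
  have n2 := mul_ne_zero (tau_ne_zero (α * β)) (tau_ne_zero β)
  have h2 := globalSymbol_eq_zero n1 n2
  have h3 : ∀ q, kubota hlog (atPlace q α) (atPlace q β) =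
      hlog ((tau (α * β) * tau α : ℚ) : ℚ_[q]) ((tau (α * β) * tau β : ℚ) : ℚ_[q]) := fun q => by
    rw [kubota, ← map_mul, tau_atPlace, tau_atPlace, tau_atPlace, Rat.cast_mul, Rat.cast_mul]
  have h4 : rclog (atReal α) (atReal β) =
      rlog ((tau (α * β) * tau α : ℚ) : ℝ) ((tau (α * β) * tau β : ℚ) : ℝ) := by
    rw [rclog_eq, kubota, ← map_mul, tau_atReal, tau_atReal, tau_atReal, Rat.cast_mul, Rat.cast_mul]
  have f1 := finite_support_slog α
  have f2 := finite_support_slog β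
  have f3 := finite_support_slog (α * β)
  have f4 := finite_support_hlog n1 n2
  have h5 : ∑ᶠ q, clog (atPlace q α) (atPlace q β) = ∑ᶠ q : Nat.Primes,
      hlog ((tau (α * β) * tau α : ℚ) : ℚ_[q]) ((tau (α * β) * tau β : ℚ) : ℚ_[q]) +
        tlog α + tlog β + tlog (α * β) := by
    rw [tlog, tlog, tlog, ← finsum_add_distrib f4 f1, ← finsum_add_distrib _ f2,
      ← finsum_add_distrib _ f3]
    · exact finsum_congr fun q => by rw [clog_eq, h3, map_mul]
    · exact (((f4.union f1).subset (Function.support_add _ _)).union f2).subset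
        (Function.support_add _ _)
    · exact (f4.union f1).subset (Function.support_add _ _)
  rw [globalSymbol, ← h4] at h2
  rw [h1] at h5
  grind

/-- Rational matrices that lie in `SL₂(ℤ_q)` for odd `q ≠ p` and in `K₁(4)` for `q = 2`. -/
def IsGoodAway (p : Nat.Primes) (α : SL(2, ℚ)) : Prop :=
  ∀ q, q ≠ p → atPlace q α ∈ integralSL q ∧ ((q : ℕ) = 2 → IsGood (atPlace q α))

theorem IsGoodAway.inv {p : Nat.Primes} {α : SL(2, ℚ)} (hα : IsGoodAway p α) :
    IsGoodAway p α⁻¹ := fun q hq => by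
  rw [map_inv]
  exact ⟨inv_mem (hα q hq).1, fun h => ((hα q hq).2 h).inv⟩

theorem IsGoodAway.clog_eq_zero {p : Nat.Primes} {α β : SL(2, ℚ)} (hα : IsGoodAway p α)
    (hβ : IsGoodAway p β) {q : Nat.Primes} (hq : q ≠ p) :
    clog (atPlace q α) (atPlace q β) = 0 := by
  by_cases h : (q : ℕ) = 2
  · exact ((hα q hq).2 h).clog_eq_zero ((hβ q hq).2 h)
  · exact clog_eq_zero_of_odd h (hα q hq).1 _ (hβ q hq).1

/-! ### The automorphy factor on `SL₂(ℝ)` -/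

/-- The square root with argument in `[-π/2, π/2)`. -/
noncomputable def lowerRoot (w : ℂ) : ℂ := conj ((conj w) ^ (1 / 2 : ℂ))

theorem lowerRoot_sq (w : ℂ) : lowerRoot w ^ 2 = w := by
  rw [lowerRoot, ← map_pow, ← Complex.cpow_nat_mul]
  norm_num

theorem lowerRoot_ne_zero {w : ℂ} (hw : w ≠ 0) : lowerRoot w ≠ 0 := fun h => by
  have := lowerRoot_sq w
  rw [h] at this
  exact hw (by rw [← this]; norm_num)

theorem cpow_half_re_im {v : ℂ} (hv : v ≠ 0) :
    (v ^ (1 / 2 : ℂ)).re = Real.exp (Real.log ‖v‖ / 2) * Real.cos (v.arg / 2) ∧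
      (v ^ (1 / 2 : ℂ)).im = Real.exp (Real.log ‖v‖ / 2) * Real.sin (v.arg / 2) := by
  have e1 : (Complex.log v * (1 / 2 : ℂ)).re = Real.log ‖v‖ / 2 := by
    rw [show Complex.log v * (1 / 2 : ℂ) = Complex.log v * ((1 / 2 : ℝ) : ℂ) by norm_num,
      Complex.re_mul_ofReal, Complex.log_re]; ring
  have e2 : (Complex.log v * (1 / 2 : ℂ)).im = v.arg / 2 := by
    rw [show Complex.log v * (1 / 2 : ℂ) = Complex.log v * ((1 / 2 : ℝ) : ℂ) by norm_num,
      Complex.im_mul_ofReal, Complex.log_im]; ring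
  rw [Complex.cpow_def_of_ne_zero hv, Complex.exp_re, Complex.exp_im, e1, e2]
  exact ⟨rfl, rfl⟩

theorem lowerRoot_of_pos {w : ℂ} (hw : 0 < w.im ∨ w.im = 0 ∧ 0 < w.re) :
    0 < (lowerRoot w).re ∧ 0 ≤ (lowerRoot w).im := by
  have hw0 : w ≠ 0 := by rintro rfl; simp at hw
  have hv : conj w ≠ 0 := (map_ne_zero _).2 hw0
  obtain ⟨h1, h2⟩ := cpow_half_re_im hv
  rw [lowerRoot, Complex.conj_re, Complex.conj_im, h1, h2]
  have hle : (conj w).arg ≤ 0 := by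
    rcases hw with h | ⟨h, h'⟩
    · exact (Complex.arg_neg_iff.2 (by simpa using h)).le
    · refine (Complex.arg_eq_zero_iff.2 ⟨by simpa using h'.le, by simpa using h⟩).le
  have hgt := Complex.neg_pi_lt_arg (conj w)
  have hp := Real.exp_pos (Real.log ‖conj w‖ / 2)
  constructor
  · exact mul_pos hp (Real.cos_pos_of_mem_Ioo ⟨by linarith, by linarith [Real.pi_pos]⟩)
  · rw [← mul_neg, ← Real.sin_neg]
    exact mul_nonneg hp.le (Real.sin_nonneg_of_nonneg_of_le_pi (by linarith) (by linarith))

theorem lowerRoot_of_neg {w : ℂ} (hw : w.im < 0 ∨ w.im = 0 ∧ w.re < 0) :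
    0 ≤ (lowerRoot w).re ∧ (lowerRoot w).im < 0 := by
  have hw0 : w ≠ 0 := by rintro rfl; simp at hw
  have hv : conj w ≠ 0 := (map_ne_zero _).2 hw0
  obtain ⟨h1, h2⟩ := cpow_half_re_im hv
  rw [lowerRoot, Complex.conj_re, Complex.conj_im, h1, h2]
  have hlt : 0 < (conj w).arg := by
    rcases hw with h | ⟨h, h'⟩
    · refine lt_of_le_of_ne (Complex.arg_nonneg_iff.2 (by simpa using h.le)) fun h0 => ?_
      have := (Complex.arg_eq_zero_iff.1 h0.symm).2
      rw [Complex.conj_im] at this; linarith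
    · rw [Complex.arg_eq_pi_iff.2 ⟨by simpa using h', by simpa using h⟩]; exact Real.pi_pos
  have hle := Complex.arg_le_pi (conj w)
  have hp := Real.exp_pos (Real.log ‖conj w‖ / 2)
  constructor
  · exact mul_nonneg hp.le (Real.cos_nonneg_of_mem_Icc ⟨by linarith [Real.pi_pos], by linarith⟩)
  · rw [neg_lt_zero]
    exact mul_pos hp (Real.sin_pos_of_pos_of_lt_pi (by linarith) (by linarith [Real.pi_pos]))

/-- The denominator `cz + d`. -/
noncomputable def den {R : Type*} [CommRing R] [Algebra R ℝ] (g : SL(2, R)) (z : ℍ) : ℂ :=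
  ((algebraMap R ℝ (g 1 0) : ℝ) : ℂ) * z + ((algebraMap R ℝ (g 1 1) : ℝ) : ℂ)

theorem denom_real (g : SL(2, ℝ)) (z : ℍ) : UpperHalfPlane.denom g z = den g z := by
  simp [UpperHalfPlane.denom, den]

theorem denom_int (g : SL(2, ℤ)) (z : ℍ) : UpperHalfPlane.denom g z = den g z := by
  simp [UpperHalfPlane.denom, den]

section Den

variable {R : Type*} [CommRing R] [Algebra R ℝ]

theorem coe_sl_smul (g : SL(2, R)) (z : ℍ) : ((g • z : ℍ) : ℂ) =
    (((algebraMap R ℝ (g 0 0) : ℝ) : ℂ) * z + ((algebraMap R ℝ (g 0 1) : ℝ) : ℂ)) / den g z := by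
  rw [UpperHalfPlane.specialLinearGroup_apply, den]

theorem den_eq_map (g : SL(2, R)) (z : ℍ) :
    den g z = den (Matrix.SpecialLinearGroup.map (algebraMap R ℝ) g) z := by simp [den]

theorem den_ne_zero (g : SL(2, R)) (z : ℍ) : den g z ≠ 0 := by
  rw [den_eq_map, ← denom_real]
  exact UpperHalfPlane.denom_ne_zero _ z

theorem den_mul (g h : SL(2, R)) (z : ℍ) : den (g * h) z = den g (h • z) * den h z := by
  have hh := den_ne_zero h z
  rw [den, den, coe_sl_smul, sl_mul_one_zero, sl_mul_one_one]
  field_simp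
  rw [den]
  simp only [map_add, map_mul, Complex.ofReal_add, Complex.ofReal_mul]
  ring

end Den

theorem realFactor_eq (g : RealCover) (z : ℍ) :
    realFactor g z = ((g.sgn : ℤ) : ℂ) * lowerRoot (den g.mat z) := by
  rw [realFactor, lowerRoot, denom_real]

/-- The sign attached to an element of `ZMod 2`. -/
noncomputable def expSign (x : ZMod 2) : ℂ := if x = 0 then 1 else -1

theorem expSign_add (x y : ZMod 2) : expSign (x + y) = expSign x * expSign y := by
  have h2 : ∀ x : ZMod 2, x = 0 ∨ x = 1 := by decide
  have h11 : (1 + 1 : ZMod 2) = 0 := by decide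
  rcases h2 x with rfl | rfl <;> rcases h2 y with rfl | rfl <;> simp [expSign, h11]

theorem expSign_signLog (u : ℤˣ) : expSign (signLog u) = ((u : ℤ) : ℂ) := by
  rcases Int.units_eq_one_or u with rfl | rfl <;> simp [signLog, expSign]

@[simp] theorem expSign_zero : expSign 0 = 1 := by simp [expSign]

theorem expSign_mul_self (x : ZMod 2) : expSign x * expSign x = 1 := by
  rw [expSign]; split_ifs <;> norm_num

theorem expSign_ne_zero (x : ZMod 2) : expSign x ≠ 0 := by
  rw [expSign]; split_ifs <;> norm_num

theorem expSign_pow_odd (x : ZMod 2) (k : ℕ) : expSign x ^ (2 * k + 1) = expSign x := by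
  rw [expSign]; split_ifs <;> simp [pow_add, pow_mul]

theorem sq_eq_sq_sign {a b : ℂ} (h : a ^ 2 = b ^ 2) : a = b ∨ a = -b := sq_eq_sq_iff_eq_or_eq_neg.1 h

theorem den_sign {g : SL(2, ℝ)} (z : ℍ) :
    (0 < tau g → 0 < (den g z).im ∨ (den g z).im = 0 ∧ 0 < (den g z).re) ∧
    (tau g < 0 → (den g z).im < 0 ∨ (den g z).im = 0 ∧ (den g z).re < 0) := by
  have him : (den g z).im = g 1 0 * z.im := by simp [den]
  have hre : (den g z).re = g 1 0 * z.re + g 1 1 := by simp [den]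
  have hz := z.im_pos
  by_cases hc : g 1 0 = 0
  · rw [tau_of_eq hc, him, hre, hc]
    simp
  · rw [tau_of_ne hc, him]
    exact ⟨fun h => Or.inl (mul_pos h hz), fun h => Or.inl (mul_neg_of_neg_of_pos h hz)⟩

/-- Both sides have the same square, so only a sign is in question. The sign of τ(g) decides whether
cz + d lies in the upper or lower half plane, or on which half of the real axis, uniformly in z.
This places the root in the quadrant re > 0, im ≥ 0 or in the quadrant re ≥ 0, im < 0, and the sign
follows from the three quadrants. -/
theorem lowerRoot_den_mul (g h : SL(2, ℝ)) (z : ℍ) :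
    lowerRoot (den (g * h) z) =
      expSign (rclog g h) * (lowerRoot (den g (h • z)) * lowerRoot (den h z)) := by
  have hsq : lowerRoot (den (g * h) z) ^ 2 =
      (lowerRoot (den g (h • z)) * lowerRoot (den h z)) ^ 2 := by
    rw [mul_pow, lowerRoot_sq, lowerRoot_sq, lowerRoot_sq, den_mul]
  obtain ⟨p1, n1⟩ := den_sign (g := g) (h • z)
  obtain ⟨p2, n2⟩ := den_sign (g := h) z
  obtain ⟨p3, n3⟩ := den_sign (g := g * h) z
  have t1 := tau_ne_zero g
  have t2 := tau_ne_zero h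
  have t3 := tau_ne_zero (g * h)
  rw [rclog_eq, kubota, rlog_eq]
  have r1p := fun h => lowerRoot_of_pos (p1 h)
  have r1n := fun h => lowerRoot_of_neg (n1 h)
  have r2p := fun h => lowerRoot_of_pos (p2 h)
  have r2n := fun h => lowerRoot_of_neg (n2 h)
  have r3p := fun h => lowerRoot_of_pos (p3 h)
  have r3n := fun h => lowerRoot_of_neg (n3 h)
  clear p1 n1 p2 n2 p3 n3
  generalize lowerRoot (den (g * h) z) = J3 at *
  generalize lowerRoot (den g (h • z)) = J1 at *
  generalize lowerRoot (den h z) = J2 at *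
  generalize tau (g * h) = c3 at *
  generalize tau g = c1 at *
  generalize tau h = c2 at *
  -- In each combination of the signs of c1, c2, c3 the wrong choice of sign contradicts the signs
  -- of real and imaginary parts. The boundary rays require the strictness of the inequalities.
  have main : J3 = (if (c3 * c1 < 0 ∧ c3 * c2 < 0) then -1 else 1) * (J1 * J2) := by
    rcases sq_eq_sq_sign hsq with e | e
    · by_cases hc : c3 * c1 < 0 ∧ c3 * c2 < 0
      · exfalso
        have hre := congrArg Complex.re e
        have him := congrArg Complex.im e
        rw [Complex.mul_re] at hre
        rw [Complex.mul_im] at him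
        rcases lt_or_gt_of_ne t3 with h3 | h3
        · have h1 : 0 < c1 := by nlinarith
          have h2 : 0 < c2 := by nlinarith
          obtain ⟨a1, b1⟩ := r1p h1
          obtain ⟨a2, b2⟩ := r2p h2
          obtain ⟨a3, b3⟩ := r3n h3
          nlinarith [mul_nonneg a1.le b2, mul_nonneg b1 a2.le]
        · have h1 : c1 < 0 := by nlinarith
          have h2 : c2 < 0 := by nlinarith
          obtain ⟨a1, b1⟩ := r1n h1
          obtain ⟨a2, b2⟩ := r2n h2
          obtain ⟨a3, b3⟩ := r3p h3
          have e1 : J1.re * J2.im ≤ 0 := mul_nonpos_of_nonneg_of_nonpos a1 b2.le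
          have e2 : J1.im * J2.re ≤ 0 := mul_nonpos_of_nonpos_of_nonneg b1.le a2
          have e3 : J1.re * J2.im = 0 := by linarith
          have e4 : J1.im * J2.re = 0 := by linarith
          have e5 : J1.re = 0 := (mul_eq_zero.1 e3).resolve_right b2.ne
          rw [e5, zero_mul] at hre
          nlinarith [mul_pos_of_neg_of_neg b1 b2]
      · rw [if_neg hc, one_mul, e]
    · by_cases hc : c3 * c1 < 0 ∧ c3 * c2 < 0
      · rw [if_pos hc, e]; ring
      · exfalso
        have hre := congrArg Complex.re e
        have him := congrArg Complex.im e
        rw [Complex.neg_re, Complex.mul_re] at hre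
        rw [Complex.neg_im, Complex.mul_im] at him
        rcases lt_or_gt_of_ne t1 with h1 | h1 <;> rcases lt_or_gt_of_ne t2 with h2 | h2 <;>
          rcases lt_or_gt_of_ne t3 with h3 | h3
        · obtain ⟨a1, b1⟩ := r1n h1
          obtain ⟨a2, b2⟩ := r2n h2
          obtain ⟨a3, b3⟩ := r3n h3
          have e1 : J1.re * J2.im ≤ 0 := mul_nonpos_of_nonneg_of_nonpos a1 b2.le
          have e2 : J1.im * J2.re ≤ 0 := mul_nonpos_of_nonpos_of_nonneg b1.le a2
          linarith
        · exact hc ⟨mul_neg_of_pos_of_neg h3 h1, mul_neg_of_pos_of_neg h3 h2⟩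
        · obtain ⟨a1, b1⟩ := r1n h1
          obtain ⟨a2, b2⟩ := r2p h2
          obtain ⟨a3, b3⟩ := r3n h3
          have e1 : 0 ≤ J1.re * J2.re := mul_nonneg a1 a2.le
          have e2 : J1.im * J2.im ≤ 0 := mul_nonpos_of_nonpos_of_nonneg b1.le b2
          have e3 : J1.re * J2.re = 0 := by linarith
          have e4 : J1.im * J2.im = 0 := by linarith
          have e5 : J1.re = 0 := (mul_eq_zero.1 e3).resolve_right a2.ne'
          have e6 : J2.im = 0 := (mul_eq_zero.1 e4).resolve_left b1.ne
          rw [e5, e6] at him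
          nlinarith [mul_neg_of_neg_of_pos b1 a2]
        · obtain ⟨a1, b1⟩ := r1n h1
          obtain ⟨a2, b2⟩ := r2p h2
          obtain ⟨a3, b3⟩ := r3p h3
          have e1 : 0 ≤ J1.re * J2.re := mul_nonneg a1 a2.le
          have e2 : J1.im * J2.im ≤ 0 := mul_nonpos_of_nonpos_of_nonneg b1.le b2
          linarith
        · obtain ⟨a1, b1⟩ := r1p h1
          obtain ⟨a2, b2⟩ := r2n h2
          obtain ⟨a3, b3⟩ := r3n h3
          have e1 : 0 ≤ J1.re * J2.re := mul_nonneg a1.le a2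
          have e2 : J1.im * J2.im ≤ 0 := mul_nonpos_of_nonneg_of_nonpos b1 b2.le
          have e3 : J1.re * J2.re = 0 := by linarith
          have e4 : J1.im * J2.im = 0 := by linarith
          have e5 : J2.re = 0 := (mul_eq_zero.1 e3).resolve_left a1.ne'
          have e6 : J1.im = 0 := (mul_eq_zero.1 e4).resolve_right b2.ne
          rw [e5, e6] at him
          nlinarith [mul_neg_of_pos_of_neg a1 b2]
        · obtain ⟨a1, b1⟩ := r1p h1
          obtain ⟨a2, b2⟩ := r2n h2
          obtain ⟨a3, b3⟩ := r3p h3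
          have e1 : 0 ≤ J1.re * J2.re := mul_nonneg a1.le a2
          have e2 : J1.im * J2.im ≤ 0 := mul_nonpos_of_nonneg_of_nonpos b1 b2.le
          linarith
        · exact hc ⟨mul_neg_of_neg_of_pos h3 h1, mul_neg_of_neg_of_pos h3 h2⟩
        · obtain ⟨a1, b1⟩ := r1p h1
          obtain ⟨a2, b2⟩ := r2p h2
          obtain ⟨a3, b3⟩ := r3p h3
          have e1 : 0 ≤ J1.re * J2.im := mul_nonneg a1.le b2
          have e2 : 0 ≤ J1.im * J2.re := mul_nonneg b1 a2.le
          have e3 : J1.re * J2.im = 0 := by linarith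
          have e4 : J1.im * J2.re = 0 := by linarith
          have e5 : J2.im = 0 := (mul_eq_zero.1 e3).resolve_left a1.ne'
          rw [e5, mul_zero] at hre
          nlinarith [mul_pos a1 a2]
  rw [main]
  split_ifs <;> simp [expSign]

/-! ### The theta multiplier -/

/-- The automorphy factor `∏ s_v(α) · (cz + d)^{1/2}` of a rational matrix. -/
noncomputable def ratFactor (α : SL(2, ℚ)) (z : ℍ) : ℂ :=
  expSign (tlog α) * lowerRoot (den α z)

theorem den_atReal (α : SL(2, ℚ)) (z : ℍ) : den (atReal α) z = den α z := (den_eq_map α z).symm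

theorem atReal_smul (α : SL(2, ℚ)) (z : ℍ) : atReal α • z = α • z := rfl

/-- The real cocycle occurs once in `tlog_mul` and once in `lowerRoot_den_mul`. The two occurrences
cancel and only the cocycle at p survives. -/
theorem ratFactor_mul {p : Nat.Primes} {α β : SL(2, ℚ)} (hα : IsGoodAway p α)
    (hβ : IsGoodAway p β) (z : ℍ) : ratFactor (α * β) z =
      expSign (clog (atPlace p α) (atPlace p β)) * (ratFactor α (β • z) * ratFactor β z) := by
  rw [ratFactor, tlog_mul (fun q hq => hα.clog_eq_zero hβ hq), ← den_atReal, map_mul,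
    lowerRoot_den_mul, ratFactor, ratFactor, den_atReal, den_atReal, atReal_smul]
  simp only [expSign_add]
  linear_combination (expSign (tlog α) * expSign (tlog β) *
    expSign (clog (atPlace p α) (atPlace p β)) * lowerRoot (den α (β • z)) * lowerRoot (den β z)) *
    expSign_mul_self (rclog (atReal α) (atReal β))

theorem ratFactor_ne_zero (α : SL(2, ℚ)) (z : ℍ) : ratFactor α z ≠ 0 :=
  mul_ne_zero (expSign_ne_zero _) (lowerRoot_ne_zero (den_ne_zero _ _))

end HalfIntegral

namespace HalfIntegral

/-- The image of an integral matrix in `SL₂(ℚ)`. -/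
def toRat : SL(2, ℤ) →* SL(2, ℚ) := Matrix.SpecialLinearGroup.map (Int.castRingHom ℚ)

@[simp] theorem toRat_apply (γ : SL(2, ℤ)) (i j : Fin 2) : toRat γ i j = (γ i j : ℚ) := by
  simp [toRat]

theorem toRat_smul (γ : SL(2, ℤ)) (z : ℍ) : toRat γ • z = γ • z := by
  ext
  rw [coe_sl_smul, coe_sl_smul, den, den]
  simp

theorem den_toRat (γ : SL(2, ℤ)) (z : ℍ) : den (toRat γ) z = den γ z := by simp [den]

/-- Integral matrices with `4 ∣ c` and `d ≡ 1` modulo `4`. -/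
structure IsGamma14 (γ : SL(2, ℤ)) : Prop where
  dvd : (4 : ℤ) ∣ γ 1 0
  one_one : γ 1 1 % 4 = 1

theorem IsGamma14.zero_zero {γ : SL(2, ℤ)} (h : IsGamma14 γ) : γ 0 0 % 4 = 1 := by
  have d := sl_det γ
  obtain ⟨c, hc⟩ := h.dvd
  obtain ⟨e, he⟩ : ∃ e, γ 1 1 = 1 + 4 * e := ⟨γ 1 1 / 4, by have := h.one_one; omega⟩
  rw [hc, he] at d
  have : γ 0 0 = 1 + 4 * (γ 0 1 * c - γ 0 0 * e) := by linear_combination d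
  omega

theorem IsGamma14.mul {γ δ : SL(2, ℤ)} (h : IsGamma14 γ) (h' : IsGamma14 δ) :
    IsGamma14 (γ * δ) where
  dvd := by
    rw [sl_mul_one_zero]
    exact dvd_add (h.dvd.mul_right _) (h'.dvd.mul_left _)
  one_one := by
    rw [sl_mul_one_one]
    obtain ⟨c, hc⟩ := h.dvd
    have h1 := h.one_one
    have h2 := h'.one_one
    rw [hc, mul_assoc, Int.mul_add_emod_self_left, Int.mul_emod, h1, h2]; rfl

theorem IsGamma14.inv {γ : SL(2, ℤ)} (h : IsGamma14 γ) : IsGamma14 γ⁻¹ where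
  dvd := by rw [sl_inv_one_zero]; exact h.dvd.neg_right
  one_one := by rw [sl_inv_one_one]; exact h.zero_zero

theorem norm_intCast_le_one (q : Nat.Primes) (n : ℤ) : ‖(n : ℚ_[q])‖ ≤ 1 := Padic.norm_int_le_one n

theorem norm_intCast_le_quarter {q : Nat.Primes} (hq : (q : ℕ) = 2) {n : ℤ} (hn : (4 : ℤ) ∣ n) :
    ‖(n : ℚ_[q])‖ ≤ 1 / 4 := by
  have := (Padic.norm_int_le_pow_iff_dvd (p := q) n 2).2 (by rw [hq]; exact_mod_cast hn)
  have hqr : ((q : ℕ) : ℝ) = 2 := by rw [hq]; norm_num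
  rw [hqr] at this
  norm_num at this ⊢
  exact this

theorem toRat_mem_integralSL (q : Nat.Primes) (γ : SL(2, ℤ)) :
    atPlace q (toRat γ) ∈ integralSL q := mem_integralSL.2 fun i j => by
  rw [atPlace_apply, toRat_apply, Rat.cast_intCast]
  exact norm_intCast_le_one q _

theorem isGoodUnit_intCast {q : Nat.Primes} (hq : (q : ℕ) = 2) {n : ℤ} (hn : n % 4 = 1) :
    IsGoodUnit (n : ℚ_[q]) :=
  ⟨norm_intCast_eq_one (by rw [hq]; push_cast; omega), fun _ => by
    have := norm_intCast_le_quarter hq (n := n - 1) (by omega)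
    push_cast at this
    exact this⟩

theorem isGoodLower_intCast {q : Nat.Primes} (hq : (q : ℕ) = 2) {n : ℤ} (hn : (4 : ℤ) ∣ n) :
    IsGoodLower (n : ℚ_[q]) := by
  have := norm_intCast_le_quarter hq hn
  exact ⟨this.trans_lt (by norm_num), fun _ => this⟩

theorem IsGamma14.isGood {γ : SL(2, ℤ)} (h : IsGamma14 γ) {q : Nat.Primes} (hq : (q : ℕ) = 2) :
    IsGood (atPlace q (toRat γ)) := by
  constructor <;> rw [atPlace_apply, toRat_apply, Rat.cast_intCast]
  · exact isGoodUnit_intCast hq h.zero_zero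
  · exact isGoodUnit_intCast hq h.one_one
  · exact isGoodLower_intCast hq h.dvd
  · exact norm_intCast_le_one q _

theorem IsGamma14.isGoodAway {γ : SL(2, ℤ)} (h : IsGamma14 γ) (p : Nat.Primes) :
    IsGoodAway p (toRat γ) := fun q _ => ⟨toRat_mem_integralSL q γ, fun hq => h.isGood hq⟩

/-- The local symbol `(c, d)_q` at the primes not dividing `c`. -/
noncomputable def awayLog (c d : ℤ) (q : Nat.Primes) : ZMod 2 :=
  open scoped Classical in if ((q : ℕ) : ℤ) ∣ c then 0 else hlog (c : ℚ_[q]) (d : ℚ_[q])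

theorem finite_support_awayLog {c d : ℤ} (hc : c ≠ 0) (hd : d ≠ 0) :
    (Function.support (awayLog c d)).Finite := by
  refine (finite_support_hlog (a := c) (b := d) (by exact_mod_cast hc)
    (by exact_mod_cast hd)).subset fun q hq => ?_
  rw [Function.mem_support, awayLog] at hq
  split_ifs at hq with h
  · exact absurd rfl hq
  · simpa using hq

/-- Both sides are multiplicative in n. For a prime n prime to c only the place n contributes, with
a Legendre symbol; the place 2 is left out of the sum because c is even. -/
theorem expSign_awayLog {c : ℤ} (hc0 : c ≠ 0) (hc : (2 : ℤ) ∣ c) (n : ℕ) (hn : n ≠ 0)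
    (hcn : IsCoprime c (n : ℤ)) : expSign (∑ᶠ q, awayLog c n q) = (jacobiSym c n : ℂ) := by
  induction n using Nat.recOnMul with
  | zero => exact absurd rfl hn
  | one =>
    have : ∀ q, awayLog c (1 : ℕ) q = 0 := fun q => by
      rw [awayLog]
      split_ifs with h
      · rfl
      · rw [Nat.cast_one, Int.cast_one, (isSymbol_hlog q).one_right (by exact_mod_cast hc0)]
    rw [finsum_congr this]
    simp
  | prime r hr =>
    have hrc : ¬ ((r : ℕ) : ℤ) ∣ c := fun h => by
      have := hcn.isUnit_of_dvd' h dvd_rfl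
      exact (Nat.prime_iff_prime_int.1 hr).not_isUnit this
    have odd : ∀ q : Nat.Primes, ¬ ((q : ℕ) : ℤ) ∣ c → (q : ℕ) ≠ 2 := fun q h h2 =>
      h (by rw [h2]; exact hc)
    obtain ⟨r, rfl⟩ : ∃ r' : Nat.Primes, (r' : ℕ) = r := ⟨⟨r, hr⟩, rfl⟩
    have hz : ∀ q : Nat.Primes, q ≠ r → awayLog c ((r : ℕ) : ℤ) q = 0 := fun q hq => by
      rw [awayLog]
      split_ifs with h
      · rfl
      · rw [Int.cast_natCast]
        exact hlog_eq_zero_away (odd q h) h (not_prime_dvd hq)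
    rw [finsum_eq_single (awayLog c ((r : ℕ) : ℤ)) r hz, awayLog, if_neg hrc, Int.cast_natCast,
      hlog_intCast_prime (odd r hrc) hrc, expSign_signLog, unitResidue_intCast hrc,
      ← jacobiSym.legendreSym.to_jacobiSym]
  | mul a b iha ihb =>
    have h1 := left_ne_zero_of_mul hn
    have h2 := right_ne_zero_of_mul hn
    push_cast at hcn
    have e : ∀ q, awayLog c (a * b : ℕ) q = awayLog c a q + awayLog c b q := fun q => by
      rw [awayLog, awayLog, awayLog]
      split_ifs with h
      · simp
      · push_cast
        exact (isSymbol_hlog q).mul_right (by exact_mod_cast hc0) (by exact_mod_cast h1)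
          (by exact_mod_cast h2)
    rw [finsum_congr e, finsum_add_distrib (finite_support_awayLog hc0 (by exact_mod_cast h1))
      (finite_support_awayLog hc0 (by exact_mod_cast h2)), expSign_add,
      iha h1 hcn.of_mul_right_left, ihb h2 hcn.of_mul_right_right, jacobiSym.mul_right' _ h1 h2]
    push_cast; rfl

theorem isCoprime_lower (γ : SL(2, ℤ)) : IsCoprime (γ 1 0) (γ 1 1) :=
  ⟨-γ 0 1, γ 0 0, by linear_combination sl_det γ⟩

theorem hlog_neg_right_of_away {q : Nat.Primes} (hq : (q : ℕ) ≠ 2) {c d : ℤ}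
    (hc : ¬ ((q : ℕ) : ℤ) ∣ c) (hd : d ≠ 0) :
    hlog (c : ℚ_[q]) ((-d : ℤ) : ℚ_[q]) = hlog (c : ℚ_[q]) (d : ℚ_[q]) := by
  have hc0 : (c : ℚ_[q]) ≠ 0 := fun h => hc (by
    have : c = 0 := by exact_mod_cast h
    rw [this]; exact dvd_zero _)
  rw [Int.cast_neg, ← neg_one_mul, (isSymbol_hlog q).mul_right hc0 (by simp) (by exact_mod_cast hd),
    hlog_eq_zero_of_units hq (norm_intCast_eq_one hc) (by simp), zero_add]

theorem IsGamma14.lower_one {γ : SL(2, ℤ)} (h : IsGamma14 γ) (hc : γ 1 0 = 0) : γ 1 1 = 1 := by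
  have d := sl_det γ
  rw [hc, mul_zero, sub_zero] at d
  have h1 := h.one_one
  rcases Int.eq_one_or_neg_one_of_mul_eq_one (by rwa [mul_comm] at d : γ 1 1 * γ 0 0 = 1) with h' | h'
  · exact h'
  · rw [h'] at h1; norm_num at h1

/-- On `Γ₁(4)` the splitting over `SL₂(ℚ)` is given by Shimura's symbol. -/
theorem IsGamma14.expSign_tlog {γ : SL(2, ℤ)} (h : IsGamma14 γ) :
    expSign (tlog (toRat γ)) = (shimuraSymbol (γ 1 0) (γ 1 1) : ℂ) := by
  by_cases hc : γ 1 0 = 0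
  · have : ∀ q, slog (atPlace q (toRat γ)) = 0 := fun q =>
      slog_of_zero (Or.inl (by rw [atPlace_apply, toRat_apply, hc]; simp))
    rw [tlog, finsum_congr this, hc, h.lower_one hc]
    simp [shimuraSymbol]
  have hd : γ 1 1 ≠ 0 := fun h0 => by have := h.one_one; rw [h0] at this; norm_num at this
  have h2c : (2 : ℤ) ∣ γ 1 0 := dvd_trans (by norm_num) h.dvd
  -- At q dividing c the factor s_q is the Hilbert symbol (c, d), trivially so if ord(c) is even. At
  -- the other q it is trivial, and `awayLog` compensates. The product formula then trades the full
  -- sum of Hilbert symbols for the real one, which is the sign in Shimura's symbol.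
  have hs : ∀ q, slog (atPlace q (toRat γ)) =
      hlog ((γ 1 0 : ℚ) : ℚ_[q]) ((γ 1 1 : ℚ) : ℚ_[q]) + awayLog (γ 1 0) (γ 1 1) q := fun q => by
    rw [awayLog]
    have e0 : atPlace q (toRat γ) 1 0 = (γ 1 0 : ℚ_[q]) := by simp
    have e1 : atPlace q (toRat γ) 1 1 = (γ 1 1 : ℚ_[q]) := by simp
    have hc' : (γ 1 0 : ℚ_[q]) ≠ 0 := by exact_mod_cast hc
    split_ifs with hq
    · have hg : IsGood (atPlace q (toRat γ)) := by
        by_cases h2 : (q : ℕ) = 2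
        · exact h.isGood h2
        · refine isGood_of_odd h2 (toRat_mem_integralSL q γ) ?_
          rw [e0]; exact Padic.norm_intCast_lt_one_iff.2 hq
      rw [Rat.cast_intCast, Rat.cast_intCast, add_zero]
      rcases Int.even_or_odd (γ 1 0 : ℚ_[q]).valuation with hv | hv
      · rw [slog_of_even (by rwa [e0]), hlog_comm,
          hlog_eq_zero_of_even (by rw [← e1]; exact hg.one_one) hc' hv]
      · rw [slog_of_odd (by rwa [e0]) (by rw [e1]; exact_mod_cast hd), e0, e1]
    · rw [Rat.cast_intCast, Rat.cast_intCast, two_mul_zmod_two,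
        slog_of_even (by rw [e0]; exact even_valuation_of_norm (norm_intCast_eq_one hq))]
  have hg := globalSymbol_eq_zero (a := (γ 1 0 : ℚ)) (b := (γ 1 1 : ℚ)) (by exact_mod_cast hc)
    (by exact_mod_cast hd)
  have ht : tlog (toRat γ) = rlog (γ 1 0) (γ 1 1) + ∑ᶠ q, awayLog (γ 1 0) (γ 1 1) q := by
    rw [tlog, finsum_congr hs, finsum_add_distrib (finite_support_hlog (by exact_mod_cast hc)
      (by exact_mod_cast hd)) (finite_support_awayLog hc hd)]
    rw [globalSymbol, Rat.cast_intCast, Rat.cast_intCast] at hg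
    grind
  have hn : ∀ q, awayLog (γ 1 0) (γ 1 1) q = awayLog (γ 1 0) ((γ 1 1).natAbs : ℕ) q := fun q => by
    rcases Int.natAbs_eq (γ 1 1) with e | e
    · rw [← e]
    · have e' : γ 1 1 = -(((γ 1 1).natAbs : ℕ) : ℤ) := e
      rw [awayLog, awayLog]
      split_ifs with hq
      · rfl
      · conv_lhs => rw [e']
        exact hlog_neg_right_of_away (fun h2 => hq (by rw [h2]; exact h2c)) hq
          (by exact_mod_cast Int.natAbs_ne_zero.2 hd)
  have hcop : IsCoprime (γ 1 0) (((γ 1 1).natAbs : ℕ) : ℤ) := by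
    rw [Int.natCast_natAbs]; exact (isCoprime_lower γ).abs_right
  rw [ht, expSign_add, finsum_congr hn, expSign_awayLog hc h2c _ (Int.natAbs_ne_zero.2 hd) hcop,
    rlog_eq, shimuraSymbol]
  push_cast
  congr 1
  simp only [Int.cast_lt_zero]
  split_ifs <;> simp [expSign]

theorem lowerRoot_eq_cpow {w : ℂ} (hw : w.arg ≠ Real.pi) : lowerRoot w = w ^ (1 / 2 : ℂ) := by
  have h := Complex.cpow_conj w (1 / 2 : ℂ) hw
  have e : conj (1 / 2 : ℂ) = 1 / 2 := by rw [map_div₀, map_one, map_ofNat]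
  rw [e] at h
  rw [lowerRoot, ← h]

/-- The two branches of the square root differ only on the negative real axis. Reaching it would
require c = 0 and d < 0, but c = 0 forces d = 1. -/
theorem IsGamma14.arg_den {γ : SL(2, ℤ)} (h : IsGamma14 γ) (z : ℍ) :
    (den γ z).arg ≠ Real.pi := by
  rw [Ne, Complex.arg_eq_pi_iff]
  rintro ⟨h1, h2⟩
  by_cases hc : γ 1 0 = 0
  · rw [den, hc, h.lower_one hc] at h1
    simp at h1
    linarith
  · have : (den γ z).im = γ 1 0 * z.im := by simp [den]
    rw [this] at h2
    rcases mul_eq_zero.1 h2 with h3 | h3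
    · exact hc (by exact_mod_cast h3)
    · exact z.im_pos.ne' h3

theorem IsGamma14.thetaFactor_eq {γ : SL(2, ℤ)} (h : IsGamma14 γ) (z : ℍ) :
    thetaFactor γ z = ratFactor (toRat γ) z := by
  rw [thetaFactor, ratFactor, h.expSign_tlog, den_toRat, lowerRoot_eq_cpow (h.arg_den z), denom_int,
    epsilon, if_pos h.one_one, inv_one, one_mul]

/-- The exceptional place of `ratFactor_mul` is taken to be 2, where the cocycle is trivial on
K₁(4); any prime would serve. -/
theorem IsGamma14.thetaFactor_mul {γ δ : SL(2, ℤ)} (h : IsGamma14 γ) (h' : IsGamma14 δ) (z : ℍ) :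
    thetaFactor (γ * δ) z = thetaFactor γ (δ • z) * thetaFactor δ z := by
  rw [(h.mul h').thetaFactor_eq, h.thetaFactor_eq, h'.thetaFactor_eq, map_mul,
    ratFactor_mul (h.isGoodAway twoPrime) (h'.isGoodAway twoPrime),
    (h.isGood (q := twoPrime) rfl).clog_eq_zero (h'.isGood rfl), expSign_zero, one_mul, toRat_smul]

theorem IsGamma14.thetaFactor_ne_zero {γ : SL(2, ℤ)} (h : IsGamma14 γ) (z : ℍ) :
    thetaFactor γ z ≠ 0 := by
  rw [h.thetaFactor_eq]; exact ratFactor_ne_zero _ _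

end HalfIntegral

namespace HalfIntegral

/-! ### Evaluation of the adelic lift -/

/-- The local component of `K₁(N)`. -/
structure InK1 (N : ℕ) {q : Nat.Primes} (g : SL(2, ℚ_[q])) : Prop where
  integral : g ∈ integralSL q
  one_zero : ‖g 1 0‖ ≤ ‖(N : ℚ_[q])‖
  zero_zero : ‖g 0 0 - 1‖ ≤ ‖(N : ℚ_[q])‖
  one_one : ‖g 1 1 - 1‖ ≤ ‖(N : ℚ_[q])‖

section InK1

variable {N : ℕ} {q : Nat.Primes}

theorem norm_mul_le_left {x y : ℚ_[q]} {r : ℝ} (hx : ‖x‖ ≤ r) (hy : ‖y‖ ≤ 1) : ‖x * y‖ ≤ r := by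
  rw [norm_mul]
  exact (mul_le_of_le_one_right (norm_nonneg _) hy).trans hx

theorem norm_mul_le_right {x y : ℚ_[q]} {r : ℝ} (hx : ‖x‖ ≤ 1) (hy : ‖y‖ ≤ r) : ‖x * y‖ ≤ r := by
  rw [mul_comm]; exact norm_mul_le_left hy hx

theorem InK1.mul {g h : SL(2, ℚ_[q])} (hg : InK1 N g) (hh : InK1 N h) : InK1 N (g * h) where
  integral := mul_mem hg.integral hh.integral
  one_zero := by
    rw [sl_mul_one_zero]
    exact norm_le_of_add (norm_mul_le_left hg.one_zero (mem_integralSL.1 hh.integral _ _))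
      (norm_mul_le_right (mem_integralSL.1 hg.integral _ _) hh.one_zero)
  zero_zero := by
    rw [sl_mul_zero_zero, show g 0 0 * h 0 0 + g 0 1 * h 1 0 - 1 =
      (g 0 0 - 1) * h 0 0 + (h 0 0 - 1) + g 0 1 * h 1 0 by ring]
    exact norm_le_of_add (norm_le_of_add
      (norm_mul_le_left hg.zero_zero (mem_integralSL.1 hh.integral _ _)) hh.zero_zero)
      (norm_mul_le_right (mem_integralSL.1 hg.integral _ _) hh.one_zero)
  one_one := by
    rw [sl_mul_one_one, show g 1 0 * h 0 1 + g 1 1 * h 1 1 - 1 =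
      g 1 0 * h 0 1 + ((g 1 1 - 1) * h 1 1 + (h 1 1 - 1)) by ring]
    exact norm_le_of_add (norm_mul_le_left hg.one_zero (mem_integralSL.1 hh.integral _ _))
      (norm_le_of_add (norm_mul_le_left hg.one_one (mem_integralSL.1 hh.integral _ _)) hh.one_one)

theorem InK1.inv {g : SL(2, ℚ_[q])} (hg : InK1 N g) : InK1 N g⁻¹ where
  integral := inv_mem hg.integral
  one_zero := by rw [sl_inv_one_zero, norm_neg]; exact hg.one_zero
  zero_zero := by rw [sl_inv_zero_zero]; exact hg.one_one
  one_one := by rw [sl_inv_one_one]; exact hg.zero_zero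

theorem InK1.isGood (hN : 4 ∣ N) {g : SL(2, ℚ_[q])} (hq : (q : ℕ) = 2) (hg : InK1 N g) :
    IsGood g := by
  have h4 : ‖(N : ℚ_[q])‖ ≤ 1 / 4 := by
    have := norm_intCast_le_quarter hq (n := N) (by exact_mod_cast hN)
    simpa using this
  have key : ∀ x : ℚ_[q], ‖x - 1‖ ≤ 1 / 4 → IsGoodUnit x := fun x hx => by
    have h1 : IsGoodLower (x - 1) := ⟨hx.trans_lt (by norm_num), fun _ => hx⟩
    have := isGoodUnit_one.add h1
    rwa [add_sub_cancel] at this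
  exact ⟨key _ (hg.zero_zero.trans h4), key _ (hg.one_one.trans h4),
    ⟨(hg.one_zero.trans h4).trans_lt (by norm_num), fun _ => hg.one_zero.trans h4⟩,
    mem_integralSL.1 hg.integral _ _⟩

theorem inK1_upper {u : ℚ_[q]} (hu : ‖u‖ ≤ 1) : InK1 N (upperSL u) :=
  ⟨upper_mem_integralSL hu, by simp, by simp, by simp⟩

theorem inK1_lower {u : ℚ_[q]} (hu : ‖u‖ ≤ ‖(N : ℚ_[q])‖) : InK1 N (lowerSL u) := by
  refine ⟨mem_integralSL.2 fun i j => ?_, by simpa using hu, by simp, by simp⟩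
  have h1 : ‖u‖ ≤ 1 := hu.trans (by simpa using norm_intCast_le_one q N)
  fin_cases i <;> fin_cases j <;> simp [h1]

end InK1

/-- Rational matrices whose components away from `p` lie in `K₁(N)`. -/
def IsLevelAway (p : Nat.Primes) (N : ℕ) (α : SL(2, ℚ)) : Prop :=
  ∀ q, q ≠ p → InK1 N (atPlace q α)

section IsLevelAway

variable {p : Nat.Primes} {N : ℕ} {α β : SL(2, ℚ)}

theorem IsLevelAway.mul (hα : IsLevelAway p N α) (hβ : IsLevelAway p N β) :
    IsLevelAway p N (α * β) := fun q hq => by rw [map_mul]; exact (hα q hq).mul (hβ q hq)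

theorem IsLevelAway.inv (hα : IsLevelAway p N α) : IsLevelAway p N α⁻¹ := fun q hq => by
  rw [map_inv]; exact (hα q hq).inv

theorem IsLevelAway.isGoodAway (hN : 4 ∣ N) (hα : IsLevelAway p N α) : IsGoodAway p α :=
  fun q hq => ⟨(hα q hq).integral, fun h => (hα q hq).isGood hN h⟩

end IsLevelAway

theorem cocycleReal_one_right (g : SL(2, ℝ)) : cocycleReal g 1 = 1 := by
  rw [cocycleReal, mul_one, hilbertReal, if_neg]
  rintro ⟨h, -⟩
  exact (mul_self_nonneg (tau g)).not_gt h

theorem cocycle_one_left {q : Nat.Primes} (g : SL(2, ℚ_[q])) : cocycle 1 g = 1 :=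
  signLog_injective (by rw [signLog_one]; exact clog_one_left g)

theorem cocycle_one_right {q : Nat.Primes} (g : SL(2, ℚ_[q])) : cocycle g 1 = 1 :=
  signLog_injective (by rw [signLog_one]; exact clog_one_right g)

/-! ### Decompositions of elements supported at infinity and p. -/

section Lift

variable {p : Nat.Primes} {k N : ℕ}

theorem finite_mul_apply (x y : FiniteSL) (q : Nat.Primes) : (x * y) q = x q * y q := rfl

theorem ofReal_mul_ofLocal (g : RealCover) (x : LocalCover p) :
    ofReal g * ofLocal x = ⟨g.mat, (ofLocal x).fin, g.sgn * x.sgn⟩ := by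
  refine AdelicCover.ext ?_ ?_ ?_
  · exact mul_one _
  · exact one_mul _
  · have h : ∏ᶠ q, cocycle ((1 : FiniteSL) q) ((ofLocal x).fin q) = 1 :=
      finprod_eq_one_of_forall_eq_one fun q => cocycle_one_left _
    refine (congrArg (fun u => g.sgn * x.sgn * (cocycleReal g.mat 1 * u)) h).trans ?_
    rw [cocycleReal_one_right]
    simp

theorem ofLocal_fin_same (x : LocalCover p) : (ofLocal x).fin p = x.mat := by
  rw [ofLocal]; exact RestrictedProduct.mulSingle_eq_same _ _ _

theorem ofLocal_fin_of_ne (x : LocalCover p) {q : Nat.Primes} (hq : q ≠ p) :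
    (ofLocal x).fin q = 1 := by
  rw [ofLocal]; exact RestrictedProduct.mulSingle_eq_of_ne _ _ hq

theorem diagFinite_apply (α : SL(2, ℚ)) (q : Nat.Primes) : diagFinite α q = atPlace q α := rfl

/-- The component of a product `s_ℚ(α) g (k, 1)`. -/
theorem section_mul (α : SL(2, ℚ)) (g : RealCover) (κ : FiniteSL) :
    rationalSection α * ofReal g * ofFinite κ = ⟨atReal α * g.mat, diagFinite α * κ,
      (rationalSection α).sgn * g.sgn * cocycleReal (atReal α) g.mat *
        ∏ᶠ q, cocycle (atPlace q α) (κ q)⟩ := by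
  refine AdelicCover.ext ?_ ?_ ?_
  · exact mul_one _
  · change diagFinite α * 1 * κ = _
    rw [mul_one]
  · have h : ∏ᶠ q, cocycle (diagFinite α q) ((1 : FiniteSL) q) = 1 :=
      finprod_eq_one_of_forall_eq_one fun q => cocycle_one_right _
    have h' : ∏ᶠ q, cocycle ((diagFinite α * 1 : FiniteSL) q) (κ q) =
        ∏ᶠ q, cocycle (atPlace q α) (κ q) := by rw [mul_one (diagFinite α)]; rfl
    refine (congrArg₂ (fun u v => (rationalSection α).sgn * g.sgn *
      (cocycleReal (atReal α) g.mat * u) * 1 * (cocycleReal (atReal α * g.mat) 1 * v)) h h').trans ?_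
    rw [cocycleReal_one_right]
    simp only [mul_one, one_mul, mul_assoc]

/-- Comparison of components forces κ = α⁻¹ at all places other than p, so α must lie in K₁(N)
there. At these places the cocycle of α and κ is trivial, so the finite part of the sign reduces to
the cocycle at p. -/
theorem isDecomposition_iff {g : RealCover} {x : LocalCover p} {t : SL(2, ℚ) × RealCover × FiniteSL}
    (hN : 4 ∣ N) : IsDecomposition N (ofReal g * ofLocal x) t ↔
      IsLevelAway p N t.1 ∧ InK1 N ((atPlace p t.1)⁻¹ * x.mat) ∧
      (∀ q, t.2.2 q = (atPlace q t.1)⁻¹ * (ofLocal x).fin q) ∧ g.mat = atReal t.1 * t.2.1.mat ∧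
      g.sgn * x.sgn = (rationalSection t.1).sgn * t.2.1.sgn *
        cocycleReal (atReal t.1) t.2.1.mat * cocycle (atPlace p t.1) ((atPlace p t.1)⁻¹ * x.mat) := by
  obtain ⟨α, g', κ⟩ := t
  rw [IsDecomposition, ofReal_mul_ofLocal, section_mul]
  have hcomp : (ofLocal x).fin = diagFinite α * κ ↔
      ∀ q, κ q = (atPlace q α)⁻¹ * (ofLocal x).fin q := by
    constructor
    · intro h q
      rw [h, finite_mul_apply, diagFinite_apply, inv_mul_cancel_left]
    · intro h
      ext q : 1
      rw [finite_mul_apply, h q, diagFinite_apply, mul_inv_cancel_left]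
  have hK : (∀ q, κ q = (atPlace q α)⁻¹ * (ofLocal x).fin q) →
      (κ ∈ K1 N ↔ IsLevelAway p N α ∧ InK1 N ((atPlace p α)⁻¹ * x.mat)) := by
    intro h
    have hne : ∀ q, q ≠ p → κ q = (atPlace q α)⁻¹ := fun q hq => by
      rw [h, ofLocal_fin_of_ne x hq, mul_one]
    have hp : κ p = (atPlace p α)⁻¹ * x.mat := by rw [h, ofLocal_fin_same]
    constructor
    · intro hκ
      have hκ' : ∀ q, InK1 N (κ q) := fun q => ⟨(hκ q).1, (hκ q).2.1, (hκ q).2.2.1, (hκ q).2.2.2⟩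
      refine ⟨fun q hq => ?_, hp ▸ hκ' p⟩
      have := (hκ' q).inv
      rwa [hne q hq, inv_inv] at this
    · rintro ⟨h1, h2⟩ q
      have : InK1 N (κ q) := by
        by_cases hq : q = p
        · subst hq; rw [hp]; exact h2
        · rw [hne q hq]; exact (h1 q hq).inv
      exact ⟨this.1, this.2, this.3, this.4⟩
  have hprod : (∀ q, κ q = (atPlace q α)⁻¹ * (ofLocal x).fin q) → IsLevelAway p N α →
      ∏ᶠ q, cocycle (atPlace q α) (κ q) = cocycle (atPlace p α) ((atPlace p α)⁻¹ * x.mat) := by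
    intro h h1
    have hz : ∀ q, q ≠ p → cocycle (atPlace q α) (κ q) = 1 := fun q hq => by
      rw [h, ofLocal_fin_of_ne x hq, mul_one, ← map_inv]
      exact signLog_injective (by
        rw [signLog_one]
        exact (h1.isGoodAway hN).clog_eq_zero (h1.isGoodAway hN).inv hq)
    rw [finprod_eq_single _ p hz, h, ofLocal_fin_same]
  rw [AdelicCover.mk.injEq, hcomp]
  constructor
  · rintro ⟨h1, h2, h3, h4⟩
    obtain ⟨h5, h6⟩ := (hK h3).1 h1
    exact ⟨h5, h6, h3, h2, by rw [← hprod h3 h5]; exact h4⟩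
  · rintro ⟨h1, h2, h3, h4, h5⟩
    exact ⟨(hK h3).2 ⟨h1, h2⟩, h4, h3, by rw [hprod h3 h1]; exact h5⟩

theorem exists_isDecomposition (hN : 4 ∣ N) {g : RealCover} {x : LocalCover p} {α : SL(2, ℚ)}
    (hα : IsLevelAway p N α) (hx : InK1 N ((atPlace p α)⁻¹ * x.mat)) :
    ∃ t, IsDecomposition N (ofReal g * ofLocal x) t := by
  refine ⟨⟨α, ⟨(atReal α)⁻¹ * g.mat, g.sgn * x.sgn * ((rationalSection α).sgn *
    cocycleReal (atReal α) ((atReal α)⁻¹ * g.mat) *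
      cocycle (atPlace p α) ((atPlace p α)⁻¹ * x.mat))⟩, (diagFinite α)⁻¹ * (ofLocal x).fin⟩,
    (isDecomposition_iff hN).2 ⟨hα, hx, fun q => rfl, ?_, ?_⟩⟩
  · rw [mul_inv_cancel_left]
  · have h : ∀ u v w e : ℤˣ, e = u * (e * (u * v * w)) * v * w := by decide
    exact h _ _ _ _

theorem signLog_eq_expSign (u : ℤˣ) : ((u : ℤ) : ℂ) = expSign (signLog u) :=
  (expSign_signLog u).symm

/-- The real part of the decomposition is α⁻¹ g up to sign, so f is evaluated at α⁻¹ z. The quotient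
of the two factors J is the factor of α, with the real cocycle cancelling against the one in the
sign condition. As 2k + 1 is odd, signs pass through the power unchanged. -/
theorem lift_of_isDecomposition (hN : 4 ∣ N) {f : ℍ → ℂ} {g : SL(2, ℝ)} {x : LocalCover p}
    {t : SL(2, ℚ) × RealCover × FiniteSL} (ht : IsDecomposition N (ofReal ⟨g, 1⟩ * ofLocal x) t) :
    f (t.2.1.mat • UpperHalfPlane.I) * realFactor t.2.1 UpperHalfPlane.I ^ (-(2 * k + 1 : ℤ)) *
        realFactor ⟨g, 1⟩ UpperHalfPlane.I ^ (2 * k + 1) =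
      ((x.sgn : ℤ) : ℂ) * expSign (clog (atPlace p t.1) ((atPlace p t.1)⁻¹ * x.mat)) *
        ratFactor t.1 (t.1⁻¹ • (g • UpperHalfPlane.I)) ^ (2 * k + 1) *
          f (t.1⁻¹ • (g • UpperHalfPlane.I)) := by
  obtain ⟨α, g', κ⟩ := t
  obtain ⟨-, -, -, h, hs⟩ := (isDecomposition_iff hN).1 ht
  dsimp only at h hs ⊢
  have hw : g'.mat • UpperHalfPlane.I = α⁻¹ • (g • UpperHalfPlane.I) := by
    rw [h, ← atReal_smul, map_inv, mul_smul, inv_smul_smul]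
  rw [← hw]
  set w := g'.mat • UpperHalfPlane.I
  have hL : lowerRoot (den g UpperHalfPlane.I) = expSign (rclog (atReal α) g'.mat) *
      (lowerRoot (den α w) * lowerRoot (den g'.mat UpperHalfPlane.I)) := by
    rw [h, lowerRoot_den_mul, den_atReal]
  have hs' := congrArg (fun u => expSign (signLog u)) hs
  simp only [one_mul, signLog_mul, expSign_add, signLog_rationalSection] at hs'
  have e1 : realFactor g' UpperHalfPlane.I ≠ 0 := by
    rw [realFactor_eq, signLog_eq_expSign]
    exact mul_ne_zero (expSign_ne_zero _) (lowerRoot_ne_zero (den_ne_zero _ _))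
  have key : realFactor ⟨g, 1⟩ UpperHalfPlane.I = realFactor g' UpperHalfPlane.I *
      (((x.sgn : ℤ) : ℂ) * expSign (clog (atPlace p α) ((atPlace p α)⁻¹ * x.mat)) *
        ratFactor α w) := by
    rw [realFactor_eq, realFactor_eq, hL, ratFactor, signLog_eq_expSign x.sgn, hs',
      signLog_eq_expSign g'.sgn]
    simp only [Units.val_one, Int.cast_one, one_mul]
    rw [show signLog (cocycleReal (atReal α) g'.mat) = rclog (atReal α) g'.mat from rfl,
      show signLog (cocycle (atPlace p α) ((atPlace p α)⁻¹ * x.mat)) =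
        clog (atPlace p α) ((atPlace p α)⁻¹ * x.mat) from rfl]
    generalize clog (atPlace p α) ((atPlace p α)⁻¹ * x.mat) = c
    generalize rclog (atReal α) g'.mat = r
    have h1 := expSign_mul_self c
    have h2 := expSign_mul_self (signLog g'.sgn)
    have h3 := expSign_mul_self (tlog α)
    generalize expSign c = c at *
    generalize expSign (signLog g'.sgn) = s at *
    generalize expSign (tlog α) = t at *
    generalize expSign r = r at *
    linear_combination (-r * lowerRoot (den α w) * lowerRoot (den g'.mat UpperHalfPlane.I)) *
      (s * s * t * t * h1 + t * t * h2 + h3)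
  have hxs : (((x.sgn : ℤ) : ℂ)) ^ (2 * k + 1) = ((x.sgn : ℤ) : ℂ) := by
    rw [signLog_eq_expSign, expSign_pow_odd]
  rw [key, mul_pow, mul_pow, mul_pow, hxs, expSign_pow_odd, zpow_neg,
    show (2 * k + 1 : ℤ) = ((2 * k + 1 : ℕ) : ℤ) by push_cast; ring, zpow_natCast]
  field_simp

end Lift

end HalfIntegral

namespace HalfIntegral

/-! ### The adelic lift on the cosets of the Iwahori subgroup -/

theorem norm_le_prime_iff {q : Nat.Primes} {x : ℚ_[q]} :
    ‖x‖ ≤ ‖((q : ℕ) : ℚ_[q])‖ ↔ ‖x‖ < 1 := by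
  have := Padic.norm_lt_pow_iff_norm_le_pow_sub_one x 0
  rw [zpow_zero, zero_sub, zpow_neg_one, ← Padic.norm_p] at this
  exact this.symm

theorem norm_intCast_le_of_dvd (q : Nat.Primes) {m n : ℤ} (h : n ∣ m) :
    ‖(m : ℚ_[q])‖ ≤ ‖(n : ℚ_[q])‖ := by
  obtain ⟨c, rfl⟩ := h
  rw [Int.cast_mul]
  exact norm_mul_le_left le_rfl (norm_intCast_le_one q c)

theorem eq_intCast_of_norm_le_one {x : ℚ} (h : ∀ q : Nat.Primes, ‖(x : ℚ_[q])‖ ≤ 1) :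
    ∃ m : ℤ, x = m := by
  refine ⟨x.num, ?_⟩
  have : x.den = 1 := by
    by_contra hne
    obtain ⟨r, hr, hd⟩ := Nat.exists_prime_and_dvd hne
    obtain ⟨r, rfl⟩ : ∃ r' : Nat.Primes, (r' : ℕ) = r := ⟨⟨r, hr⟩, rfl⟩
    have h1 : ‖((x.den : ℤ) : ℚ_[r])‖ < 1 := Padic.norm_intCast_lt_one_iff.2 (by exact_mod_cast hd)
    have h2 : ‖(x.num : ℚ_[r])‖ < 1 := by
      have e : (x.num : ℚ_[r]) = (x : ℚ_[r]) * ((x.den : ℤ) : ℚ_[r]) := by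
        have := Rat.mul_den_eq_num x
        exact_mod_cast congrArg (fun y : ℚ => (y : ℚ_[r])) this.symm
      rw [e, norm_mul]
      exact (mul_le_of_le_one_left (norm_nonneg _) (h r)).trans_lt h1
    have h3 := Padic.norm_intCast_lt_one_iff.1 h2
    have := Nat.dvd_gcd (Int.natCast_dvd.1 h3) hd
    rw [x.reduced] at this
    exact r.2.one_lt.ne' (Nat.dvd_one.1 this)
  conv_lhs => rw [← Rat.num_div_den x, this]
  simp

theorem dvd_of_norm_le {m : ℤ} {n : ℕ} (hn : n ≠ 0)
    (h : ∀ q : Nat.Primes, ‖(m : ℚ_[q])‖ ≤ ‖(n : ℚ_[q])‖) : (n : ℤ) ∣ m := by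
  have hnq : (n : ℚ) ≠ 0 := by exact_mod_cast hn
  obtain ⟨c, hc⟩ := eq_intCast_of_norm_le_one (x := (m : ℚ) / n) fun q => by
    push_cast
    rw [norm_div]
    exact div_le_one_of_le₀ (h q) (norm_nonneg _)
  refine ⟨c, ?_⟩
  rw [div_eq_iff hnq] at hc
  have : m = c * n := by exact_mod_cast hc
  rw [this, mul_comm]

theorem exists_toRat_eq {α : SL(2, ℚ)} (h : ∀ q, atPlace q α ∈ integralSL q) :
    ∃ γ : SL(2, ℤ), toRat γ = α := by
  have hi : ∀ i j, ∃ m : ℤ, α i j = m := fun i j => eq_intCast_of_norm_le_one fun q => by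
    have := mem_integralSL.1 (h q) i j
    rwa [atPlace_apply] at this
  choose m hm using hi
  refine ⟨⟨Matrix.of m, ?_⟩, ?_⟩
  · have d := sl_det α
    rw [hm, hm, hm, hm] at d
    rw [Matrix.det_fin_two]
    exact_mod_cast d
  · exact sl_ext ((toRat_apply _ _ _).trans (hm _ _).symm) ((toRat_apply _ _ _).trans (hm _ _).symm)
      ((toRat_apply _ _ _).trans (hm _ _).symm) ((toRat_apply _ _ _).trans (hm _ _).symm)

section Coset

variable {p : Nat.Primes} {n : ℕ}

theorem norm_level_at (hpn : ¬ (p : ℕ) ∣ n) :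
    ‖((p * n : ℕ) : ℚ_[p])‖ = ‖((p : ℕ) : ℚ_[p])‖ := by
  have : ‖((n : ℤ) : ℚ_[p])‖ = 1 := norm_intCast_eq_one (by exact_mod_cast hpn)
  rw [Int.cast_natCast] at this
  rw [Nat.cast_mul, norm_mul, this, mul_one]

theorem norm_level_away {q : Nat.Primes} (hq : q ≠ p) :
    ‖((p * n : ℕ) : ℚ_[q])‖ = ‖(n : ℚ_[q])‖ := by
  have : ‖(((p : ℕ) : ℤ) : ℚ_[q])‖ = 1 := norm_intCast_eq_one (not_prime_dvd hq)
  rw [Int.cast_natCast] at this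
  rw [Nat.cast_mul, norm_mul, this, one_mul]

/-- Strong approximation made explicit. Choose d congruent to κ 1 1 mod p and to 1 mod n, and
complete the coprime pair (pn, d) to the bottom row of an integral matrix. It lies in K₁(pn) away
from p and agrees with κ at p up to a matrix that is upper unipotent mod p. -/
theorem exists_isLevelAway_inv_mul (hpn : ¬ (p : ℕ) ∣ n) {κ : SL(2, ℚ_[p])} (hκ : κ ∈ iwahori p) :
    ∃ γ : SL(2, ℤ), IsLevelAway p (p * n) (toRat γ) ∧
      InK1 (p * n) ((atPlace p (toRat γ))⁻¹ * κ) := by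
  have hi := mem_integralSL.1 hκ.1
  have hκc : ‖κ 1 0‖ < 1 := norm_le_prime_iff.1 hκ.2
  have hdet := sl_det κ
  obtain ⟨m, hm⟩ : ∃ m : ℕ, ‖κ 1 1 - (m : ℚ_[p])‖ < 1 :=
    ⟨_, PadicInt.norm_sub_zmodRepr_lt_one (toIntegral (κ 1 1) (hi 1 1))⟩
  have hcop : Nat.Coprime p n := (Nat.Prime.coprime_iff_not_dvd p.2).2 hpn
  obtain ⟨d, hdm, hd1⟩ := Nat.chineseRemainder hcop m 1
  have hdp : ‖κ 1 1 - (d : ℚ_[p])‖ < 1 := by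
    have h1 : ‖((m - d : ℤ) : ℚ_[p])‖ < 1 :=
      Padic.norm_intCast_lt_one_iff.2 (Nat.modEq_iff_dvd.1 hdm)
    have := norm_lt_of_add hm h1
    push_cast at this
    rwa [sub_add_sub_cancel] at this
  have hdn : (n : ℤ) ∣ d - 1 := by
    have := Nat.modEq_iff_dvd.1 hd1.symm
    simpa using this
  have hpd : ¬ ((p : ℕ) : ℤ) ∣ d := fun h => by
    have h1 : ‖((d : ℤ) : ℚ_[p])‖ < 1 := Padic.norm_intCast_lt_one_iff.2 h
    have h2 : ‖κ 1 1‖ < 1 := by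
      have := norm_lt_of_add hdp h1
      rwa [Int.cast_natCast, sub_add_cancel] at this
    have h3 : ‖κ 0 0 * κ 1 1 + -(κ 0 1 * κ 1 0)‖ < 1 := by
      refine norm_lt_of_add ?_ ?_
      · rw [norm_mul]
        exact (mul_le_of_le_one_left (norm_nonneg _) (hi 0 0)).trans_lt h2
      · rw [norm_neg, norm_mul]
        exact (mul_le_of_le_one_left (norm_nonneg _) (hi 0 1)).trans_lt hκc
    rw [← sub_eq_add_neg, hdet, norm_one] at h3
    exact lt_irrefl _ h3
  have hcd : IsCoprime ((p * n : ℕ) : ℤ) (d : ℤ) := by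
    push_cast
    refine IsCoprime.mul_left ?_ ?_
    · exact (Prime.coprime_iff_not_dvd (Nat.prime_iff_prime_int.1 p.2)).2 hpd
    · obtain ⟨e, he⟩ := hdn
      exact ⟨-e, 1, by linear_combination he⟩
  obtain ⟨b, a, hab⟩ := hcd
  have hγdet : (!![a, -b; ((p * n : ℕ) : ℤ), (d : ℤ)] : Matrix (Fin 2) (Fin 2) ℤ).det = 1 := by
    rw [Matrix.det_fin_two_of]; linear_combination hab
  let γ : SL(2, ℤ) := ⟨!![a, -b; ((p * n : ℕ) : ℤ), (d : ℤ)], hγdet⟩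
  have e00 : γ 0 0 = a := rfl
  have e01 : γ 0 1 = -b := rfl
  have e10 : γ 1 0 = ((p * n : ℕ) : ℤ) := rfl
  have e11 : γ 1 1 = d := rfl
  have habq : ∀ q : Nat.Primes, (b : ℚ_[q]) * ((p * n : ℕ) : ℚ_[q]) + a * d = 1 := fun q => by
    exact_mod_cast congrArg (fun x : ℤ => (x : ℚ_[q])) hab
  have hnd : ∀ q : Nat.Primes, ‖(d : ℚ_[q]) - 1‖ ≤ ‖(n : ℚ_[q])‖ := fun q => by
    have := norm_intCast_le_of_dvd q hdn
    push_cast at this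
    exact this
  refine ⟨γ, fun q hq => ⟨toRat_mem_integralSL q γ, ?_, ?_, ?_⟩,
    mul_mem (inv_mem (toRat_mem_integralSL p γ)) hκ.1, ?_, ?_, ?_⟩
  · rw [atPlace_apply, toRat_apply, e10]; simp
  · rw [atPlace_apply, toRat_apply, e00, Rat.cast_intCast, norm_level_away hq,
      show (a : ℚ_[q]) - 1 = -(b * ((p * n : ℕ) : ℚ_[q])) - a * ((d : ℚ_[q]) - 1) by
        linear_combination habq q, sub_eq_add_neg]
    refine norm_le_of_add ?_ ?_
    · rw [norm_neg]
      exact norm_mul_le_right (norm_intCast_le_one q b) (norm_level_away hq).le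
    · rw [norm_neg]
      exact norm_mul_le_right (norm_intCast_le_one q a) (hnd q)
  · rw [atPlace_apply, toRat_apply, e11, norm_level_away hq]
    simpa using hnd q
  all_goals rw [norm_level_at hpn, norm_le_prime_iff]
  · rw [sl_mul_one_zero, sl_inv_one_zero, sl_inv_one_one]
    simp only [atPlace_apply, toRat_apply, e10, e00, Rat.cast_intCast, Int.cast_natCast,
      Rat.cast_natCast]
    refine norm_lt_of_add ?_ ?_
    · rw [neg_mul, norm_neg, ← norm_le_prime_iff]
      exact norm_mul_le_left (norm_level_at hpn).le (hi 0 0)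
    · rw [← norm_le_prime_iff]
      exact norm_mul_le_right (norm_intCast_le_one p a) hκ.2
  · rw [sl_mul_zero_zero, sl_inv_zero_zero, sl_inv_zero_one]
    simp only [atPlace_apply, toRat_apply, e11, e01, Rat.cast_intCast, Int.cast_natCast,
      Rat.cast_natCast, Int.cast_neg, Rat.cast_neg, neg_neg]
    rw [show (d : ℚ_[p]) * κ 0 0 + b * κ 1 0 - 1 =
      (-(κ 1 1 - d)) * κ 0 0 + (κ 0 1 * κ 1 0 + b * κ 1 0) by linear_combination hdet,
      ← norm_le_prime_iff]
    refine norm_le_of_add (norm_mul_le_left ?_ (hi 0 0)) (norm_le_of_add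
      (norm_mul_le_right (hi 0 1) hκ.2) (norm_mul_le_right (norm_intCast_le_one p b) hκ.2))
    rw [norm_neg, norm_le_prime_iff]; exact hdp
  · rw [sl_mul_one_one, sl_inv_one_one, sl_inv_one_zero]
    simp only [atPlace_apply, toRat_apply, e10, e00, Rat.cast_intCast, Int.cast_natCast,
      Rat.cast_natCast]
    rw [show -((p * n : ℕ) : ℚ_[p]) * κ 0 1 + a * κ 1 1 - 1 =
      ((p * n : ℕ) : ℚ_[p]) * (-κ 0 1) + (a * (κ 1 1 - d) + -(((p * n : ℕ) : ℚ_[p]) * b)) by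
        linear_combination habq p, ← norm_le_prime_iff]
    refine norm_le_of_add (norm_mul_le_left (norm_level_at hpn).le (by rw [norm_neg]; exact hi 0 1))
      (norm_le_of_add (norm_mul_le_right (norm_intCast_le_one p a) (norm_le_prime_iff.2 hdp)) ?_)
    rw [norm_neg]
    exact norm_mul_le_left (norm_level_at hpn).le (norm_intCast_le_one p b)

theorem mul_mem_iwahori {g h : SL(2, ℚ_[p])} (hg : g ∈ iwahori p) (hh : h ∈ iwahori p) :
    g * h ∈ iwahori p := ⟨mul_mem hg.1 hh.1, by
  rw [sl_mul_one_zero]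
  exact norm_le_of_add (norm_mul_le_left hg.2 (mem_integralSL.1 hh.1 _ _))
    (norm_mul_le_right (mem_integralSL.1 hg.1 _ _) hh.2)⟩

theorem inv_mem_iwahori {g : SL(2, ℚ_[p])} (hg : g ∈ iwahori p) : g⁻¹ ∈ iwahori p :=
  ⟨inv_mem hg.1, by rw [sl_inv_one_zero, norm_neg]; exact hg.2⟩

theorem InK1.mem_iwahori (hpn : ¬ (p : ℕ) ∣ n) {g : SL(2, ℚ_[p])} (hg : InK1 (p * n) g) :
    g ∈ iwahori p := ⟨hg.integral, by rw [← norm_level_at hpn]; exact hg.one_zero⟩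

/-- A function on `ℍ` that is invariant under the weight `k + 1/2` action of `Γ₀(N)`. -/
def IsInvariant (k N : ℕ) (f : ℍ → ℂ) : Prop :=
  ∀ γ ∈ CongruenceSubgroup.Gamma0 N, slash k γ (thetaFactor γ) f = f

theorem slash_apply_eq {k : ℕ} {γ : SL(2, ℤ)} {φ f : ℍ → ℂ} {z : ℍ} (hφ : φ z ≠ 0)
    (h : slash k γ φ f z = f z) : f (γ • z) = φ z ^ (2 * k + 1) * f z := by
  rw [slash, zpow_neg, show (2 * k + 1 : ℤ) = ((2 * k + 1 : ℕ) : ℤ) by push_cast; ring,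
    zpow_natCast] at h
  rw [← h]
  field_simp

/-- A rational matrix that is integral at every place is integral, and divisibility of c by pn can
be tested place by place. The congruence d ≡ 1 mod 4 comes from the place 2, which differs from p.
-/
theorem exists_gamma_of_isLevelAway (h4 : 4 ∣ n) (hpn : ¬ (p : ℕ) ∣ n) {β : SL(2, ℚ)}
    (hβ : IsLevelAway p (p * n) β) (hp : atPlace p β ∈ iwahori p) (hp2 : (p : ℕ) ≠ 2) :
    ∃ γ : SL(2, ℤ), toRat γ = β ∧ γ ∈ CongruenceSubgroup.Gamma0 (p * n) ∧ IsGamma14 γ := by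
  have hn : p * n ≠ 0 := mul_ne_zero p.2.ne_zero (by rintro rfl; exact hpn (dvd_zero _))
  obtain ⟨γ, hγ⟩ := exists_toRat_eq (α := β) fun q => by
    by_cases hq : q = p
    · subst hq; exact hp.1
    · exact (hβ q hq).integral
  have hdvd : ((p * n : ℕ) : ℤ) ∣ γ 1 0 := dvd_of_norm_le hn fun q => by
    have e : atPlace q β 1 0 = (γ 1 0 : ℚ_[q]) := by rw [← hγ]; simp
    rw [← e]
    by_cases hq : q = p
    · subst hq; rw [norm_level_at hpn]; exact hp.2
    · exact (hβ q hq).one_zero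
  refine ⟨γ, hγ, ?_, ?_, ?_⟩
  · rw [CongruenceSubgroup.Gamma0_mem, ZMod.intCast_zmod_eq_zero_iff_dvd]; exact hdvd
  · exact dvd_trans (by exact_mod_cast h4.mul_left _) hdvd
  · have h2 : twoPrime ≠ p := fun h => hp2 (by rw [← h]; rfl)
    have h1 := (hβ twoPrime h2).one_one
    have e : atPlace twoPrime β 1 1 = (γ 1 1 : ℚ_[twoPrime]) := by rw [← hγ]; simp
    rw [e] at h1
    have h3 : ((twoPrime : ℕ) ^ 2 : ℤ) ∣ γ 1 1 - 1 := by
      refine (Padic.norm_int_le_pow_iff_dvd (p := twoPrime) _ 2).1 ?_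
      push_cast
      refine h1.trans ?_
      have h5 := (Padic.norm_int_le_pow_iff_dvd (p := twoPrime) ((p * n : ℕ) : ℤ) 2).2 (by
        change ((2 : ℕ) ^ 2 : ℤ) ∣ _
        norm_num
        exact_mod_cast h4.mul_left _)
      rw [Int.cast_natCast] at h5
      exact_mod_cast h5
    have h6 : (4 : ℤ) ∣ γ 1 1 - 1 := by
      change ((2 : ℕ) ^ 2 : ℤ) ∣ _ at h3
      norm_num at h3
      exact h3
    omega

/-- The adelic lift on a coset of the Iwahori subgroup. -/
theorem adelicLift_coset {k : ℕ} (h4 : 4 ∣ n) (hpn : ¬ (p : ℕ) ∣ n) (hp2 : (p : ℕ) ≠ 2)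
    {f : ℍ → ℂ} (hf : IsInvariant k (p * n) f) (g : SL(2, ℝ)) {α : SL(2, ℚ)}
    (hα : IsLevelAway p (p * n) α) {κ : SL(2, ℚ_[p])} (hκ : κ ∈ iwahori p) (ε : ℤˣ) :
    adelicLift k (p * n) f (ofReal ⟨g, 1⟩ * ofLocal ⟨atPlace p α * κ, ε⟩) *
        realFactor ⟨g, 1⟩ UpperHalfPlane.I ^ (2 * k + 1) =
      ((ε : ℤ) : ℂ) * expSign (clog (atPlace p α) κ) *
        ratFactor α (α⁻¹ • (g • UpperHalfPlane.I)) ^ (2 * k + 1) *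
          f (α⁻¹ • (g • UpperHalfPlane.I)) := by
  have h4' : 4 ∣ p * n := h4.mul_left _
  have hex : ∃ t, IsDecomposition (p * n) (ofReal ⟨g, 1⟩ * ofLocal ⟨atPlace p α * κ, ε⟩) t := by
    obtain ⟨γ, h1, h2⟩ := exists_isLevelAway_inv_mul hpn hκ
    refine exists_isDecomposition h4' (hα.mul h1) ?_
    rw [map_mul, mul_inv_rev, mul_assoc, inv_mul_cancel_left]
    exact h2
  rw [adelicLift, dif_pos hex, lift_of_isDecomposition h4' hex.choose_spec]
  obtain ⟨h1, h2, -⟩ := (isDecomposition_iff h4').1 hex.choose_spec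
  set β := hex.choose.1
  dsimp only at h2 ⊢
  -- The rational part β of the chosen decomposition is not under control, but δ comes from an
  -- element of Γ₀(pn) with d ≡ 1 mod 4. The invariance of f under it makes the value independent of
  -- the choice.
  set δ := α⁻¹ * β with hδ
  have hβ : β = α * δ := by rw [hδ, mul_inv_cancel_left]
  have hκ' : (atPlace p (α * δ))⁻¹ * (atPlace p α * κ) = (atPlace p δ)⁻¹ * κ := by
    rw [map_mul, mul_inv_rev, mul_assoc, inv_mul_cancel_left]
  rw [hβ, hκ'] at h2 ⊢
  rw [map_mul]
  have hδp : atPlace p δ ∈ iwahori p := by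
    have := mul_mem_iwahori hκ (inv_mem_iwahori (h2.mem_iwahori hpn))
    rwa [mul_inv_rev, inv_inv, mul_inv_cancel_left] at this
  have hδl : IsLevelAway p (p * n) δ := hα.inv.mul h1
  obtain ⟨γ, hγ, hγ0, hγ1⟩ := exists_gamma_of_isLevelAway h4 hpn hδl hδp hp2
  set w := (δ⁻¹ * α⁻¹) • (g • UpperHalfPlane.I) with hw
  have hw' : (α * δ)⁻¹ • (g • UpperHalfPlane.I) = w := by rw [mul_inv_rev]
  have hw1 : α⁻¹ • (g • UpperHalfPlane.I) = γ • w := by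
    rw [← toRat_smul, hγ, hw, smul_smul δ, mul_inv_cancel_left]
  have hfγ := slash_apply_eq (hγ1.thetaFactor_ne_zero w) (congrFun (hf γ hγ0) w)
  rw [hw1, hfγ, hγ1.thetaFactor_eq, hγ,
    ratFactor_mul (hα.isGoodAway h4') (hδl.isGoodAway h4'), mul_pow, mul_pow, expSign_pow_odd]
  -- As σ_p is trivial on SL₂(ℤ_p), this relation turns the two cocycle values of the chosen
  -- decomposition into σ_p(α, κ).
  have hc := clog_assoc (atPlace p α) (atPlace p δ) ((atPlace p δ)⁻¹ * κ)
  rw [mul_inv_cancel_left, clog_eq_zero_of_odd hp2 hδp.1 _ (mul_mem (inv_mem hδp.1) hκ.1),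
    add_zero] at hc
  rw [← hc, expSign_add, hw', show δ • w = γ • w by rw [← toRat_smul, hγ]]
  ring

end Coset

end HalfIntegral

namespace HalfIntegral

/-! ### Elements of the Iwahori Hecke algebra -/

section Hecke

variable {p : Nat.Primes}

@[simp] theorem wMatrix_zero_zero (t : ℚ_[p]ˣ) : wMatrix t 0 0 = 0 := rfl
@[simp] theorem wMatrix_zero_one (t : ℚ_[p]ˣ) : wMatrix t 0 1 = t := rfl
@[simp] theorem wMatrix_one_zero (t : ℚ_[p]ˣ) : wMatrix t 1 0 = -(t : ℚ_[p])⁻¹ := by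
  change -((t⁻¹ : ℚ_[p]ˣ) : ℚ_[p]) = _
  rw [Units.val_inv_eq_inv_val]
@[simp] theorem wMatrix_one_one (t : ℚ_[p]ˣ) : wMatrix t 1 1 = 0 := rfl

theorem iwahori_isGood (hp2 : (p : ℕ) ≠ 2) {κ : SL(2, ℚ_[p])} (hκ : κ ∈ iwahori p) : IsGood κ :=
  isGood_of_odd hp2 hκ.1 (norm_le_prime_iff.1 hκ.2)

theorem clog_iwahori (hp2 : (p : ℕ) ≠ 2) {g h : SL(2, ℚ_[p])} (hg : g ∈ iwahori p)
    (hh : h ∈ iwahori p) : clog g h = 0 := clog_eq_zero_of_odd hp2 hg.1 _ hh.1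

theorem IsGood.slog_eq_one_one {q : Nat.Primes} {g : SL(2, ℚ_[q])} (hg : IsGood g)
    (hc : g 1 0 ≠ 0) : slog g = hlog (g 1 1) (g 1 0) := by
  rcases Int.even_or_odd (g 1 0).valuation with h | h
  · rw [slog_of_even h, hlog_eq_zero_of_even hg.one_one hc h]
  · rw [slog_of_odd h hg.one_one.ne_zero, hlog_comm]

theorem slog_wMatrix (t : ℚ_[p]ˣ) : slog (wMatrix t) = 0 := slog_of_zero (Or.inr rfl)

theorem tau_wMatrix (t : ℚ_[p]ˣ) : tau (wMatrix t) = -(t : ℚ_[p])⁻¹ := by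
  rw [tau_of_ne] <;> simp

-- This formula and its mirror image `clog_wMatrix_left` have the same shape, with the diagonal
-- entries exchanged. Moving κ through w(t) exchanges these entries as well, so the two signs can be
-- compared in `doubleLog_congr`.
set_option linter.unusedSimpArgs false in
theorem clog_wMatrix_right (t : ℚ_[p]ˣ) {κ : SL(2, ℚ_[p])}
    (hκ : IsGood κ) : clog κ (wMatrix t) = hlog (t : ℚ_[p]) (κ 1 1) + slog (κ * wMatrix t) := by
  have hH := isSymbol_hlog p
  have hd := hκ.one_one.ne_zero
  have ht := t.ne_zero
  have e : (κ * wMatrix t) 1 0 = -(κ 1 1 * (t : ℚ_[p])⁻¹) := by rw [sl_mul_one_zero]; simp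
  have e' : tau (κ * wMatrix t) = -(κ 1 1 * (t : ℚ_[p])⁻¹) := by
    rw [tau_of_ne, e]; rw [e]; exact neg_ne_zero.2 (mul_ne_zero hd (inv_ne_zero ht))
  rw [clog_eq, kubota, e', tau_wMatrix, slog_wMatrix, add_zero]
  congr 1
  have h1 := hlog_neg_one_of_good hκ.one_one
  have hself : hlog (κ 1 1) (κ 1 1) = 0 := by rw [hH.self hd, h1]
  by_cases hc : κ 1 0 = 0
  · rw [tau_of_eq hc, slog_of_zero (Or.inl hc), add_zero,
      show -(κ 1 1 * (t : ℚ_[p])⁻¹) * κ 1 1 = (-1) * (t : ℚ_[p])⁻¹ * (κ 1 1 * κ 1 1) by ring,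
      show -(κ 1 1 * (t : ℚ_[p])⁻¹) * -(t : ℚ_[p])⁻¹ = κ 1 1 * ((t : ℚ_[p])⁻¹ * (t : ℚ_[p])⁻¹) by ring]
    have hn1 : (-1 : ℚ_[p]) ≠ 0 := by simp
    rw [hH.comm (κ 1 1) (-1)] at h1
    simp only [hH.mul_left, hH.mul_right, hH.inv_left, hH.inv_right, ht, hd, mul_ne_zero_iff, ne_eq,
      not_false_eq_true, and_self, inv_eq_zero, neg_eq_zero, one_ne_zero, hself, h1]
    grind
  · rw [tau_of_ne hc, hκ.slog_eq_one_one hc,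
      show -(κ 1 1 * (t : ℚ_[p])⁻¹) * κ 1 0 = (-κ 1 1) * ((t : ℚ_[p])⁻¹ * κ 1 0) by ring,
      show -(κ 1 1 * (t : ℚ_[p])⁻¹) * -(t : ℚ_[p])⁻¹ = κ 1 1 * ((t : ℚ_[p])⁻¹ * (t : ℚ_[p])⁻¹) by ring]
    have h2 : hlog (-κ 1 1) (κ 1 1) = 0 := by rw [hH.comm]; exact hH.neg_self hd
    rw [hH.comm (κ 1 1) (κ 1 0)]
    simp only [hH.mul_left, hH.mul_right, hH.inv_left, hH.inv_right, ht, hd, hc, mul_ne_zero_iff, ne_eq,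
      not_false_eq_true, and_self, inv_eq_zero, neg_eq_zero, one_ne_zero, h2]
    grind

set_option linter.unusedSimpArgs false in
theorem clog_wMatrix_left (hp2 : (p : ℕ) ≠ 2) (t : ℚ_[p]ˣ) {κ : SL(2, ℚ_[p])}
    (hκ : IsGood κ) : clog (wMatrix t) κ = hlog (t : ℚ_[p]) (κ 0 0) + slog (wMatrix t * κ) := by
  have hH := isSymbol_hlog p
  have ha := hκ.zero_zero.ne_zero
  have ht := t.ne_zero
  have e : (wMatrix t * κ) 1 0 = -((t : ℚ_[p])⁻¹ * κ 0 0) := by rw [sl_mul_one_zero]; simp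
  have e' : tau (wMatrix t * κ) = -((t : ℚ_[p])⁻¹ * κ 0 0) := by
    rw [tau_of_ne, e]; rw [e]; exact neg_ne_zero.2 (mul_ne_zero (inv_ne_zero ht) ha)
  rw [clog_eq, kubota, e', tau_wMatrix, slog_wMatrix, add_zero]
  congr 1
  have h1 := hlog_neg_one_of_good hκ.zero_zero
  have hself : hlog (κ 0 0) (κ 0 0) = 0 := by rw [hH.self ha, h1]
  have hn1 : (-1 : ℚ_[p]) ≠ 0 := by simp
  rw [show -((t : ℚ_[p])⁻¹ * κ 0 0) * -(t : ℚ_[p])⁻¹ =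
      κ 0 0 * ((t : ℚ_[p])⁻¹ * (t : ℚ_[p])⁻¹) by ring, hH.comm (t : ℚ_[p])]
  by_cases hc : κ 1 0 = 0
  · have hd := hκ.one_one.ne_zero
    have h3 : hlog (κ 0 0) (κ 1 1) = 0 := hlog_eq_zero_of_units hp2 hκ.zero_zero.1 hκ.one_one.1
    rw [tau_of_eq hc, slog_of_zero (Or.inl hc), add_zero,
      show -((t : ℚ_[p])⁻¹ * κ 0 0) * κ 1 1 = (-1) * ((t : ℚ_[p])⁻¹ * κ 0 0 * κ 1 1) by ring]
    simp only [hH.mul_left, hH.mul_right, hH.inv_left, hH.inv_right, ht, hd, ha, mul_ne_zero_iff, ne_eq,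
      not_false_eq_true, and_self, inv_eq_zero, neg_eq_zero, one_ne_zero, hself, h1, h3]
    grind
  · rw [tau_of_ne hc, hκ.slog_eq hc,
      show -((t : ℚ_[p])⁻¹ * κ 0 0) * κ 1 0 = (-1) * ((t : ℚ_[p])⁻¹ * κ 0 0 * κ 1 0) by ring]
    simp only [hH.mul_left, hH.mul_right, hH.inv_left, hH.inv_right, ht, hc, ha, mul_ne_zero_iff, ne_eq,
      not_false_eq_true, and_self, inv_eq_zero, neg_eq_zero, one_ne_zero, hself, h1]
    grind

/-- The sign relating `(a w b, 1)` to the product `(a, 1) (w, 1) (b, 1)`. -/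
noncomputable def doubleLog (w a b : SL(2, ℚ_[p])) : ZMod 2 := clog a w + clog (a * w) b

theorem doubleLog_mul_right (hp2 : (p : ℕ) ≠ 2) (w a : SL(2, ℚ_[p])) {b κ : SL(2, ℚ_[p])}
    (hb : b ∈ iwahori p) (hκ : κ ∈ iwahori p) :
    doubleLog w a (b * κ) = doubleLog w a b + clog (a * w * b) κ := by
  have := clog_assoc (a * w) b κ
  rw [clog_iwahori hp2 hb hκ] at this
  rw [doubleLog, doubleLog]
  grind

theorem doubleLog_mul_left (hp2 : (p : ℕ) ≠ 2) (w b : SL(2, ℚ_[p])) {a a' : SL(2, ℚ_[p])}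
    (ha : a ∈ iwahori p) (ha' : a' ∈ iwahori p) :
    doubleLog w (a * a') b = doubleLog w a' b + clog a (a' * w * b) := by
  have h1 := clog_assoc a a' w
  have h2 := clog_assoc a (a' * w) b
  rw [clog_iwahori hp2 ha ha'] at h1
  rw [← mul_assoc] at h2
  rw [doubleLog, doubleLog]
  grind

/-- The sign is determined by the product. -/
theorem doubleLog_congr (hp2 : (p : ℕ) ≠ 2) (t : ℚ_[p]ˣ) {a b a' b' : SL(2, ℚ_[p])}
    (ha : a ∈ iwahori p) (hb : b ∈ iwahori p) (ha' : a' ∈ iwahori p) (hb' : b' ∈ iwahori p)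
    (h : a * wMatrix t * b = a' * wMatrix t * b') :
    doubleLog (wMatrix t) a b = doubleLog (wMatrix t) a' b' := by
  set w := wMatrix t
  have hκ := mul_mem_iwahori (inv_mem_iwahori ha') ha
  have hκ' := mul_mem_iwahori hb' (inv_mem_iwahori hb)
  set κ := a'⁻¹ * a with e
  set κ' := b' * b⁻¹ with e'
  have ea : a = a' * κ := by rw [e, mul_inv_cancel_left]
  have eb : b' = κ' * b := by rw [e', inv_mul_cancel_right]
  have hw : κ * w = w * κ' := by
    rw [e, e', mul_assoc, inv_mul_eq_iff_eq_mul, ← mul_assoc, ← mul_assoc, eq_mul_inv_iff_mul_eq, h]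
  -- Two factorizations of one element differ by κ w = w κ' with κ, κ' in the Iwahori subgroup.
  -- Equality of these entries is what makes σ_p(κ, w) = σ_p(w, κ').
  have hentry : κ' 0 0 = κ 1 1 := by
    have ht := t.ne_zero
    have h1 : (κ * w) 1 0 = -(κ 1 1 * (t : ℚ_[p])⁻¹) := by rw [sl_mul_one_zero]; simp [w]
    have h1' : (w * κ') 1 0 = -((t : ℚ_[p])⁻¹ * κ' 0 0) := by rw [sl_mul_one_zero]; simp [w]
    rw [hw, h1'] at h1
    have h2 : (t : ℚ_[p])⁻¹ * (κ' 0 0 - κ 1 1) = 0 := by linear_combination -h1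
    exact sub_eq_zero.1 ((mul_eq_zero.1 h2).resolve_left (inv_ne_zero ht))
  have key : clog κ w = clog w κ' := by
    rw [clog_wMatrix_right t (iwahori_isGood hp2 hκ),
      clog_wMatrix_left hp2 t (iwahori_isGood hp2 hκ'), hentry, hw]
  have h1 := clog_assoc a' κ w
  have h2 := clog_assoc (a' * w) κ' b
  have h3 := clog_assoc a' w κ'
  rw [clog_iwahori hp2 ha' hκ] at h1
  rw [clog_iwahori hp2 hκ' hb] at h2
  rw [doubleLog, doubleLog, ea, eb]
  rw [hw] at h1
  rw [mul_assoc a' κ w, hw, ← mul_assoc]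
  grind

/-- The value in the definition uses a chosen factorization. By `doubleLog_congr` its sign depends
only on the product, so any factorization at hand computes it. -/
theorem heckeElement_apply (hp2 : (p : ℕ) ≠ 2) (n : ℤ) {a b : SL(2, ℚ_[p])}
    (ha : a ∈ iwahori p) (hb : b ∈ iwahori p) (ε : ℤˣ) :
    heckeElement p n ⟨a * wMatrix (primeUnit p ^ (-n)) * b, ε⟩ =
      ((ε : ℤ) : ℂ) * expSign (doubleLog (wMatrix (primeUnit p ^ (-n))) a b) *
        conj (gammaW (primeUnit p ^ (-n))) := by
  set w := wMatrix (primeUnit p ^ (-n)) with hw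
  have hex : ∃ κ : LocalCover p × LocalCover p, κ.1.mat ∈ iwahori p ∧ κ.2.mat ∈ iwahori p ∧
      (⟨a * w * b, ε⟩ : LocalCover p) = κ.1 * ⟨w, 1⟩ * κ.2 := by
    refine ⟨(⟨a, 1⟩, ⟨b, ε * (cocycle a w * cocycle (a * w) b)⟩), ha, hb, ?_⟩
    refine LocalCover.ext rfl ?_
    change ε = 1 * 1 * cocycle a w * (ε * (cocycle a w * cocycle (a * w) b)) * cocycle (a * w) b
    have h : ∀ u v e : ℤˣ, e = 1 * 1 * u * (e * (u * v)) * v := by decide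
    exact h _ _ _
  rw [heckeElement, dif_pos hex]
  obtain ⟨h1, h2, h3⟩ := hex.choose_spec
  set κ := hex.choose
  have hm : a * w * b = κ.1.mat * w * κ.2.mat := congrArg LocalCover.mat h3
  have hs : ε = κ.1.sgn * 1 * cocycle κ.1.mat w * κ.2.sgn * cocycle (κ.1.mat * w) κ.2.mat :=
    congrArg LocalCover.sgn h3
  rw [doubleLog_congr hp2 _ ha hb h1 h2 hm]
  have hs' : ((ε : ℤ) : ℂ) = ((κ.1.sgn : ℤ) : ℂ) * ((κ.2.sgn : ℤ) : ℂ) *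
      expSign (doubleLog w κ.1.mat κ.2.mat) := by
    rw [doubleLog, expSign_add, clog, clog, expSign_signLog, expSign_signLog, hs]
    push_cast
    ring
  rw [hs', gamma, gamma, ← hw, map_intCast, map_intCast]
  linear_combination (-((κ.1.sgn : ℤ) : ℂ) * ((κ.2.sgn : ℤ) : ℂ) *
    conj (gammaW (primeUnit p ^ (-n)))) * expSign_mul_self (doubleLog w κ.1.mat κ.2.mat)

theorem heckeElement_eq_zero {n : ℤ} {x : SL(2, ℚ_[p])} {ε : ℤˣ}
    (h : ∀ a ∈ iwahori p, ∀ b ∈ iwahori p, x ≠ a * wMatrix (primeUnit p ^ (-n)) * b) :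
    heckeElement p n ⟨x, ε⟩ = 0 := by
  rw [heckeElement, dif_neg]
  rintro ⟨κ, h1, h2, h3⟩
  exact h _ h1 _ h2 (congrArg LocalCover.mat h3)

/-- On a right coset of the Iwahori subgroup the function varies by the sign ε σ_p(·, κ), the same
one by which the adelic lift varies. -/
theorem heckeElement_mul (hp2 : (p : ℕ) ≠ 2) (n : ℤ) {a b κ : SL(2, ℚ_[p])}
    (ha : a ∈ iwahori p) (hb : b ∈ iwahori p) (hκ : κ ∈ iwahori p) (ε : ℤˣ) :
    heckeElement p n ⟨a * wMatrix (primeUnit p ^ (-n)) * b * κ, ε⟩ =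
      expSign (doubleLog (wMatrix (primeUnit p ^ (-n))) a b) * conj (gammaW (primeUnit p ^ (-n))) *
        (((ε : ℤ) : ℂ) * expSign (clog (a * wMatrix (primeUnit p ^ (-n)) * b) κ)) := by
  rw [mul_assoc _ b κ, heckeElement_apply hp2 n ha (mul_mem_iwahori hb hκ),
    doubleLog_mul_right hp2 _ _ hb hκ, expSign_add]
  ring

/-! ### The integral over the double cover -/

theorem measurableSet_coset (g : SL(2, ℚ_[p])) : MeasurableSet {x | g⁻¹ * x ∈ iwahori p} :=
  ((isCompact_iwahori p).isClosed.preimage (continuous_const_mul g⁻¹)).measurableSet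

instance haarSL_isMulLeftInvariant : (haarSL p).IsMulLeftInvariant := by
  unfold haarSL; infer_instance

theorem haarSL_coset (g : SL(2, ℚ_[p])) : haarSL p {x | g⁻¹ * x ∈ iwahori p} = 1 := by
  have h1 := measure_preimage_mul (haarSL p) g⁻¹ (iwahori p)
  have h2 : haarSL p (iwahori p) = 1 := Measure.haarMeasure_self
  rw [h2] at h1
  exact h1

theorem coverIntegral_mul_const (F : LocalCover p → ℂ) (c : ℂ) :
    coverIntegral p F * c = coverIntegral p fun x => F x * c := by
  simp only [coverIntegral, mul_assoc, Finset.sum_mul, integral_mul_const]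

/-- Every left translate of the Iwahori subgroup has measure 1 by invariance. The two sheets
contribute equally, which uses up the factor 1/2. -/
theorem coverIntegral_of_cosets {ι : Type*} [Fintype ι] {F : LocalCover p → ℂ}
    {α : ι → SL(2, ℚ_[p])} {c : ι → ℂ} (hF : ∀ i, ∀ κ ∈ iwahori p, ∀ ε, F ⟨α i * κ, ε⟩ = c i)
    (hF0 : ∀ x ε, (∀ i, (α i)⁻¹ * x ∉ iwahori p) → F ⟨x, ε⟩ = 0)
    (hd : ∀ i j, (α i)⁻¹ * α j ∈ iwahori p → i = j) : coverIntegral p F = ∑ i, c i := by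
  have hsum : ∀ ε, (fun x => F ⟨x, ε⟩) =
      fun x => ∑ i, ({x | (α i)⁻¹ * x ∈ iwahori p}.indicator fun _ => c i) x := by
    intro ε
    funext x
    by_cases hx : ∃ i, (α i)⁻¹ * x ∈ iwahori p
    · obtain ⟨i, hi⟩ := hx
      rw [Finset.sum_eq_single i, Set.indicator_of_mem (by exact hi), ← hF i _ hi ε,
        mul_inv_cancel_left]
      · intro j _ hj
        refine Set.indicator_of_notMem (fun h => hj ?_) _
        refine hd j i ?_
        have := mul_mem_iwahori h (inv_mem_iwahori hi)
        rwa [mul_inv_rev, inv_inv, mul_assoc, mul_inv_cancel_left] at this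
      · exact fun h => absurd (Finset.mem_univ i) h
    · rw [not_exists] at hx
      rw [hF0 x ε hx]
      symm
      exact Finset.sum_eq_zero fun i _ => Set.indicator_of_notMem (s := {x | (α i)⁻¹ * x ∈ iwahori p}) (hx i) _
  have hint : ∀ ε, ∫ x, F ⟨x, ε⟩ ∂(haarSL p) = ∑ i, c i := by
    intro ε
    rw [hsum ε, integral_finsetSum]
    · refine Finset.sum_congr rfl fun i _ => ?_
      rw [integral_indicator_const _ (measurableSet_coset (α i)), measureReal_def, haarSL_coset]
      simp
    · intro i _
      refine (integrable_indicator_iff (measurableSet_coset (α i))).2 ?_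
      exact integrableOn_const (by rw [haarSL_coset]; exact ENNReal.one_ne_top)
  rw [coverIntegral, Fintype.sum_congr _ _ hint]
  simp

theorem pointMatrix_smul (z : ℍ) : pointMatrix z • UpperHalfPlane.I = z := by
  have h : √z.im ≠ 0 := (Real.sqrt_pos.2 z.im_pos).ne'
  have h2 : (((√z.im : ℝ) : ℂ)) ≠ 0 := by exact_mod_cast h
  have h3 : ((√z.im : ℝ) : ℂ) * ((√z.im : ℝ) : ℂ) = (z.im : ℂ) := by
    rw [← Complex.ofReal_mul, Real.mul_self_sqrt z.im_pos.le]
  ext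
  rw [coe_sl_smul, den]
  simp only [pointMatrix, Matrix.of_apply, Matrix.cons_val', Matrix.cons_val_zero,
    Matrix.cons_val_one, Matrix.cons_val_fin_one, Algebra.algebraMap_self, RingHom.id_apply,
    Complex.ofReal_zero, zero_mul, zero_add, UpperHalfPlane.coe_I, Complex.ofReal_div,
    Complex.ofReal_one]
  field_simp
  rw [sq, h3]
  conv_rhs => rw [← Complex.re_add_im (z : ℂ)]
  simp [add_comm]

/-- The genuine sign occurs in T and in the adelic lift and squares to 1, so the integrand is
constant on each coset and vanishes elsewhere. -/
theorem classicalOperator_apply {k n : ℕ} (h4 : 4 ∣ n) (hpn : ¬ (p : ℕ) ∣ n) (hp2 : (p : ℕ) ≠ 2)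
    {f : ℍ → ℂ} (hf : IsInvariant k (p * n) f) {ι : Type*} [Fintype ι] {α : ι → SL(2, ℚ)}
    {c : ι → ℂ} {T : LocalCover p → ℂ} (hα : ∀ i, IsLevelAway p (p * n) (α i))
    (hT : ∀ i, ∀ κ ∈ iwahori p, ∀ ε : ℤˣ, T ⟨atPlace p (α i) * κ, ε⟩ =
      c i * (((ε : ℤ) : ℂ) * expSign (clog (atPlace p (α i)) κ)))
    (hT0 : ∀ x ε, (∀ i, (atPlace p (α i))⁻¹ * x ∉ iwahori p) → T ⟨x, ε⟩ = 0)
    (hd : ∀ i j, (atPlace p (α i))⁻¹ * atPlace p (α j) ∈ iwahori p → i = j) (z : ℍ) :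
    classicalOperator k (p * n) T f z =
      ∑ i, c i * (ratFactor (α i) ((α i)⁻¹ • z) ^ (2 * k + 1) * f ((α i)⁻¹ • z)) := by
  rw [classicalOperator, classicalForm, heckeAction, coverIntegral_mul_const]
  refine coverIntegral_of_cosets (α := fun i => atPlace p (α i)) ?_ ?_ hd
  · intro i κ hκ ε
    rw [mul_assoc, adelicLift_coset h4 hpn hp2 hf _ (hα i) hκ, hT i κ hκ, pointMatrix_smul]
    have h1 := expSign_mul_self (clog (atPlace p (α i)) κ)
    have h2 : ((ε : ℤ) : ℂ) * ((ε : ℤ) : ℂ) = 1 := by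
      rw [signLog_eq_expSign]; exact expSign_mul_self _
    generalize ((ε : ℤ) : ℂ) = e at *
    generalize expSign (clog (atPlace p (α i)) κ) = s at *
    linear_combination (c i * ratFactor (α i) ((α i)⁻¹ • z) ^ (2 * k + 1) * f ((α i)⁻¹ • z)) *
      (s * s * h2 + h1)
  · intro x ε hx
    rw [hT0 x ε hx, zero_mul, zero_mul]

end Hecke

end HalfIntegral

namespace HalfIntegral

/-! ### Classical formulas for the two Hecke operators -/

theorem thetaFactor_one (z : ℍ) : thetaFactor 1 z = 1 := by
  simp [thetaFactor, epsilon, shimuraSymbol, UpperHalfPlane.denom]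

theorem isGamma14_upper (b : ℤ) : IsGamma14 (upperSL b) := ⟨by simp, by simp⟩

theorem isGamma14_lower {c : ℤ} (hc : 4 ∣ c) : IsGamma14 (lowerSL c) := ⟨by simpa using hc, by simp⟩

theorem IsGamma14.thetaFactor_inv {γ : SL(2, ℤ)} (h : IsGamma14 γ) (z : ℍ) :
    thetaFactor γ (γ⁻¹ • z) * thetaFactor γ⁻¹ z = 1 := by
  rw [← h.thetaFactor_mul h.inv, mul_inv_cancel, thetaFactor_one]

theorem slash_apply (k : ℕ) (γ : SL(2, ℤ)) (φ f : ℍ → ℂ) (z : ℍ) :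
    slash k γ φ f z = (φ z ^ (2 * k + 1))⁻¹ * f (γ • z) := by
  rw [slash, zpow_neg, show (2 * k + 1 : ℤ) = ((2 * k + 1 : ℕ) : ℤ) by push_cast; ring,
    zpow_natCast, mul_comm]

/-- The slash operator for the theta multiplier. -/
noncomputable def thetaSlash (k : ℕ) (f : ℍ → ℂ) (γ : SL(2, ℤ)) : ℍ → ℂ :=
  slash k γ (thetaFactor γ) f

theorem IsGamma14.ratFactor_pow_mul {γ : SL(2, ℤ)} (h : IsGamma14 γ) (k : ℕ) (f : ℍ → ℂ) (z : ℍ) :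
    ratFactor (toRat γ) ((toRat γ)⁻¹ • z) ^ (2 * k + 1) * f ((toRat γ)⁻¹ • z) =
      thetaSlash k f γ⁻¹ z := by
  rw [thetaSlash, slash_apply, ← map_inv, toRat_smul, ← h.thetaFactor_eq]
  congr 1
  exact eq_inv_of_mul_eq_one_left (by rw [← mul_pow, h.thetaFactor_inv, one_pow])

theorem IsGamma14.thetaSlash_mul {γ δ : SL(2, ℤ)} (h : IsGamma14 γ) (h' : IsGamma14 δ) (k : ℕ)
    (f : ℍ → ℂ) : thetaSlash k f (γ * δ) = thetaSlash k (thetaSlash k f γ) δ := by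
  funext z
  simp only [thetaSlash, slash_apply]
  rw [h.thetaFactor_mul h', mul_pow, mul_inv, mul_smul]
  ring

theorem toRat_upper (b : ℤ) : toRat (upperSL b) = upperSL (b : ℚ) := by
  apply sl_ext <;> simp

theorem toRat_lower (c : ℤ) : toRat (lowerSL c) = lowerSL (c : ℚ) := by
  apply sl_ext <;> simp

theorem atPlace_upper (q : Nat.Primes) (b : ℚ) : atPlace q (upperSL b) = upperSL (b : ℚ_[q]) := by
  apply sl_ext <;> simp

theorem atPlace_lower (q : Nat.Primes) (b : ℚ) : atPlace q (lowerSL b) = lowerSL (b : ℚ_[q]) := by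
  apply sl_ext <;> simp

theorem upperSL_inv {R : Type*} [CommRing R] (b : R) : (upperSL b)⁻¹ = upperSL (-b) := by
  apply sl_ext <;>
    simp [sl_inv_zero_zero, sl_inv_zero_one, sl_inv_one_zero, sl_inv_one_one]

theorem lowerSL_inv {R : Type*} [CommRing R] (b : R) : (lowerSL b)⁻¹ = lowerSL (-b) := by
  apply sl_ext <;>
    simp [sl_inv_zero_zero, sl_inv_zero_one, sl_inv_one_zero, sl_inv_one_one]

theorem upperSL_mul {R : Type*} [CommRing R] (b c : R) :
    upperSL b * upperSL c = upperSL (b + c) := by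
  apply sl_ext <;>
    simp [sl_mul_zero_zero, sl_mul_zero_one, sl_mul_one_zero, sl_mul_one_one, add_comm]

theorem lowerSL_mul {R : Type*} [CommRing R] (b c : R) :
    lowerSL b * lowerSL c = lowerSL (b + c) := by
  apply sl_ext <;>
    simp [sl_mul_zero_zero, sl_mul_zero_one, sl_mul_one_zero, sl_mul_one_one]

section Formulas

variable {p : Nat.Primes} {n : ℕ}

theorem isLevelAway_upper {b : ℚ} (hb : ∀ q : Nat.Primes, q ≠ p → ‖(b : ℚ_[q])‖ ≤ 1) (N : ℕ) :
    IsLevelAway p N (upperSL b) := fun q hq => by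
  rw [atPlace_upper]; exact inK1_upper (hb q hq)

theorem isLevelAway_lower {c : ℤ} (hc : (n : ℤ) ∣ c) :
    IsLevelAway p (p * n) (lowerSL (c : ℚ)) := fun q hq => by
  rw [atPlace_lower]
  refine inK1_lower ?_
  rw [norm_level_away hq, Rat.cast_intCast]
  simpa using norm_intCast_le_of_dvd q hc

theorem exists_fin_norm_sub_lt (u : ℚ_[p]) (hu : ‖u‖ ≤ 1) :
    ∃ s : Fin p, ‖u - ((s : ℕ) : ℚ_[p])‖ < 1 :=
  ⟨⟨_, PadicInt.zmodRepr_lt_p (toIntegral u hu)⟩,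
    PadicInt.norm_sub_zmodRepr_lt_one (toIntegral u hu)⟩

theorem fin_eq_of_dvd {i j : Fin p} (h : ((p : ℕ) : ℤ) ∣ (j : ℕ) - (i : ℕ)) : i = j := by
  have := (Nat.modEq_iff_dvd (n := p)).2 h
  exact Fin.ext (this.eq_of_lt_of_lt i.2 j.2)

theorem primeUnit_zpow_zero : primeUnit p ^ (-(0 : ℤ)) = 1 := by simp

theorem wMatrix_one_eq : wMatrix (1 : ℚ_[p]ˣ) = weylSL := by
  apply sl_ext <;> simp

theorem gammaW_one : gammaW (1 : ℚ_[p]ˣ) = 1 := by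
  rw [gammaW, if_pos]
  simp

/-- The element p⁻¹ has odd valuation and unit part 1, so the value before conjugation is ε_p
(-1/p). Conjugating ε_p multiplies it by (-1/p), and the Legendre symbols cancel. -/
theorem conj_gammaW_prime (hp2 : (p : ℕ) ≠ 2) :
    conj (gammaW (primeUnit p ^ (-(1 : ℤ)))) = epsilon (p : ℕ) := by
  have hv : ((primeUnit p ^ (-(1 : ℤ)) : ℚ_[p]ˣ) : ℚ_[p]) = ((p : ℕ) : ℚ_[p])⁻¹ := by
    simp [primeUnit]
  have hval : (((p : ℕ) : ℚ_[p])⁻¹).valuation = -1 := by simp [Padic.valuation_inv]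
  have hu : unitPart (((p : ℕ) : ℚ_[p])⁻¹) = 1 := by
    have h0 : ((p : ℕ) : ℚ_[p]) ≠ 0 := by exact_mod_cast p.2.ne_zero
    have h1 : ((p : ℕ) : ℚ_[p])⁻¹ * ((p : ℕ) : ℚ_[p]) ^ (-(((p : ℕ) : ℚ_[p])⁻¹).valuation) = 1 := by
      rw [hval, neg_neg, zpow_one, inv_mul_cancel₀ h0]
    exact (dif_pos (by rw [h1, norm_one])).trans (Subtype.ext h1)
  rw [gammaW, hv, hval, hu, if_neg (by decide)]
  have h := unitResidue_intCast (q := p) (n := -1) (not_prime_dvd_neg_one p)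
  rw [Int.cast_neg, Int.cast_one] at h
  rw [h, legendreSym.at_neg_one hp2, map_mul, map_intCast]
  have hodd : (p : ℕ) % 2 = 1 := p.2.eq_two_or_odd.resolve_left hp2
  rw [epsilon]
  rcases Nat.odd_mod_four_iff.1 hodd with h1 | h1
  · rw [ZMod.χ₄_nat_one_mod_four h1, if_pos (by omega)]; simp
  · rw [ZMod.χ₄_nat_three_mod_four h1, if_neg (by omega)]; simp

theorem heckeElement_zero_mul (hp2 : (p : ℕ) ≠ 2) {g κ : SL(2, ℚ_[p])} (hg : g ∈ integralSL p)
    (hc : ‖g 1 0‖ = 1) (hκ : κ ∈ iwahori p) (ε : ℤˣ) :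
    heckeElement p 0 ⟨g * κ, ε⟩ = 1 * (((ε : ℤ) : ℂ) * expSign (clog g κ)) := by
  have hi := mem_integralSL.1 hg
  have hc0 : g 1 0 ≠ 0 := fun h => by rw [h] at hc; simp at hc
  have hci : ‖(g 1 0)⁻¹‖ = 1 := by rw [norm_inv, hc, inv_one]
  have hd := sl_det g
  -- The Bruhat decomposition g = x(a/c) w b, integral because c is a unit. All factors lie in
  -- SL₂(ℤ_p), so no sign arises.
  let a : SL(2, ℚ_[p]) := upperSL (g 0 0 * (g 1 0)⁻¹)
  let b : SL(2, ℚ_[p]) := ⟨!![-g 1 0, -g 1 1; 0, -(g 1 0)⁻¹], by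
    rw [Matrix.det_fin_two_of]; field_simp; ring⟩
  have ha : a ∈ iwahori p := ⟨upper_mem_integralSL (norm_mul_le_left (hi 0 0) hci.le), by simp [a]⟩
  have hb : b ∈ iwahori p := by
    refine ⟨mem_integralSL.2 fun i j => ?_, by simp [b]⟩
    fin_cases i <;> fin_cases j <;> simp [b, hc, hi]
  have he : g = a * wMatrix (primeUnit p ^ (-(0 : ℤ))) * b := by
    have b00 : b 0 0 = -g 1 0 := rfl
    have b01 : b 0 1 = -g 1 1 := rfl
    have b10 : b 1 0 = 0 := rfl
    have b11 : b 1 1 = -(g 1 0)⁻¹ := rfl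
    rw [primeUnit_zpow_zero, wMatrix_one_eq]
    apply sl_ext <;>
      simp only [sl_mul_zero_zero, sl_mul_zero_one, sl_mul_one_zero, sl_mul_one_one, a, b00, b01,
        b10, b11, upperSL_zero_zero, upperSL_zero_one, upperSL_one_zero, upperSL_one_one,
        weylSL_zero_zero, weylSL_zero_one, weylSL_one_zero, weylSL_one_one] <;> field_simp <;>
      first | ring1 | linear_combination (-g 1 0) * hd
  have hdl : doubleLog (wMatrix (primeUnit p ^ (-(0 : ℤ)))) a b = 0 := by
    rw [doubleLog, primeUnit_zpow_zero, wMatrix_one_eq,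
      clog_eq_zero_of_odd hp2 ha.1 _ weyl_mem_integralSL,
      clog_eq_zero_of_odd hp2 (mul_mem ha.1 weyl_mem_integralSL) _ hb.1, add_zero]
  have h1 : conj (gammaW (primeUnit p ^ (-(0 : ℤ)))) = 1 := by
    rw [primeUnit_zpow_zero, gammaW_one, map_one]
  conv_lhs => rw [he]
  rw [heckeElement_mul hp2 0 ha hb hκ, hdl, h1, expSign_zero, ← he, one_mul]

theorem heckeElement_zero_eq_zero (hp2 : (p : ℕ) ≠ 2) {x : SL(2, ℚ_[p])} {ε : ℤˣ}
    (h : ¬ (x ∈ integralSL p ∧ ‖x 1 0‖ = 1)) : heckeElement p 0 ⟨x, ε⟩ = 0 := by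
  refine heckeElement_eq_zero fun a ha b hb hx => h ?_
  rw [primeUnit_zpow_zero, wMatrix_one_eq] at hx
  subst hx
  refine ⟨mul_mem (mul_mem ha.1 weyl_mem_integralSL) hb.1, ?_⟩
  have hga := iwahori_isGood hp2 ha
  have hgb := iwahori_isGood hp2 hb
  have e : (a * (weylSL : SL(2, ℚ_[p])) * b) 1 0 = -(a 1 1 * b 0 0) + a 1 0 * b 1 0 := by
    rw [sl_mul_one_zero, sl_mul_one_zero, sl_mul_one_one]; simp
  have h1 : ‖-(a 1 1 * b 0 0)‖ = 1 := by
    rw [norm_neg, norm_mul, hga.one_one.1, hgb.zero_zero.1, one_mul]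
  have h2 := (hga.one_zero.mul_right hgb.one_zero.1.le).1
  rw [e, Padic.add_eq_max_of_ne (by rw [h1]; exact h2.ne'), h1, max_eq_left h2.le]

/-- The double coset of w consists of the integral matrices with c a unit, and its right
K₀(p)-cosets are separated by a/c mod p. The representatives x(s) y(n) have a/c = s + 1/n. They are
integral matrices over ℚ, and since n divides their lower unipotent parameter they lie in K₁(pn)
away from p. -/
theorem Qtilde_formula {k : ℕ} (h4 : 4 ∣ n) (hpn : ¬ (p : ℕ) ∣ n) (hp2 : (p : ℕ) ≠ 2)
    {f : ℍ → ℂ} (hf : IsInvariant k (p * n) f) :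
    classicalOperator k (p * n) (heckeElement p 0) f =
      ∑ s : Fin p, thetaSlash k f (upperSL ((s : ℕ) : ℤ) * lowerSL (n : ℤ))⁻¹ := by
  funext z
  have hn1 : ‖(n : ℚ_[p])‖ = 1 := by
    have := norm_intCast_eq_one (q := p) (n := n) (by exact_mod_cast hpn)
    simpa using this
  have hn0 : (n : ℚ_[p]) ≠ 0 := fun h => by rw [h] at hn1; simp at hn1
  have hg : ∀ s : Fin p, IsGamma14 (upperSL ((s : ℕ) : ℤ) * lowerSL (n : ℤ)) := fun s =>
    (isGamma14_upper _).mul (isGamma14_lower (by exact_mod_cast h4))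
  have hat : ∀ s : Fin p, atPlace p (toRat (upperSL ((s : ℕ) : ℤ) * lowerSL (n : ℤ))) =
      upperSL ((s : ℕ) : ℚ_[p]) * lowerSL (n : ℚ_[p]) := fun s => by
    rw [map_mul, map_mul, toRat_upper, toRat_lower, atPlace_upper, atPlace_lower]
    simp
  have hint : ∀ s : Fin p, ‖((s : ℕ) : ℚ_[p])‖ ≤ 1 := fun s => by
    simpa using norm_intCast_le_one p (s : ℕ)
  have hlow : lowerSL (n : ℚ_[p]) ∈ integralSL p :=
    mem_integralSL.2 fun i j => by fin_cases i <;> fin_cases j <;> simp [lowerSL, hn1]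
  have he : ∀ (s : Fin p) (x : SL(2, ℚ_[p])),
      ((upperSL ((s : ℕ) : ℚ_[p]) * lowerSL (n : ℚ_[p]))⁻¹ * x) 1 0 =
        x 1 0 - n * (x 0 0 - (s : ℕ) * x 1 0) := fun s x => by
    rw [sl_mul_one_zero, sl_inv_one_zero, sl_inv_one_one, sl_mul_one_zero, sl_mul_zero_zero]
    simp; ring
  have hmem : ∀ s : Fin p, upperSL ((s : ℕ) : ℚ_[p]) * lowerSL (n : ℚ_[p]) ∈ integralSL p :=
    fun s => mul_mem (upper_mem_integralSL (hint s)) hlow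
  rw [classicalOperator_apply h4 hpn hp2 hf
    (α := fun s : Fin p => toRat (upperSL ((s : ℕ) : ℤ) * lowerSL (n : ℤ))) (c := fun _ => 1)]
  · rw [Finset.sum_apply]
    exact Finset.sum_congr rfl fun s _ => by rw [one_mul, (hg s).ratFactor_pow_mul]
  · intro s
    rw [map_mul, toRat_upper, toRat_lower]
    refine (isLevelAway_upper (fun q _ => ?_) _).mul (isLevelAway_lower dvd_rfl)
    rw [Rat.cast_intCast]; exact norm_intCast_le_one q _
  · intro s κ hκ ε
    refine heckeElement_zero_mul hp2 ?_ ?_ hκ ε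
    · rw [hat]; exact hmem s
    · rw [hat, sl_mul_one_zero]; simpa using hn1
  · intro x ε hx
    refine heckeElement_zero_eq_zero hp2 ?_
    rintro ⟨h1, h2⟩
    have hc0 : x 1 0 ≠ 0 := fun h => by rw [h] at h2; simp at h2
    have hi := mem_integralSL.1 h1
    -- Solves s + 1/n ≡ a/c mod p.
    obtain ⟨s, hs⟩ := exists_fin_norm_sub_lt ((x 0 0 - x 1 0 * (n : ℚ_[p])⁻¹) * (x 1 0)⁻¹) (by
      refine norm_mul_le_left ?_ (by rw [norm_inv, h2, inv_one])
      rw [sub_eq_add_neg]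
      refine norm_le_of_add (hi 0 0) ?_
      rw [norm_neg]
      exact norm_mul_le_left (hi 1 0) (by rw [norm_inv, hn1, inv_one]))
    refine hx s ?_
    rw [hat]
    refine ⟨mul_mem (inv_mem (hmem s)) h1, ?_⟩
    rw [he, norm_le_prime_iff, show x 1 0 - n * (x 0 0 - (s : ℕ) * x 1 0) =
      -(n * x 1 0) * ((x 0 0 - x 1 0 * (n : ℚ_[p])⁻¹) * (x 1 0)⁻¹ - (s : ℕ)) by field_simp; ring,
      norm_mul, norm_neg, norm_mul, hn1, h2, one_mul, one_mul]
    exact hs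
  · intro i j hij
    rw [hat, hat] at hij
    have h1 := norm_le_prime_iff.1 hij.2
    rw [he, sl_mul_one_zero, sl_mul_zero_zero] at h1
    refine fin_eq_of_dvd ?_
    have h2 : ‖((((j : ℕ) : ℤ) - ((i : ℕ) : ℤ) : ℤ) : ℚ_[p])‖ < 1 := by
      have e : (((((j : ℕ) : ℤ) - ((i : ℕ) : ℤ) : ℤ) : ℚ_[p])) * (-(n * n)) =
          upperSL ((j : ℕ) : ℚ_[p]) 1 0 * lowerSL (n : ℚ_[p]) 0 0 +
            upperSL ((j : ℕ) : ℚ_[p]) 1 1 * lowerSL (n : ℚ_[p]) 1 0 -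
          n * (upperSL ((j : ℕ) : ℚ_[p]) 0 0 * lowerSL (n : ℚ_[p]) 0 0 +
            upperSL ((j : ℕ) : ℚ_[p]) 0 1 * lowerSL (n : ℚ_[p]) 1 0 -
            (i : ℕ) * (upperSL ((j : ℕ) : ℚ_[p]) 1 0 * lowerSL (n : ℚ_[p]) 0 0 +
              upperSL ((j : ℕ) : ℚ_[p]) 1 1 * lowerSL (n : ℚ_[p]) 1 0)) := by
        simp; ring
      rw [← e, norm_mul, norm_neg, norm_mul, hn1, one_mul, mul_one] at h1
      exact h1
    exact Padic.norm_intCast_lt_one_iff.1 h2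

end Formulas

end HalfIntegral

namespace HalfIntegral

/-! ### The double coset of w(p⁻¹). -/

section Formulas

variable {p : Nat.Primes} {n : ℕ}

theorem prime_ne_zero (p : Nat.Primes) : ((p : ℕ) : ℚ_[p]) ≠ 0 := by exact_mod_cast p.2.ne_zero

/-- The matrix `w(p⁻¹)`. -/
noncomputable def wPrime (p : Nat.Primes) : SL(2, ℚ_[p]) := wMatrix (primeUnit p ^ (-(1 : ℤ)))

theorem wPrime_zero_zero : wPrime p 0 0 = 0 := rfl
theorem wPrime_zero_one : wPrime p 0 1 = ((p : ℕ) : ℚ_[p])⁻¹ := by simp [wPrime, primeUnit]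
theorem wPrime_one_zero : wPrime p 1 0 = -((p : ℕ) : ℚ_[p]) := by simp [wPrime, primeUnit]
theorem wPrime_one_one : wPrime p 1 1 = 0 := rfl

theorem lower_mem_iwahori {u : ℚ_[p]} (hu : ‖u‖ ≤ ‖((p : ℕ) : ℚ_[p])‖) :
    lowerSL u ∈ iwahori p := by
  refine ⟨mem_integralSL.2 fun i j => ?_, by simpa using hu⟩
  have h1 : ‖u‖ ≤ 1 := hu.trans (by simpa using norm_intCast_le_one p (p : ℕ))
  fin_cases i <;> fin_cases j <;> simp [h1]

/-- This puts x(1/p) into the double coset of w(p⁻¹). As a rational matrix it lies in K₁ away from p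
and has automorphy factor 1, which makes it a convenient representative. -/
theorem lower_wPrime_lower : lowerSL ((p : ℕ) : ℚ_[p]) * wPrime p * lowerSL ((p : ℕ) : ℚ_[p]) =
    upperSL ((p : ℕ) : ℚ_[p])⁻¹ := by
  have h := prime_ne_zero p
  apply sl_ext <;> simp only [sl_mul_zero_zero, sl_mul_zero_one, sl_mul_one_zero, sl_mul_one_one,
    wPrime_zero_zero, wPrime_zero_one, wPrime_one_zero, wPrime_one_one] <;> simp [h]

/-- All matrices involved, apart from w itself, have lower right entry 1, so their s_p is trivial.
The remaining symbol is (p, -p) = 1. -/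
theorem doubleLog_wPrime (hp2 : (p : ℕ) ≠ 2) :
    doubleLog (wPrime p) (lowerSL ((p : ℕ) : ℚ_[p])) (lowerSL ((p : ℕ) : ℚ_[p])) = 0 := by
  have hH := isSymbol_hlog p
  have h := prime_ne_zero p
  have hs : ∀ g : SL(2, ℚ_[p]), g 1 1 = 1 → slog g = 0 := fun g hg => by
    by_cases hc : g 1 0 = 0
    · exact slog_of_zero (Or.inl hc)
    · rcases Int.even_or_odd (g 1 0).valuation with hv | hv
      · exact slog_of_even hv
      · rw [slog_of_odd hv (by rw [hg]; exact one_ne_zero), hg, hH.one_right hc]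
  have hgood := iwahori_isGood hp2 (lower_mem_iwahori (p := p) le_rfl)
  have e0 : (lowerSL ((p : ℕ) : ℚ_[p]) * wPrime p) 1 0 = -((p : ℕ) : ℚ_[p]) := by
    rw [sl_mul_one_zero, wPrime_zero_zero, wPrime_one_zero]; simp
  have e1 : (lowerSL ((p : ℕ) : ℚ_[p]) * wPrime p) 1 1 = 1 := by
    rw [sl_mul_one_one, wPrime_zero_one, wPrime_one_one]; simp [h]
  have h1 : clog (lowerSL ((p : ℕ) : ℚ_[p])) (wPrime p) = 0 := by
    rw [wPrime, clog_wMatrix_right _ hgood, ← wPrime, hs _ e1, lowerSL_one_one,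
      hH.one_right (Units.ne_zero _), add_zero]
  rw [doubleLog, h1, clog_eq, kubota, lower_wPrime_lower, hs _ e1, hs _ (lowerSL_one_one _),
    hs _ (upperSL_one_one _), tau_of_eq (upperSL_one_zero _), upperSL_one_one,
    tau_of_ne (by rw [e0]; exact neg_ne_zero.2 h), e0, tau_of_ne (by simpa using h),
    lowerSL_one_zero, one_mul, one_mul, hH.comm, hH.neg_self h]
  simp

theorem heckeElement_one_mul (hp2 : (p : ℕ) ≠ 2) {u : ℚ_[p]} (hu : ‖u‖ ≤ ‖((p : ℕ) : ℚ_[p])‖)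
    {κ : SL(2, ℚ_[p])} (hκ : κ ∈ iwahori p) (ε : ℤˣ) :
    heckeElement p 1 ⟨lowerSL u * upperSL ((p : ℕ) : ℚ_[p])⁻¹ * κ, ε⟩ =
      expSign (clog (lowerSL u) (upperSL ((p : ℕ) : ℚ_[p])⁻¹)) * epsilon (p : ℕ) *
        (((ε : ℤ) : ℂ) * expSign (clog (lowerSL u * upperSL ((p : ℕ) : ℚ_[p])⁻¹) κ)) := by
  have hp := lower_mem_iwahori (p := p) le_rfl
  have hul := lower_mem_iwahori hu
  have he : lowerSL u * upperSL ((p : ℕ) : ℚ_[p])⁻¹ =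
      lowerSL u * lowerSL ((p : ℕ) : ℚ_[p]) * wPrime p * lowerSL ((p : ℕ) : ℚ_[p]) := by
    rw [← lower_wPrime_lower]; simp only [mul_assoc]
  have h := heckeElement_mul hp2 1 (mul_mem_iwahori hul hp) hp hκ ε
  rw [← wPrime, ← he, doubleLog_mul_left hp2 _ _ hul hp, doubleLog_wPrime hp2, zero_add,
    lower_wPrime_lower, conj_gammaW_prime hp2] at h
  exact h

theorem isLevelAway_upper_inv_prime (N : ℕ) :
    IsLevelAway p N (upperSL ((p : ℕ) : ℚ)⁻¹) := isLevelAway_upper (fun q hq => by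
  have := norm_intCast_eq_one (q := q) (n := (p : ℕ)) (not_prime_dvd hq)
  rw [Int.cast_natCast] at this
  rw [Rat.cast_inv, Rat.cast_natCast, norm_inv, this, inv_one]) N

theorem ratFactor_upper (b : ℚ) (z : ℍ) : ratFactor (upperSL b) z = 1 := by
  have h1 : tlog (upperSL b) = 0 := by
    rw [tlog, finsum_congr fun q => slog_of_zero (Or.inl (by simp)), finsum_zero]
  rw [ratFactor, h1, den, lowerRoot]
  simp

/-- The cosets are represented by y(pns) x(1/p) for s mod p. The sign σ_p(y(pns), x(1/p)) occurs in
the Hecke function and in the factor of the product, and cancels. -/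
theorem Wtilde_formula {k : ℕ} (h4 : 4 ∣ n) (hpn : ¬ (p : ℕ) ∣ n) (hp2 : (p : ℕ) ≠ 2)
    {f : ℍ → ℂ} (hf : IsInvariant k (p * n) f) :
    classicalOperator k (p * n)
        (fun x => ((Real.sqrt (p : ℕ) : ℝ) : ℂ)⁻¹ * heckeElement p 1 x) f =
      (((Real.sqrt (p : ℕ) : ℝ) : ℂ)⁻¹ * epsilon (p : ℕ)) • ∑ s : Fin p,
        thetaSlash k (fun z => f ((upperSL ((p : ℕ) : ℚ)⁻¹)⁻¹ • z))
          (lowerSL (((p * n : ℕ) : ℤ) * ((s : ℕ) : ℤ)))⁻¹ := by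
  funext z
  have h4' : 4 ∣ p * n := h4.mul_left _
  have hp0 := prime_ne_zero p
  have hn1 : ‖(n : ℚ_[p])‖ = 1 := by
    have := norm_intCast_eq_one (q := p) (n := n) (by exact_mod_cast hpn)
    simpa using this
  have hn0 : (n : ℚ_[p]) ≠ 0 := fun h => by rw [h] at hn1; simp at hn1
  set β : Fin p → SL(2, ℤ) := fun s => lowerSL (((p * n : ℕ) : ℤ) * ((s : ℕ) : ℤ)) with hβ
  have hg : ∀ s, IsGamma14 (β s) := fun s =>
    isGamma14_lower (Dvd.dvd.mul_right (by exact_mod_cast h4') _)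
  have hβl : ∀ s, IsLevelAway p (p * n) (toRat (β s)) := fun s => by
    rw [hβ, toRat_lower]
    exact isLevelAway_lower (Dvd.dvd.mul_right (by push_cast; exact dvd_mul_left _ _) _)
  have hatβ : ∀ s, atPlace p (toRat (β s)) = lowerSL ((p : ℕ) * n * ((s : ℕ) : ℚ_[p])) := fun s => by
    rw [hβ, toRat_lower, atPlace_lower]; simp
  have hatu : atPlace p (upperSL ((p : ℕ) : ℚ)⁻¹) = upperSL ((p : ℕ) : ℚ_[p])⁻¹ := by
    rw [atPlace_upper]; simp
  have hat : ∀ s : Fin p, atPlace p (toRat (β s) * upperSL ((p : ℕ) : ℚ)⁻¹) =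
      lowerSL ((p : ℕ) * n * ((s : ℕ) : ℚ_[p])) * upperSL ((p : ℕ) : ℚ_[p])⁻¹ := fun s => by
    rw [map_mul, hatβ, hatu]
  have hint : ∀ s : Fin p, ‖((s : ℕ) : ℚ_[p])‖ ≤ 1 := fun s => by
    simpa using norm_intCast_le_one p (s : ℕ)
  have hnorm : ∀ s : Fin p, ‖(p : ℕ) * n * ((s : ℕ) : ℚ_[p])‖ ≤ ‖((p : ℕ) : ℚ_[p])‖ := fun s =>
    norm_mul_le_left (norm_mul_le_left le_rfl hn1.le) (hint s)
  rw [classicalOperator_apply h4 hpn hp2 hf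
    (α := fun s : Fin p => toRat (β s) * upperSL ((p : ℕ) : ℚ)⁻¹)
    (c := fun s => ((Real.sqrt (p : ℕ) : ℝ) : ℂ)⁻¹ * (expSign (clog (atPlace p (toRat (β s)))
      (atPlace p (upperSL ((p : ℕ) : ℚ)⁻¹))) * epsilon (p : ℕ)))]
  · rw [Pi.smul_apply, Finset.sum_apply, smul_eq_mul, Finset.mul_sum]
    refine Finset.sum_congr rfl fun s _ => ?_
    have e1 : (upperSL ((p : ℕ) : ℚ)⁻¹ : SL(2, ℚ)) •
        ((toRat (β s) * upperSL ((p : ℕ) : ℚ)⁻¹)⁻¹ • z) = (toRat (β s))⁻¹ • z := by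
      rw [mul_inv_rev, mul_smul, smul_inv_smul]
    have e2 : (toRat (β s) * upperSL ((p : ℕ) : ℚ)⁻¹)⁻¹ • z =
        (upperSL ((p : ℕ) : ℚ)⁻¹)⁻¹ • ((toRat (β s))⁻¹ • z) := by rw [mul_inv_rev, mul_smul]
    rw [ratFactor_mul ((hβl s).isGoodAway h4') ((isLevelAway_upper_inv_prime _).isGoodAway h4'),
      e1, ratFactor_upper, mul_one, mul_pow, expSign_pow_odd, e2,
      ← (hg s).ratFactor_pow_mul k (fun z => f ((upperSL ((p : ℕ) : ℚ)⁻¹)⁻¹ • z))]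
    have h1 := expSign_mul_self (clog (atPlace p (toRat (β s))) (atPlace p (upperSL ((p : ℕ) : ℚ)⁻¹)))
    generalize expSign (clog (atPlace p (toRat (β s))) (atPlace p (upperSL ((p : ℕ) : ℚ)⁻¹))) = e at *
    linear_combination (((Real.sqrt (p : ℕ) : ℝ) : ℂ)⁻¹ * epsilon (p : ℕ) *
      ratFactor (toRat (β s)) ((toRat (β s))⁻¹ • z) ^ (2 * k + 1) *
        f ((upperSL ((p : ℕ) : ℚ)⁻¹)⁻¹ • ((toRat (β s))⁻¹ • z))) * h1
  · intro s
    exact (hβl s).mul (isLevelAway_upper_inv_prime _)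
  · intro s κ hκ ε
    rw [hat, hatβ, hatu, heckeElement_one_mul hp2 (hnorm s) hκ]
    ring
  · intro x ε hx
    refine mul_eq_zero_of_right _ (heckeElement_eq_zero fun a ha b hb hxe => ?_)
    rw [← wPrime] at hxe
    have hga := iwahori_isGood hp2 ha
    have ha0 := hga.zero_zero.ne_zero
    have hai := mem_integralSL.1 ha.1
    have hdet := sl_det a
    obtain ⟨c, hc⟩ : ∃ c, a 1 0 = (p : ℕ) * c := ⟨a 1 0 / (p : ℕ), by field_simp⟩
    have hc1 : ‖c‖ ≤ 1 := by
      have := ha.2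
      rw [hc, norm_mul] at this
      exact le_of_mul_le_mul_left (by simpa using this) (norm_pos_iff.2 hp0)
    -- Only the upper right entry of the quotient below could fail to be integral. It is 1/p times a
    -- unit multiple of (c - a₀₀)/(n a₀₀) - s, which determines s mod p.
    obtain ⟨s, hs⟩ := exists_fin_norm_sub_lt ((c - a 0 0) * (n * a 0 0)⁻¹) (by
      refine norm_mul_le_left ?_ (by rw [norm_inv, norm_mul, hn1, hga.zero_zero.1]; simp)
      rw [sub_eq_add_neg]
      refine norm_le_of_add hc1 ?_
      rw [norm_neg]
      exact hga.zero_zero.1.le)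
    refine hx s ?_
    rw [hat, hxe, ← mul_assoc]
    refine mul_mem_iwahori ?_ hb
    set α := lowerSL ((p : ℕ) * n * ((s : ℕ) : ℚ_[p])) * upperSL ((p : ℕ) : ℚ_[p])⁻¹
    have hentry : (α⁻¹ * (a * wPrime p)) 0 0 =
          -a 0 1 * (p : ℕ) + (a 1 1 - (p : ℕ) * (n * (s : ℕ) * a 0 1)) ∧
        (α⁻¹ * (a * wPrime p)) 0 1 = -(n * a 0 0 * ((p : ℕ) : ℚ_[p])⁻¹) *
          ((c - a 0 0) * (n * a 0 0)⁻¹ - (s : ℕ)) ∧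
        (α⁻¹ * (a * wPrime p)) 1 0 = (p : ℕ) * ((p : ℕ) * (n * (s : ℕ) * a 0 1) - a 1 1) ∧
        (α⁻¹ * (a * wPrime p)) 1 1 = c - n * (s : ℕ) * a 0 0 := by
      refine ⟨?_, ?_, ?_, ?_⟩ <;>
      · simp only [α, sl_mul_zero_zero, sl_mul_zero_one, sl_mul_one_zero, sl_mul_one_one,
          sl_inv_zero_zero, sl_inv_zero_one, sl_inv_one_zero, sl_inv_one_one, lowerSL_zero_zero,
          lowerSL_zero_one, lowerSL_one_zero, lowerSL_one_one, upperSL_zero_zero, upperSL_zero_one,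
          upperSL_one_zero, upperSL_one_one, wPrime_zero_zero, wPrime_zero_one, wPrime_one_zero,
          wPrime_one_one, hc]
        field_simp
        ring
    obtain ⟨e00, e01, e10, e11⟩ := hentry
    have hns : ‖n * ((s : ℕ) : ℚ_[p])‖ ≤ 1 := norm_mul_le_left hn1.le (hint s)
    have hp1 : ‖((p : ℕ) : ℚ_[p])‖ ≤ 1 := by simpa using norm_intCast_le_one p (p : ℕ)
    have h1 : ‖(p : ℕ) * (n * (s : ℕ) * a 0 1)‖ ≤ 1 :=
      norm_mul_le_left hp1 (norm_mul_le_left hns (hai 0 1))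
    have hlow : ‖(α⁻¹ * (a * wPrime p)) 1 0‖ ≤ ‖((p : ℕ) : ℚ_[p])‖ := by
      rw [e10, sub_eq_add_neg]
      exact norm_mul_le_left le_rfl (norm_le_of_add h1 (by rw [norm_neg]; exact hai 1 1))
    refine ⟨mem_integralSL.2 fun i j => ?_, hlow⟩
    fin_cases i <;> fin_cases j
    · refine e00 ▸ norm_le_of_add ?_ ?_
      · rw [neg_mul, norm_neg]; exact norm_mul_le_left (hai 0 1) hp1
      · rw [sub_eq_add_neg]
        exact norm_le_of_add (hai 1 1) (by rw [norm_neg]; exact h1)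
    · refine e01 ▸ ?_
      rw [norm_mul, norm_neg, norm_mul, norm_mul, hn1, hga.zero_zero.1, one_mul, one_mul, norm_inv,
        inv_mul_le_one₀ (norm_pos_iff.2 hp0), norm_le_prime_iff]
      exact hs
    · exact hlow.trans hp1
    · refine e11 ▸ ?_
      rw [sub_eq_add_neg]
      exact norm_le_of_add hc1 (by rw [norm_neg]; exact norm_mul_le_left hns (hai 0 0))
  · intro i j hij
    rw [hat, hat] at hij
    have h1 := mem_integralSL.1 hij.1 0 1
    refine fin_eq_of_dvd (Padic.norm_intCast_lt_one_iff.1 ?_)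
    have e : ((lowerSL ((p : ℕ) * n * ((i : ℕ) : ℚ_[p])) * upperSL ((p : ℕ) : ℚ_[p])⁻¹)⁻¹ *
        (lowerSL ((p : ℕ) * n * ((j : ℕ) : ℚ_[p])) * upperSL ((p : ℕ) : ℚ_[p])⁻¹)) 0 1 =
        -n * ((((j : ℕ) : ℤ) - ((i : ℕ) : ℤ) : ℤ) : ℚ_[p]) * ((p : ℕ) : ℚ_[p])⁻¹ := by
      set_option linter.unusedSimpArgs false in
      simp only [sl_mul_zero_one, sl_mul_one_one, sl_inv_zero_zero, sl_inv_zero_one,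
        lowerSL_zero_zero, lowerSL_zero_one, lowerSL_one_zero, lowerSL_one_one, upperSL_zero_one,
        upperSL_one_one, sl_mul_zero_zero, sl_mul_one_zero, upperSL_zero_zero, upperSL_one_zero]
      push_cast
      field_simp
      ring
    rw [e, norm_mul, norm_mul, norm_neg, hn1, one_mul, norm_inv, ← div_eq_mul_inv,
      div_le_one (norm_pos_iff.2 hp0), norm_le_prime_iff] at h1
    exact h1

end Formulas

end HalfIntegral

namespace HalfIntegral

/-! ### The factor of automorphy of `-γ` -/

theorem cpow_half_neg_of_im_pos {w : ℂ} (hw : 0 < w.im) :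
    (-w) ^ (1 / 2 : ℂ) = -Complex.I * w ^ (1 / 2 : ℂ) := by
  have h0 : w ≠ 0 := by rintro rfl; simp at hw
  rw [Complex.cpow_def_of_ne_zero (neg_ne_zero.2 h0), Complex.cpow_def_of_ne_zero h0,
    Complex.log, Complex.log, norm_neg, Complex.arg_neg_eq_arg_sub_pi_of_im_pos hw, ← Complex.exp_neg_pi_div_two_mul_I, ← Complex.exp_add]
  congr 1
  push_cast
  ring

theorem cpow_half_neg_of_im_neg {w : ℂ} (hw : w.im < 0) :
    (-w) ^ (1 / 2 : ℂ) = Complex.I * w ^ (1 / 2 : ℂ) := by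
  have h := cpow_half_neg_of_im_pos (w := -w) (by simpa using hw)
  rw [neg_neg] at h
  rw [h, ← mul_assoc, mul_neg, Complex.I_mul_I]
  ring

theorem jacobiSym_neg_of_one_mod_four (c : ℤ) {m : ℕ} (hm : m % 4 = 1) :
    jacobiSym (-c) m = jacobiSym c m := by
  rw [jacobiSym.neg _ (Nat.odd_iff.2 (by omega)), ZMod.χ₄_nat_one_mod_four hm, one_mul]

theorem jacobiSym_neg_of_three_mod_four (c : ℤ) {m : ℕ} (hm : m % 4 = 3) :
    jacobiSym (-c) m = -jacobiSym c m := by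
  rw [jacobiSym.neg _ (Nat.odd_iff.2 (by omega)), ZMod.χ₄_nat_three_mod_four hm, neg_one_mul]

theorem den_neg (γ : SL(2, ℤ)) (z : ℍ) : den (-γ) z = -den γ z := by
  simp [den]; ring

/-- The factor ±i from the root of -(cz + d) is matched by ε_{-d} = i, by the symbol (-1/|d|) and by
the sign in Shimura's symbol. Invariance under Γ₀ therefore need only be tested on matrices with d ≡
1 mod 4. -/
theorem IsGamma14.thetaFactor_neg {γ : SL(2, ℤ)} (h : IsGamma14 γ) (z : ℍ) :
    thetaFactor (-γ) z = thetaFactor γ z := by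
  have h1 := h.one_one
  have n10 : (-γ) 1 0 = -γ 1 0 := by simp
  have n11 : (-γ) 1 1 = -γ 1 1 := by simp
  have him : (den γ z).im = γ 1 0 * z.im := by simp [den]
  rw [thetaFactor, thetaFactor, denom_int, denom_int, den_neg, n10, n11, epsilon,
    if_neg (by omega), epsilon, if_pos h1, shimuraSymbol, shimuraSymbol, Int.natAbs_neg]
  rcases lt_trichotomy (γ 1 0) 0 with hc | hc | hc
  · rw [cpow_half_neg_of_im_neg (by
      rw [him]; exact mul_neg_of_neg_of_pos (by exact_mod_cast hc) z.im_pos)]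
    rw [if_neg (by omega)]
    rcases lt_or_ge (γ 1 1) 0 with hd | hd
    · rw [jacobiSym_neg_of_three_mod_four _ (by omega), if_pos ⟨hc, hd⟩]
      push_cast
      field_simp
    · rw [jacobiSym_neg_of_one_mod_four _ (by omega), if_neg (by omega)]
      push_cast
      field_simp
  · rw [den, hc, h.lower_one hc]
    simp
    have hI : (-1 : ℂ) ^ (2⁻¹ : ℂ) = Complex.I := by
      rw [Complex.cpow_def_of_ne_zero (by simp), Complex.log_neg_one,
        show Real.pi * Complex.I * (2⁻¹ : ℂ) = Real.pi / 2 * Complex.I by ring,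
        Complex.exp_pi_div_two_mul_I]
    rw [hI]
    simp
  · rw [cpow_half_neg_of_im_pos (by
      rw [him]; exact mul_pos (by exact_mod_cast hc) z.im_pos)]
    rw [if_neg (show ¬ (γ 1 0 < 0 ∧ γ 1 1 < 0) by omega)]
    rcases lt_or_ge (γ 1 1) 0 with hd | hd
    · rw [jacobiSym_neg_of_three_mod_four _ (by omega), if_neg (by omega)]
      push_cast
      field_simp
    · rw [jacobiSym_neg_of_one_mod_four _ (by omega), if_pos (by omega)]
      push_cast
      field_simp

theorem isGamma14_or_neg {n : ℕ} (h4 : 4 ∣ n) {γ : SL(2, ℤ)}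
    (hγ : γ ∈ CongruenceSubgroup.Gamma0 n) : IsGamma14 γ ∨ IsGamma14 (-γ) := by
  rw [CongruenceSubgroup.Gamma0_mem, ZMod.intCast_zmod_eq_zero_iff_dvd] at hγ
  have h1 : (4 : ℤ) ∣ γ 1 0 := dvd_trans (by exact_mod_cast h4) hγ
  have hd : γ 1 1 % 4 = 1 ∨ γ 1 1 % 4 = 3 := by
    have := sl_det γ
    obtain ⟨c, hc⟩ := h1
    have h2 : γ 1 1 % 2 = 1 := by
      rcases Int.emod_two_eq_zero_or_one (γ 1 1) with h | h
      · exfalso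
        obtain ⟨e, he⟩ := Int.dvd_of_emod_eq_zero h
        rw [hc, he] at this
        have h3 : 2 * (γ 0 0 * e - γ 0 1 * (2 * c)) = 1 := by linear_combination this
        omega
      · exact h
    omega
  rcases hd with hd | hd
  · exact Or.inl ⟨h1, hd⟩
  · refine Or.inr ⟨?_, ?_⟩
    · have : (-γ) 1 0 = -γ 1 0 := by simp
      rw [this]; exact h1.neg_right
    · have : (-γ) 1 1 = -γ 1 1 := by simp
      rw [this]; omega

theorem isInvariant_of_gamma14 {k n : ℕ} (h4 : 4 ∣ n) {f : ℍ → ℂ}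
    (h : ∀ γ ∈ CongruenceSubgroup.Gamma0 n, IsGamma14 γ → thetaSlash k f γ = f) :
    IsInvariant k n f := by
  intro γ hγ
  rcases isGamma14_or_neg h4 hγ with h1 | h1
  · exact h γ hγ h1
  · have h2 : -γ ∈ CongruenceSubgroup.Gamma0 n := by
      rw [CongruenceSubgroup.Gamma0_mem] at hγ ⊢
      have : (-γ) 1 0 = -γ 1 0 := by simp
      rw [this]; push_cast; rw [hγ, neg_zero]
    have h3 := h _ h2 h1
    funext z
    rw [← congrFun h3 z, thetaSlash, slash, slash, ← h1.thetaFactor_neg, neg_neg,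
      ModularGroup.SL_neg_smul]

/-! ### Reciprocity -/

/-- For d ≡ 1 mod 4 the sign of d absorbs the sign in the reciprocity law. This is the source of the
character χ in the rescaled picture. -/
theorem jacobiSym_prime_natAbs {p : Nat.Primes} (hp2 : (p : ℕ) ≠ 2) {d : ℤ} (hd : d % 4 = 1) :
    jacobiSym (p : ℕ) d.natAbs = legendreSym p d := by
  have hodd : Odd (p : ℕ) := p.2.odd_of_ne_two hp2
  rw [jacobiSym.legendreSym.to_jacobiSym]
  rcases lt_or_ge d 0 with h | h
  · have hm : d.natAbs % 4 = 3 := by omega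
    have e : d = -((d.natAbs : ℕ) : ℤ) := by omega
    conv_rhs => rw [e]
    rcases Nat.odd_mod_four_iff.1 (Nat.odd_iff.1 hodd) with h1 | h1
    · rw [jacobiSym_neg_of_one_mod_four _ h1,
        jacobiSym.quadratic_reciprocity_one_mod_four h1 (Nat.odd_iff.2 (by omega))]
    · rw [jacobiSym_neg_of_three_mod_four _ h1, jacobiSym.quadratic_reciprocity_three_mod_four h1 hm]
  · have hm : d.natAbs % 4 = 1 := by omega
    have e : d = ((d.natAbs : ℕ) : ℤ) := by omega
    conv_rhs => rw [e]
    rw [jacobiSym.quadratic_reciprocity_one_mod_four hm hodd]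

end HalfIntegral

namespace HalfIntegral

/-! ### Forms of level prime to `p` and their translates -/

/-- The subgroup `Γ₀(n) ∩ {d ≡ 1 mod 4}`. -/
structure IsLevel (n : ℕ) (γ : SL(2, ℤ)) : Prop where
  dvd : (n : ℤ) ∣ γ 1 0
  isGamma14 : IsGamma14 γ

section IsLevel

variable {n : ℕ} {γ δ : SL(2, ℤ)}

theorem IsLevel.mul (h : IsLevel n γ) (h' : IsLevel n δ) : IsLevel n (γ * δ) where
  dvd := by rw [sl_mul_one_zero]; exact dvd_add (h.dvd.mul_right _) (h'.dvd.mul_left _)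
  isGamma14 := h.isGamma14.mul h'.isGamma14

theorem IsLevel.inv (h : IsLevel n γ) : IsLevel n γ⁻¹ where
  dvd := by rw [sl_inv_one_zero]; exact h.dvd.neg_right
  isGamma14 := h.isGamma14.inv

theorem isLevel_one (n : ℕ) : IsLevel n 1 := ⟨by simp, by simp, by simp⟩

theorem isLevel_upper (n : ℕ) (b : ℤ) : IsLevel n (upperSL b) := ⟨by simp, isGamma14_upper b⟩

theorem isLevel_lower (h4 : 4 ∣ n) {c : ℤ} (hc : (n : ℤ) ∣ c) : IsLevel n (lowerSL c) :=
  ⟨by simpa using hc, isGamma14_lower (dvd_trans (by exact_mod_cast h4) hc)⟩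

end IsLevel

theorem mem_Gamma0_iff {n : ℕ} {γ : SL(2, ℤ)} :
    γ ∈ CongruenceSubgroup.Gamma0 n ↔ (n : ℤ) ∣ γ 1 0 := by
  rw [CongruenceSubgroup.Gamma0_mem, ZMod.intCast_zmod_eq_zero_iff_dvd]

theorem sum_fin_eq_sum_zmod {N : ℕ} [NeZero N] {V : Type*} [AddCommMonoid V] (g : ℕ → V) :
    ∑ s : Fin N, g s = ∑ s : ZMod N, g s.val := by
  let e : Fin N ≃ ZMod N := ⟨fun i => ((i : ℕ) : ZMod N), fun s => ⟨s.val, s.val_lt⟩,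
    fun i => Fin.ext (ZMod.val_natCast_of_lt i.2), fun s => ZMod.natCast_zmod_val s⟩
  refine Fintype.sum_equiv e _ _ fun i => ?_
  change g i = g (ZMod.val ((i : ℕ) : ZMod N))
  rw [ZMod.val_natCast_of_lt i.2]

/-- The sum over pairs that underlies both quadratic relations. -/
theorem sum_sum_eq {F V : Type*} [Field F] [Fintype F] [DecidableEq F] [AddCommGroup V] [Module ℂ V]
    {c : F} (hc : c ≠ 0) {A : F → F → V} {B : F → V} {e : V} {χ : F → ℂ}
    (h0 : ∀ s r, 2 + c * s = 0 → A s r = e)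
    (h1 : ∀ s r, 2 + c * s ≠ 0 → A s r = χ (2 + c * s) • B (r - (c * (2 + c * s))⁻¹)) :
    ∑ r, ∑ s, A s r = (Fintype.card F : ℂ) • e + (∑ m ∈ {0}ᶜ, χ m) • ∑ r, B r := by
  rw [Finset.sum_comm]
  have hs : ∀ s, ∑ r, A s r =
      if 2 + c * s = 0 then (Fintype.card F : ℂ) • e else χ (2 + c * s) • ∑ r, B r := by
    intro s
    split_ifs with h
    · rw [Finset.sum_congr rfl fun r _ => h0 s r h, Finset.sum_const, Finset.card_univ,
        Nat.cast_smul_eq_nsmul]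
    · rw [Finset.sum_congr rfl fun r _ => h1 s r h, ← Finset.smul_sum]
      congr 1
      exact Fintype.sum_equiv (Equiv.subRight _) _ _ fun r => rfl
  rw [Finset.sum_congr rfl fun s _ => hs s]
  have hm : ∑ s, (if 2 + c * s = 0 then (Fintype.card F : ℂ) • e else χ (2 + c * s) • ∑ r, B r) =
      ∑ m, (if m = 0 then (Fintype.card F : ℂ) • e else χ m • ∑ r, B r) := by
    -- The substitution m = 2 + cs. The single value m = 0 gives the constant term; every other m
    -- gives a translate of the sum over r.
    refine Fintype.sum_equiv ((Equiv.mulLeft₀ c hc).trans (Equiv.addLeft 2)) _ _ fun s => ?_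
    simp
  rw [hm, ← Finset.sum_add_sum_compl {(0 : F)}]
  congr 1
  · simp
  · rw [Finset.sum_smul]
    refine Finset.sum_congr rfl fun m hm => ?_
    rw [if_neg (by simpa using hm)]

theorem thetaSlash_sum {ι : Type*} (k : ℕ) (t : Finset ι) (g : ι → ℍ → ℂ) (γ : SL(2, ℤ)) :
    thetaSlash k (∑ i ∈ t, g i) γ = ∑ i ∈ t, thetaSlash k (g i) γ := by
  funext z
  simp only [thetaSlash, slash_apply, Finset.sum_apply, Finset.mul_sum]

theorem thetaSlash_smul (k : ℕ) (a : ℂ) (g : ℍ → ℂ) (γ : SL(2, ℤ)) :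
    thetaSlash k (a • g) γ = a • thetaSlash k g γ := by
  funext z
  simp only [thetaSlash, slash_apply, Pi.smul_apply, smul_eq_mul]
  ring

/-! ### Slashes determined by the bottom row modulo p. -/

section Lower

variable {p : Nat.Primes} {n k : ℕ} {f : ℍ → ℂ}

/-- Proportional bottom rows mod p mean γ' γ⁻¹ ∈ Γ₀(pn), which fixes f. So f|γ is a function on
ℙ¹(𝔽_p). -/
theorem thetaSlash_congr_of_lower (hpn : ¬ (p : ℕ) ∣ n) (hf : IsInvariant k (p * n) f)
    {γ γ' : SL(2, ℤ)} (h : IsLevel n γ) (h' : IsLevel n γ')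
    (hr : ((γ' 1 0 * γ 1 1 - γ' 1 1 * γ 1 0 : ℤ) : ZMod p) = 0) :
    thetaSlash k f γ' = thetaSlash k f γ := by
  have e : (γ' * γ⁻¹) 1 0 = γ' 1 0 * γ 1 1 - γ' 1 1 * γ 1 0 := by
    rw [sl_mul_one_zero, sl_inv_zero_zero, sl_inv_one_zero]; ring
  have hm : γ' * γ⁻¹ ∈ CongruenceSubgroup.Gamma0 (p * n) := by
    rw [mem_Gamma0_iff]
    push_cast
    refine IsCoprime.mul_dvd ?_ ?_ (h'.mul h.inv).dvd
    · exact (Prime.coprime_iff_not_dvd (Nat.prime_iff_prime_int.1 p.2)).2 (by exact_mod_cast hpn)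
    · rw [e]; exact (ZMod.intCast_zmod_eq_zero_iff_dvd _ _).1 hr
  have h2 := (h'.isGamma14.mul h.isGamma14.inv).thetaSlash_mul h.isGamma14 k f
  rw [inv_mul_cancel_right, show thetaSlash k f (γ' * γ⁻¹) = f from hf _ hm] at h2
  exact h2

/-- The representatives `(x(s) y(n))⁻¹`. -/
def lowerRep (n : ℕ) (s : ℤ) : SL(2, ℤ) := (upperSL s * lowerSL (n : ℤ))⁻¹

theorem lowerRep_one_zero (s : ℤ) : lowerRep n s 1 0 = -n := by
  rw [lowerRep, sl_inv_one_zero, sl_mul_one_zero]; simp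

theorem lowerRep_one_one (s : ℤ) : lowerRep n s 1 1 = 1 + s * n := by
  rw [lowerRep, sl_inv_one_one, sl_mul_zero_zero]; simp

theorem lowerRep_zero_zero (s : ℤ) : lowerRep n s 0 0 = 1 := by
  rw [lowerRep, sl_inv_zero_zero, sl_mul_one_one]; simp

theorem lowerRep_zero_one (s : ℤ) : lowerRep n s 0 1 = -s := by
  rw [lowerRep, sl_inv_zero_one, sl_mul_zero_one]; simp

theorem isLevel_lowerRep (h4 : 4 ∣ n) (s : ℤ) : IsLevel n (lowerRep n s) :=
  ((isLevel_upper n s).mul (isLevel_lower h4 dvd_rfl)).inv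

/-- The trace-like operator `∑_s f|(x(s) y(n))⁻¹`. -/
noncomputable def lowerSum (p : Nat.Primes) (k n : ℕ) (f : ℍ → ℂ) : ℍ → ℂ :=
  ∑ s : ZMod p, thetaSlash k f (lowerRep n s.val)

theorem zmod_natCast_ne_zero (hpn : ¬ (p : ℕ) ∣ n) : (n : ZMod p) ≠ 0 := fun h =>
  hpn ((ZMod.natCast_eq_zero_iff n p).1 h)

theorem isInvariant_lowerSum (h4 : 4 ∣ n) (hpn : ¬ (p : ℕ) ∣ n) (hf : IsInvariant k (p * n) f) :
    IsInvariant k (p * n) (lowerSum p k n f) := by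
  refine isInvariant_of_gamma14 (h4.mul_left _) fun γ hγ hγ1 => ?_
  rw [mem_Gamma0_iff] at hγ
  have hn := zmod_natCast_ne_zero hpn
  have hl : IsLevel n γ := ⟨dvd_trans (by push_cast; exact dvd_mul_left _ _) hγ, hγ1⟩
  have hc : ((γ 1 0 : ℤ) : ZMod p) = 0 := (ZMod.intCast_zmod_eq_zero_iff_dvd _ _).2
    (dvd_trans (by push_cast; exact dvd_mul_right _ _) hγ)
  have hdet : ((γ 0 0 : ℤ) : ZMod p) * ((γ 1 1 : ℤ) : ZMod p) = 1 := by
    have := congrArg (fun x : ℤ => (x : ZMod p)) (sl_det γ)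
    push_cast at this
    rw [hc, mul_zero, sub_zero] at this
    exact this
  have hd0 : ((γ 1 1 : ℤ) : ZMod p) ≠ 0 := right_ne_zero_of_mul_eq_one hdet
  rw [lowerSum, thetaSlash_sum]
  -- Right multiplication by γ ∈ Γ₀(pn) fixes the point (0 : 1) and permutes the others. In the
  -- coordinate s, with bottom row (-n : 1 + sn), it is this affine map.
  refine Fintype.sum_equiv ((Equiv.mulLeft₀ (((γ 1 1 : ℤ) : ZMod p) ^ 2) (pow_ne_zero 2 hd0)).trans
    (Equiv.addLeft (((((γ 1 1 : ℤ) : ZMod p) ^ 2 - 1) / n) - (γ 0 1 : ℤ) * (γ 1 1 : ℤ)))) _ _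
    fun s => ?_
  rw [← (isLevel_lowerRep h4 _).isGamma14.thetaSlash_mul hγ1]
  refine thetaSlash_congr_of_lower hpn hf (isLevel_lowerRep h4 _)
    ((isLevel_lowerRep h4 _).mul hl) ?_
  rw [sl_mul_one_zero, sl_mul_one_one]
  simp only [lowerRep_one_zero, lowerRep_one_one, Equiv.trans_apply, Equiv.mulLeft₀_apply,
    Equiv.coe_addLeft]
  push_cast
  rw [hc, ZMod.natCast_zmod_val, ZMod.natCast_zmod_val]
  field_simp
  linear_combination (-(n : ZMod p) * (((γ 1 1 : ℤ) : ZMod p) * (1 + n * s) -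
    n * ((γ 0 1 : ℤ) : ZMod p))) * hdet

/-- The product of the representatives for s and r has lower left entry -n(2 + ns). If 2 + ns = 0 it
lies over the base point, which gives p copies of f. Each of the other p - 1 values of s permutes
the sum over r. -/
theorem lowerSum_lowerSum (h4 : 4 ∣ n) (hpn : ¬ (p : ℕ) ∣ n) (hf : IsInvariant k (p * n) f) :
    lowerSum p k n (lowerSum p k n f) = (p : ℂ) • f + ((p : ℂ) - 1) • lowerSum p k n f := by
  have hn := zmod_natCast_ne_zero hpn
  have h := sum_sum_eq (F := ZMod p) (c := (n : ZMod p)) hn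
    (A := fun s r => thetaSlash k f (lowerRep n s.val * lowerRep n r.val))
    (B := fun r => thetaSlash k f (lowerRep n r.val)) (e := f) (χ := fun _ => 1) ?_ ?_
  · rw [lowerSum, lowerSum]
    simp only [thetaSlash_sum, ← (isLevel_lowerRep h4 _).isGamma14.thetaSlash_mul
      (isLevel_lowerRep h4 _).isGamma14]
    rw [h, ZMod.card, Finset.sum_const, Finset.card_compl, ZMod.card]
    congr 2
    simp [Nat.cast_sub p.2.one_lt.le]
  · intro s r hm
    have h1 := thetaSlash_congr_of_lower hpn hf (γ := 1)
      (γ' := lowerRep n s.val * lowerRep n r.val) (isLevel_one n)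
      ((isLevel_lowerRep h4 _).mul (isLevel_lowerRep h4 _)) (by
        rw [sl_mul_one_zero]
        simp only [lowerRep_one_zero, lowerRep_one_one, lowerRep_zero_zero]
        simp
        linear_combination (-(n : ZMod p)) * hm)
    rw [h1]
    funext z
    simp [thetaSlash, slash_apply, thetaFactor_one]
  · intro s r hm
    rw [one_smul]
    refine thetaSlash_congr_of_lower hpn hf (isLevel_lowerRep h4 _)
      ((isLevel_lowerRep h4 _).mul (isLevel_lowerRep h4 _)) ?_
    rw [sl_mul_one_zero, sl_mul_one_one]
    simp only [lowerRep_one_zero, lowerRep_one_one, lowerRep_zero_zero, lowerRep_zero_one]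
    push_cast
    simp only [ZMod.natCast_zmod_val]
    field_simp
    ring

end Lower

end HalfIntegral

namespace HalfIntegral

/-! ### Rescaling by `p` -/

/-- The map `z ↦ r z` of the upper half plane for `r > 0`. -/
def rescale (r : ℝ) (hr : 0 < r) (z : ℍ) : ℍ :=
  ⟨(r : ℂ) * z, by rw [Complex.im_ofReal_mul]; exact mul_pos hr z.im_pos⟩

theorem coe_rescale (r : ℝ) (hr : 0 < r) (z : ℍ) : ((rescale r hr z : ℍ) : ℂ) = (r : ℂ) * z := rfl

section Hat

variable {p : Nat.Primes} {n k : ℕ} {f g : ℍ → ℂ}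

theorem prime_inv_pos (p : Nat.Primes) : (0 : ℝ) < ((p : ℕ) : ℝ)⁻¹ :=
  inv_pos.2 (by exact_mod_cast p.2.pos)

theorem prime_pos (p : Nat.Primes) : (0 : ℝ) < ((p : ℕ) : ℝ) := by exact_mod_cast p.2.pos

/-- The function `z ↦ f(z/p)`. -/
noncomputable def hat (p : Nat.Primes) (f : ℍ → ℂ) : ℍ → ℂ :=
  fun z => f (rescale ((p : ℕ) : ℝ)⁻¹ (prime_inv_pos p) z)

theorem rescale_inv_rescale (p : Nat.Primes) (z : ℍ) :
    rescale ((p : ℕ) : ℝ)⁻¹ (prime_inv_pos p) (rescale (p : ℕ) (prime_pos p) z) = z := by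
  ext
  rw [coe_rescale, coe_rescale, ← mul_assoc, ← Complex.ofReal_mul, inv_mul_cancel₀ (prime_pos p).ne']
  simp

theorem hat_rescale (f : ℍ → ℂ) (z : ℍ) : hat p f (rescale (p : ℕ) (prime_pos p) z) = f z := by
  rw [hat, rescale_inv_rescale]

theorem hat_injective (h : hat p f = hat p g) : f = g := by
  funext z
  rw [← hat_rescale (p := p) f z, h, hat_rescale]

theorem hat_sum {ι : Type*} (t : Finset ι) (g : ι → ℍ → ℂ) :
    hat p (∑ i ∈ t, g i) = ∑ i ∈ t, hat p (g i) := by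
  funext z
  simp [hat]

theorem hat_smul (a : ℂ) : hat p (a • f) = a • hat p f := rfl

/-- The quadratic character modulo `p`. -/
noncomputable def chi (p : Nat.Primes) (d : ZMod p) : ℂ := ((quadraticChar (ZMod p) d : ℤ) : ℂ)

theorem chi_mul (a b : ZMod p) : chi p (a * b) = chi p a * chi p b := by
  rw [chi, map_mul]; push_cast; rfl

theorem chi_one : chi p 1 = 1 := by simp [chi]

theorem chi_mul_self {a : ZMod p} (ha : a ≠ 0) : chi p a * chi p a = 1 := by
  have := quadraticChar_sq_one ha
  rw [chi]
  exact_mod_cast (sq (quadraticChar (ZMod p) a)) ▸ this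

theorem chi_pow_odd {a : ZMod p} (ha : a ≠ 0) (k : ℕ) : chi p a ^ (2 * k + 1) = chi p a := by
  rw [pow_succ, pow_mul, sq, chi_mul_self ha, one_pow, one_mul]

theorem chi_eq_of_mul_eq_one {a b : ZMod p} (h : a * b = 1) : chi p a = chi p b := by
  have h1 := chi_mul a b
  rw [h, chi_one] at h1
  have h2 := chi_mul_self (right_ne_zero_of_mul_eq_one h)
  linear_combination -chi p a * h2 - chi p b * h1

theorem sum_chi (hp2 : (p : ℕ) ≠ 2) : ∑ m ∈ ({0} : Finset (ZMod p))ᶜ, chi p m = 0 := by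
  have h : ∑ m : ZMod p, quadraticChar (ZMod p) m = 0 :=
    quadraticChar_sum_zero (by rw [ZMod.ringChar_zmod_n]; exact hp2)
  rw [← Finset.sum_add_sum_compl {(0 : ZMod p)}] at h
  simp only [Finset.sum_singleton, MulChar.map_zero, zero_add] at h
  simp only [chi]
  exact_mod_cast congrArg (fun x : ℤ => (x : ℂ)) h

theorem legendreSym_eq_chi (d : ℤ) : ((legendreSym p d : ℤ) : ℂ) = chi p (d : ZMod p) := rfl

/-- Conjugation by the rescaling replaces c by pc and leaves cz + d alone. The symbol (pc/d)
acquires the factor (p/|d|) = (d/p). -/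
theorem thetaFactor_rescale (hp2 : (p : ℕ) ≠ 2) {β β' : SL(2, ℤ)} (hβ : IsGamma14 β)
    (h10 : β' 1 0 = (p : ℕ) * β 1 0) (h11 : β' 1 1 = β 1 1) (z : ℍ) :
    thetaFactor β' (rescale ((p : ℕ) : ℝ)⁻¹ (prime_inv_pos p) z) =
      chi p ((β 1 1 : ℤ) : ZMod p) * thetaFactor β z := by
  have hden : den β' (rescale ((p : ℕ) : ℝ)⁻¹ (prime_inv_pos p) z) = den β z := by
    have : ((p : ℕ) : ℂ) ≠ 0 := by exact_mod_cast p.2.ne_zero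
    rw [den, den, h10, h11, coe_rescale]
    simp
    field_simp
  have hs : shimuraSymbol (β' 1 0) (β' 1 1) =
      legendreSym p (β 1 1) * shimuraSymbol (β 1 0) (β 1 1) := by
    have hp : (0 : ℤ) < (p : ℕ) := by exact_mod_cast p.2.pos
    rw [shimuraSymbol, shimuraSymbol, h10, h11, jacobiSym.mul_left,
      jacobiSym_prime_natAbs hp2 hβ.one_one]
    have : ((p : ℕ) * β 1 0 < 0 ∧ β 1 1 < 0) ↔ (β 1 0 < 0 ∧ β 1 1 < 0) := by
      rw [← not_le, ← not_le, mul_nonneg_iff_of_pos_left hp, not_le, not_le]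
    rw [if_congr this rfl rfl]
    ring
  rw [thetaFactor, thetaFactor, denom_int, denom_int, hden, hs, h11, ← legendreSym_eq_chi]
  push_cast
  ring

theorem rescale_smul {β β' : SL(2, ℤ)} (h00 : β' 0 0 = β 0 0) (h01 : β 0 1 = (p : ℕ) * β' 0 1)
    (h10 : β' 1 0 = (p : ℕ) * β 1 0) (h11 : β' 1 1 = β 1 1) (z : ℍ) :
    β' • rescale ((p : ℕ) : ℝ)⁻¹ (prime_inv_pos p) z =
      rescale ((p : ℕ) : ℝ)⁻¹ (prime_inv_pos p) (β • z) := by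
  have hp : ((p : ℕ) : ℂ) ≠ 0 := by exact_mod_cast p.2.ne_zero
  have hden : den β' (rescale ((p : ℕ) : ℝ)⁻¹ (prime_inv_pos p) z) = den β z := by
    rw [den, den, h10, h11, coe_rescale]
    simp
    field_simp
  ext
  rw [coe_rescale, coe_sl_smul, coe_sl_smul, hden, coe_rescale, h00, h01, mul_div_assoc']
  congr 1
  simp
  field_simp

theorem unit_of_dvd {β : SL(2, ℤ)} (h : ((p : ℕ) : ℤ) ∣ β 0 1) :
    ((β 0 0 : ℤ) : ZMod p) * ((β 1 1 : ℤ) : ZMod p) = 1 := by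
  have := congrArg (fun x : ℤ => (x : ZMod p)) (sl_det β)
  push_cast at this
  rw [(ZMod.intCast_zmod_eq_zero_iff_dvd _ _).2 h, zero_mul, sub_zero] at this
  exact this

theorem hat_thetaSlash (hp2 : (p : ℕ) ≠ 2) {β β' : SL(2, ℤ)} (hβ : IsGamma14 β)
    (h00 : β' 0 0 = β 0 0) (h01 : β 0 1 = (p : ℕ) * β' 0 1)
    (h10 : β' 1 0 = (p : ℕ) * β 1 0) (h11 : β' 1 1 = β 1 1) (f : ℍ → ℂ) :
    hat p (thetaSlash k f β') = chi p ((β 1 1 : ℤ) : ZMod p) • thetaSlash k (hat p f) β := by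
  funext z
  have hd := right_ne_zero_of_mul_eq_one (unit_of_dvd (p := p) (β := β) ⟨_, h01⟩)
  have hχ := chi_mul_self hd
  rw [hat, thetaSlash, slash_apply, thetaFactor_rescale hp2 hβ h10 h11,
    rescale_smul h00 h01 h10 h11, Pi.smul_apply, thetaSlash, slash_apply, smul_eq_mul, mul_pow,
    chi_pow_odd hd, mul_inv, inv_eq_of_mul_eq_one_left hχ, hat, mul_assoc]

theorem exists_rescaled {β : SL(2, ℤ)} (h : ((p : ℕ) : ℤ) ∣ β 0 1) :
    ∃ β' : SL(2, ℤ), β' 0 0 = β 0 0 ∧ β 0 1 = (p : ℕ) * β' 0 1 ∧ β' 1 0 = (p : ℕ) * β 1 0 ∧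
      β' 1 1 = β 1 1 := by
  obtain ⟨b, hb⟩ := h
  refine ⟨⟨!![β 0 0, b; (p : ℕ) * β 1 0, β 1 1], ?_⟩, rfl, hb, rfl, rfl⟩
  have := sl_det β
  rw [Matrix.det_fin_two_of]
  rw [hb] at this
  linear_combination this

/-- The transformation behaviour of `f(z/p)`. -/
theorem thetaSlash_hat (hp2 : (p : ℕ) ≠ 2) (hf : IsInvariant k (p * n) f) {β : SL(2, ℤ)}
    (hβ : IsLevel n β) (h : ((p : ℕ) : ℤ) ∣ β 0 1) :
    thetaSlash k (hat p f) β = chi p ((β 1 1 : ℤ) : ZMod p) • hat p f := by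
  obtain ⟨β', h00, h01, h10, h11⟩ := exists_rescaled h
  have hm : β' ∈ CongruenceSubgroup.Gamma0 (p * n) := by
    rw [mem_Gamma0_iff, h10]
    push_cast
    exact mul_dvd_mul_left _ hβ.dvd
  have h1 := hat_thetaSlash (k := k) hp2 hβ.isGamma14 h00 h01 h10 h11 f
  rw [show thetaSlash k f β' = f from hf _ hm] at h1
  conv_rhs => rw [h1]
  rw [smul_smul, chi_mul_self (right_ne_zero_of_mul_eq_one (unit_of_dvd h)), one_smul]

/-- The analogue of `thetaSlash_congr_of_lower` for f(z/p), with top rows in place of bottom rows.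
Proportional top rows put γ' γ⁻¹ into the group with p ∣ b, and the factor l of proportionality is
its upper left entry mod p, whence χ(l). -/
theorem thetaSlash_hat_congr (hp2 : (p : ℕ) ≠ 2) (hf : IsInvariant k (p * n) f)
    {γ γ' : SL(2, ℤ)} (h : IsLevel n γ) (h' : IsLevel n γ') {l : ZMod p}
    (h0 : ((γ' 0 0 : ℤ) : ZMod p) = l * ((γ 0 0 : ℤ) : ZMod p))
    (h1 : ((γ' 0 1 : ℤ) : ZMod p) = l * ((γ 0 1 : ℤ) : ZMod p)) :
    thetaSlash k (hat p f) γ' = chi p l • thetaSlash k (hat p f) γ := by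
  have e01 : (γ' * γ⁻¹) 0 1 = -(γ' 0 0 * γ 0 1) + γ' 0 1 * γ 0 0 := by
    rw [sl_mul_zero_one, sl_inv_zero_one, sl_inv_one_one]; ring
  have e00 : (γ' * γ⁻¹) 0 0 = γ' 0 0 * γ 1 1 - γ' 0 1 * γ 1 0 := by
    rw [sl_mul_zero_zero, sl_inv_zero_zero, sl_inv_one_zero]; ring
  have hdet := congrArg (fun x : ℤ => (x : ZMod p)) (sl_det γ)
  push_cast at hdet
  have hd : ((p : ℕ) : ℤ) ∣ (γ' * γ⁻¹) 0 1 := by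
    refine (ZMod.intCast_zmod_eq_zero_iff_dvd _ _).1 ?_
    rw [e01]
    push_cast
    rw [h0, h1]
    ring
  have hu := unit_of_dvd hd
  have hl : (((γ' * γ⁻¹) 0 0 : ℤ) : ZMod p) = l := by
    rw [e00]
    push_cast
    rw [h0, h1]
    linear_combination l * hdet
  rw [hl] at hu
  have h2 := (h'.isGamma14.mul h.isGamma14.inv).thetaSlash_mul h.isGamma14 k (hat p f)
  rw [inv_mul_cancel_right, thetaSlash_hat hp2 hf (h'.mul h.inv) hd, thetaSlash_smul,
    ← chi_eq_of_mul_eq_one hu] at h2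
  exact h2

/-- The representatives `x(-1) y(-ns)`. -/
def upperRep (n : ℕ) (s : ℤ) : SL(2, ℤ) := upperSL (-1) * lowerSL (-(n * s))

theorem upperRep_one_zero (s : ℤ) : upperRep n s 1 0 = -(n * s) := by
  rw [upperRep, sl_mul_one_zero]; simp

theorem upperRep_one_one (s : ℤ) : upperRep n s 1 1 = 1 := by
  rw [upperRep, sl_mul_one_one]; simp

theorem upperRep_zero_zero (s : ℤ) : upperRep n s 0 0 = 1 + n * s := by
  rw [upperRep, sl_mul_zero_zero]; simp

theorem upperRep_zero_one (s : ℤ) : upperRep n s 0 1 = -1 := by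
  rw [upperRep, sl_mul_zero_one]; simp

theorem isLevel_upperRep (h4 : 4 ∣ n) (s : ℤ) : IsLevel n (upperRep n s) :=
  (isLevel_upper n _).mul (isLevel_lower h4 (dvd_mul_right _ _).neg_right)

/-- The operator `F ↦ ∑_s F|x(-1) y(-ns)`. -/
noncomputable def upperSum (p : Nat.Primes) (k n : ℕ) (F : ℍ → ℂ) : ℍ → ℂ :=
  ∑ s : ZMod p, thetaSlash k F (upperRep n s.val)

/-- Right multiplication by β permutes the top rows (1 + ns, -1) up to scaling. As p ∣ b, the second
entry becomes -d, so the scaling factor is d and an affine change of s absorbs the rest. -/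
theorem upperSum_slash (h4 : 4 ∣ n) (hpn : ¬ (p : ℕ) ∣ n) (hp2 : (p : ℕ) ≠ 2)
    (hf : IsInvariant k (p * n) f) {β : SL(2, ℤ)} (hβ : IsLevel n β)
    (h : ((p : ℕ) : ℤ) ∣ β 0 1) : thetaSlash k (upperSum p k n (hat p f)) β =
      chi p ((β 1 1 : ℤ) : ZMod p) • upperSum p k n (hat p f) := by
  have hn := zmod_natCast_ne_zero hpn
  have hb : ((β 0 1 : ℤ) : ZMod p) = 0 := (ZMod.intCast_zmod_eq_zero_iff_dvd _ _).2 h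
  have hdet := unit_of_dvd h
  have ha0 := left_ne_zero_of_mul_eq_one hdet
  have hd0 := right_ne_zero_of_mul_eq_one hdet
  rw [upperSum, thetaSlash_sum, Finset.smul_sum]
  refine Fintype.sum_equiv ((Equiv.mulLeft₀ (((β 0 0 : ℤ) : ZMod p) ^ 2) (pow_ne_zero 2 ha0)).trans
    (Equiv.addLeft ((((β 0 0 : ℤ) : ZMod p) ^ 2 - (β 0 0 : ℤ) * (β 1 0 : ℤ) - 1) / n))) _ _
    fun s => ?_
  rw [← (isLevel_upperRep h4 _).isGamma14.thetaSlash_mul hβ.isGamma14]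
  refine thetaSlash_hat_congr hp2 hf (isLevel_upperRep h4 _) ((isLevel_upperRep h4 _).mul hβ) ?_ ?_
  · rw [sl_mul_zero_zero]
    simp only [upperRep_zero_zero, upperRep_zero_one, Equiv.trans_apply, Equiv.mulLeft₀_apply,
      Equiv.coe_addLeft]
    push_cast
    rw [ZMod.natCast_zmod_val, ZMod.natCast_zmod_val]
    field_simp
    linear_combination (((β 1 0 : ℤ) : ZMod p) - ((β 0 0 : ℤ) : ZMod p) * (1 + n * s)) * hdet
  · rw [sl_mul_zero_one]
    simp only [upperRep_zero_zero, upperRep_zero_one]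
    push_cast
    rw [hb]
    ring

/-- The same count as for `lowerSum_lowerSum`, with weight χ(2 + ns). The weights sum to zero over
the nonzero values, so only the terms with 2 + ns = 0 remain; there the top row is -(1, 0), which
accounts for χ(-1). -/
theorem upperSum_upperSum (h4 : 4 ∣ n) (hpn : ¬ (p : ℕ) ∣ n) (hp2 : (p : ℕ) ≠ 2)
    (hf : IsInvariant k (p * n) f) :
    upperSum p k n (upperSum p k n (hat p f)) = ((p : ℂ) * chi p (-1)) • hat p f := by
  have hn := zmod_natCast_ne_zero hpn
  have h := sum_sum_eq (F := ZMod p) (c := (n : ZMod p)) hn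
    (A := fun s r => thetaSlash k (hat p f) (upperRep n s.val * upperRep n r.val))
    (B := fun r => thetaSlash k (hat p f) (upperRep n r.val)) (e := chi p (-1) • hat p f)
    (χ := chi p) ?_ ?_
  · rw [upperSum, upperSum]
    simp only [thetaSlash_sum, ← (isLevel_upperRep h4 _).isGamma14.thetaSlash_mul
      (isLevel_upperRep h4 _).isGamma14]
    rw [h, ZMod.card, sum_chi hp2, zero_smul, add_zero, smul_smul]
  · intro s r hm
    have h1 := thetaSlash_hat_congr hp2 hf (γ := 1) (l := -1)
      (γ' := upperRep n s.val * upperRep n r.val) (isLevel_one n)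
      ((isLevel_upperRep h4 _).mul (isLevel_upperRep h4 _)) (by
        rw [sl_mul_zero_zero]
        simp only [upperRep_zero_zero, upperRep_one_zero, upperRep_zero_one]
        simp
        linear_combination (1 + n * r) * hm) (by
        rw [sl_mul_zero_one]
        simp only [upperRep_zero_zero, upperRep_one_one, upperRep_zero_one]
        simp
        linear_combination -hm)
    rw [h1]
    congr 1
    funext z
    simp [thetaSlash, slash_apply, thetaFactor_one]
  · intro s r hm
    refine thetaSlash_hat_congr hp2 hf (isLevel_upperRep h4 _)
      ((isLevel_upperRep h4 _).mul (isLevel_upperRep h4 _)) ?_ ?_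
    · rw [sl_mul_zero_zero]
      simp only [upperRep_one_zero, upperRep_zero_zero, upperRep_zero_one]
      push_cast
      simp only [ZMod.natCast_zmod_val]
      field_simp
      ring
    · rw [sl_mul_zero_one]
      simp only [upperRep_one_one, upperRep_zero_zero, upperRep_zero_one]
      push_cast
      simp only [ZMod.natCast_zmod_val]
      ring

end Hat

end HalfIntegral

namespace HalfIntegral

/-! ### The two operators on invariant functions -/

section Operators

variable {p : Nat.Primes} {n k : ℕ} {f : ℍ → ℂ}

theorem classicalOperator_zero_eq (h4 : 4 ∣ n) (hpn : ¬ (p : ℕ) ∣ n) (hp2 : (p : ℕ) ≠ 2)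
    (hf : IsInvariant k (p * n) f) :
    classicalOperator k (p * n) (heckeElement p 0) f = lowerSum p k n f := by
  rw [Qtilde_formula h4 hpn hp2 hf]
  exact sum_fin_eq_sum_zmod fun s => thetaSlash k f (lowerRep n s)

/-- The function `z ↦ f(z - 1/p)`. -/
noncomputable def shift (p : Nat.Primes) (f : ℍ → ℂ) : ℍ → ℂ :=
  fun z => f ((upperSL ((p : ℕ) : ℚ)⁻¹)⁻¹ • z)

/-- The constant `p^{-1/2} ε_p`. -/
noncomputable def constW (p : Nat.Primes) : ℂ := ((Real.sqrt (p : ℕ) : ℝ) : ℂ)⁻¹ * epsilon (p : ℕ)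

/-- The operator `f ↦ p^{-1/2} ε_p ∑_s f|x(-1/p) y(-pns)`. -/
noncomputable def opW (p : Nat.Primes) (k n : ℕ) (f : ℍ → ℂ) : ℍ → ℂ :=
  constW p • ∑ s : ZMod p, thetaSlash k (shift p f) (lowerSL (-((p : ℕ) * (n * s.val))))

theorem classicalOperator_one_eq (h4 : 4 ∣ n) (hpn : ¬ (p : ℕ) ∣ n) (hp2 : (p : ℕ) ≠ 2)
    (hf : IsInvariant k (p * n) f) :
    classicalOperator k (p * n)
      (fun x => ((Real.sqrt (p : ℕ) : ℝ) : ℂ)⁻¹ * heckeElement p 1 x) f = opW p k n f := by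
  rw [Wtilde_formula h4 hpn hp2 hf, opW, constW]
  congr 1
  refine (sum_fin_eq_sum_zmod fun s => thetaSlash k (shift p f)
    (lowerSL (((p * n : ℕ) : ℤ) * ((s : ℕ) : ℤ)))⁻¹).trans ?_
  refine Finset.sum_congr rfl fun s _ => ?_
  rw [lowerSL_inv]
  push_cast
  rw [mul_assoc]

theorem epsilon_sq (hp2 : (p : ℕ) ≠ 2) : epsilon (p : ℕ) * epsilon (p : ℕ) = chi p (-1) := by
  have h : chi p (-1) = ((legendreSym p (-1) : ℤ) : ℂ) := by
    rw [legendreSym_eq_chi]; push_cast; rfl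
  have hodd : (p : ℕ) % 2 = 1 := p.2.eq_two_or_odd.resolve_left hp2
  rw [h, legendreSym.at_neg_one hp2, epsilon]
  rcases Nat.odd_mod_four_iff.1 hodd with h1 | h1
  · rw [ZMod.χ₄_nat_one_mod_four h1, if_pos (by omega)]; simp
  · rw [ZMod.χ₄_nat_three_mod_four h1, if_neg (by omega)]; simp

theorem epsilon_ne_zero (d : ℤ) : epsilon d ≠ 0 := by
  rw [epsilon]; split_ifs <;> simp

theorem sqrt_prime_mul_self (p : Nat.Primes) :
    ((Real.sqrt (p : ℕ) : ℝ) : ℂ) * ((Real.sqrt (p : ℕ) : ℝ) : ℂ) = ((p : ℕ) : ℂ) := by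
  rw [← Complex.ofReal_mul, Real.mul_self_sqrt (Nat.cast_nonneg _)]; simp

theorem constW_mul_self (hp2 : (p : ℕ) ≠ 2) :
    constW p * constW p * ((p : ℕ) : ℂ) = chi p (-1) := by
  have h1 := sqrt_prime_mul_self p
  have h0 : ((Real.sqrt (p : ℕ) : ℝ) : ℂ) ≠ 0 := by
    exact_mod_cast (Real.sqrt_pos.2 (prime_pos p)).ne'
  rw [← epsilon_sq hp2, constW, ← h1]
  field_simp

theorem neg_one_ne_zero_zmod (p : Nat.Primes) : (-1 : ZMod p) ≠ 0 := neg_ne_zero.2 one_ne_zero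

theorem hat_shift (f : ℍ → ℂ) : hat p (shift p f) = thetaSlash k (hat p f) (upperSL (-1)) := by
  funext z
  have h1 : thetaFactor (upperSL (-1)) z = 1 := by
    rw [(isGamma14_upper _).thetaFactor_eq, toRat_upper, ratFactor_upper]
  rw [thetaSlash, slash_apply, h1, one_pow, inv_one, one_mul, hat, hat, shift]
  congr 1
  have hp : ((p : ℕ) : ℂ) ≠ 0 := by exact_mod_cast p.2.ne_zero
  ext
  rw [upperSL_inv, coe_sl_smul, coe_rescale, coe_rescale, coe_sl_smul, den, den]
  simp
  ring

/-- Rescaling turns the translation by -1/p into x(-1) and y(-pns) into y(-ns), both integral. -/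
theorem hat_opW (h4 : 4 ∣ n) (hp2 : (p : ℕ) ≠ 2) (f : ℍ → ℂ) :
    hat p (opW p k n f) = constW p • upperSum p k n (hat p f) := by
  rw [opW, hat_smul, hat_sum, upperSum]
  congr 1
  refine Finset.sum_congr rfl fun s _ => ?_
  have hl := isGamma14_lower (c := -((n : ℤ) * (s.val : ℕ)))
    ((dvd_mul_of_dvd_left (by exact_mod_cast h4) _).neg_right)
  rw [hat_thetaSlash hp2 hl (by simp) (by simp) (by simp) (by simp), lowerSL_one_one, Int.cast_one,
    chi_one, one_smul, hat_shift, ← (isGamma14_upper _).thetaSlash_mul hl]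
  rfl

theorem exists_unscaled {γ : SL(2, ℤ)} (h : ((p : ℕ) : ℤ) ∣ γ 1 0) :
    ∃ β : SL(2, ℤ), γ 0 0 = β 0 0 ∧ β 0 1 = (p : ℕ) * γ 0 1 ∧ γ 1 0 = (p : ℕ) * β 1 0 ∧
      γ 1 1 = β 1 1 := by
  obtain ⟨c, hc⟩ := h
  refine ⟨⟨!![γ 0 0, (p : ℕ) * γ 0 1; c, γ 1 1], ?_⟩, rfl, rfl, hc, rfl⟩
  have := sl_det γ
  rw [Matrix.det_fin_two_of]
  rw [hc] at this
  linear_combination this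

theorem isInvariant_opW (h4 : 4 ∣ n) (hpn : ¬ (p : ℕ) ∣ n) (hp2 : (p : ℕ) ≠ 2)
    (hf : IsInvariant k (p * n) f) : IsInvariant k (p * n) (opW p k n f) := by
  refine isInvariant_of_gamma14 (h4.mul_left _) fun γ hγ hγ1 => ?_
  rw [mem_Gamma0_iff] at hγ
  push_cast at hγ
  obtain ⟨β, h00, h01, h10, h11⟩ := exists_unscaled (dvd_trans (dvd_mul_right _ _) hγ)
  have hp0 : ((p : ℕ) : ℤ) ≠ 0 := by exact_mod_cast p.2.ne_zero
  have hn : (n : ℤ) ∣ β 1 0 := by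
    rw [h10] at hγ
    exact Int.dvd_of_mul_dvd_mul_left hp0 hγ
  have hβ : IsLevel n β := ⟨hn, dvd_trans (by exact_mod_cast h4) hn, h11 ▸ hγ1.one_one⟩
  refine hat_injective (p := p) ?_
  rw [hat_thetaSlash hp2 hβ.isGamma14 h00 h01 h10 h11, hat_opW h4 hp2, thetaSlash_smul,
    upperSum_slash h4 hpn hp2 hf hβ ⟨_, h01⟩, smul_smul, smul_smul,
    show ∀ a b : ℂ, a * b * a = (a * a) * b from fun a b => by ring,
    chi_mul_self (right_ne_zero_of_mul_eq_one (unit_of_dvd ⟨_, h01⟩)), one_mul]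

/-- The square of p^{-1/2} ε_p is p⁻¹ χ(-1), which exactly cancels the constant p χ(-1) of
`upperSum_upperSum`. -/
theorem opW_opW (h4 : 4 ∣ n) (hpn : ¬ (p : ℕ) ∣ n) (hp2 : (p : ℕ) ≠ 2)
    (hf : IsInvariant k (p * n) f) : opW p k n (opW p k n f) = f := by
  refine hat_injective (p := p) ?_
  have h : ∀ (a : ℂ) (F : ℍ → ℂ), upperSum p k n (a • F) = a • upperSum p k n F := fun a F => by
    simp only [upperSum, thetaSlash_smul, Finset.smul_sum]
  rw [hat_opW h4 hp2, hat_opW h4 hp2, h, upperSum_upperSum h4 hpn hp2 hf, smul_smul, smul_smul,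
    ← mul_assoc, constW_mul_self hp2, chi_mul_self (neg_one_ne_zero_zmod p), one_smul]

theorem isInvariant_mul (hf : IsInvariant k n f) : IsInvariant k (p * n) f := fun γ hγ => by
  refine hf γ ?_
  rw [mem_Gamma0_iff] at hγ ⊢
  exact dvd_trans (by push_cast; exact dvd_mul_left _ _) hγ

theorem lowerSum_of_isInvariant (h4 : 4 ∣ n) (hf : IsInvariant k n f) :
    lowerSum p k n f = ((p : ℕ) : ℂ) • f := by
  have h : ∀ s : ZMod p, thetaSlash k f (lowerRep n s.val) = f := fun s =>
    hf _ (mem_Gamma0_iff.2 (isLevel_lowerRep h4 _).dvd)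
  rw [lowerSum, Finset.sum_congr rfl fun s _ => h s, Finset.sum_const, Finset.card_univ, ZMod.card,
    Nat.cast_smul_eq_nsmul]

end Operators

end HalfIntegral

namespace HalfIntegral

/-! ### The composition of the two operators -/

theorem ofReal_mul_cpow_half {r : ℝ} (hr : 0 < r) {x : ℂ} (hx : x ≠ 0) :
    ((r : ℂ) * x) ^ (1 / 2 : ℂ) = ((√r : ℝ) : ℂ) * x ^ (1 / 2 : ℂ) := by
  have hr' : (r : ℂ) ≠ 0 := by exact_mod_cast hr.ne'
  have h : ((√r : ℝ) : ℂ) = (r : ℂ) ^ (1 / 2 : ℂ) := by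
    rw [Real.sqrt_eq_rpow, Complex.ofReal_cpow hr.le]
    norm_num
  rw [h, Complex.cpow_def_of_ne_zero (mul_ne_zero hr' hx), Complex.cpow_def_of_ne_zero hr',
    Complex.cpow_def_of_ne_zero hx, Complex.log_ofReal_mul hr hx, add_mul, Complex.exp_add,
    Complex.ofReal_log hr.le]

section Composition

variable {p : Nat.Primes} {n k : ℕ} {f : ℍ → ℂ}

/-- Since pD = 1 + mu ≡ 1 mod 4m, the symbol (-m/pD) is 1, so (-m/D) = (-m/p). Moreover mD ≡ 1 mod p
gives (m/p) = (D/p), and reciprocity between p and D, together with D ≡ p mod 4, makes all signs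
cancel. -/
theorem jacobiSym_neg_mul_eq_one (hp2 : (p : ℕ) ≠ 2) {m u D : ℕ} (h4m : 4 ∣ m) (hm : 0 < m)
    (h4u : 4 ∣ u) (h : (p : ℕ) * D = 1 + m * u) (hD : ((p : ℕ) : ℤ) ∣ m * D - 1) :
    jacobiSym (-((p : ℕ) * m : ℤ)) D = 1 := by
  have hodd : (p : ℕ) % 2 = 1 := p.2.eq_two_or_odd.resolve_left hp2
  obtain ⟨m', rfl⟩ := h4m
  obtain ⟨u', rfl⟩ := h4u
  have hpD : ((p : ℕ) * D) % 4 = 1 := by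
    rw [h, show 1 + 4 * m' * (4 * u') = 1 + 4 * (m' * (4 * u')) by ring]; omega
  have hpD' := hpD
  rw [Nat.mul_mod] at hpD'
  have hne : NeZero D := ⟨by rintro rfl; simp at hpD⟩
  have hnp : NeZero (p : ℕ) := ⟨p.2.ne_zero⟩
  have h1 : jacobiSym (-((4 * m' : ℕ) : ℤ)) p * jacobiSym (-((4 * m' : ℕ) : ℤ)) D = 1 := by
    rw [← jacobiSym.mul_right, jacobiSym.mod_right _ (Nat.odd_iff.2 (by omega)), h, Int.natAbs_neg,
      Int.natAbs_natCast, show 1 + 4 * m' * (4 * u') = 1 + 4 * (4 * m') * u' by ring,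
      Nat.add_mul_mod_self_left, Nat.mod_eq_of_lt (by omega), jacobiSym.one_right]
  have h2 : jacobiSym ((4 * m' : ℕ) : ℤ) p * jacobiSym (D : ℤ) p = 1 := by
    rw [← jacobiSym.mul_left]
    exact (jacobiSym.mod_left' (Int.emod_eq_emod_iff_emod_sub_eq_zero.2
      (Int.emod_eq_zero_of_dvd hD))).trans (jacobiSym.one_left _)
  rw [show -((p : ℕ) * ((4 * m' : ℕ) : ℤ)) = (p : ℕ) * -((4 * m' : ℕ) : ℤ) by ring,
    jacobiSym.mul_left]
  rcases Nat.odd_mod_four_iff.1 hodd with hp | hp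
  · rw [jacobiSym_neg_of_one_mod_four _ hp] at h1
    have hD4 : D % 4 = 1 := by rw [hp] at hpD'; omega
    rw [jacobiSym.quadratic_reciprocity_one_mod_four hp (Nat.odd_iff.2 (by omega))]
    rcases Int.mul_eq_one_iff_eq_one_or_neg_one.1 h1 with ⟨ha, hb⟩ | ⟨ha, hb⟩ <;>
    · rw [ha] at h2
      rw [hb]
      linarith
  · rw [jacobiSym_neg_of_three_mod_four _ hp] at h1
    have hD4 : D % 4 = 3 := by rw [hp] at hpD'; omega
    rw [jacobiSym.quadratic_reciprocity_three_mod_four hp hD4]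
    rcases Int.mul_eq_one_iff_eq_one_or_neg_one.1 h1 with ⟨ha, hb⟩ | ⟨ha, hb⟩ <;>
    · rw [neg_eq_iff_eq_neg] at ha
      rw [ha] at h2
      rw [hb]
      linarith

theorem prime_sq_inv_pos (p : Nat.Primes) : (0 : ℝ) < (((p : ℕ) : ℝ) ^ 2)⁻¹ :=
  inv_pos.2 (pow_pos (prime_pos p) 2)

/-- The point `(z + v)/p²`. -/
noncomputable def heckePoint (p : Nat.Primes) (z : ℍ) (v : ℤ) : ℍ :=
  rescale (((p : ℕ) : ℝ) ^ 2)⁻¹ (prime_sq_inv_pos p) (upperSL v • z)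

theorem coe_heckePoint (z : ℍ) (v : ℤ) :
    ((heckePoint p z v : ℍ) : ℂ) = ((z : ℂ) + v) / ((p : ℕ) : ℂ) ^ 2 := by
  rw [heckePoint, coe_rescale, coe_sl_smul, den]
  simp
  field_simp

theorem thetaFactor_eq_of_pos {γ : SL(2, ℤ)} (hd : 0 < γ 1 1) (hJ : jacobiSym (γ 1 0) (γ 1 1).natAbs = 1)
    (z : ℍ) : thetaFactor γ z = (epsilon (γ 1 1))⁻¹ * (den γ z) ^ (1 / 2 : ℂ) := by
  rw [thetaFactor, shimuraSymbol, hJ, if_neg (by omega), denom_int]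
  simp

theorem epsilon_congr {a b : ℤ} (h : a % 4 = b % 4) : epsilon a = epsilon b := by
  rw [epsilon, epsilon, h]

/-- The matrix p x(-1/p) y(-m) factors as γ (1, u; 0, p²), where γ has rows (p + m, -B) and (-pm,
D), (p + m)u + 1 = p²B and 1 + mu = pD. So γ ∈ Γ₀(pn) can be removed by invariance. The condition 4
∣ u makes its quadratic symbol trivial, so only ε_p⁻¹ and p^{-1/2} remain. -/
theorem thetaSlash_shift_lower (hp2 : (p : ℕ) ≠ 2) (hf : IsInvariant k (p * n) f) {m u : ℕ}
    (h4m : 4 ∣ m) (hnm : n ∣ m) (hm : 0 < m) (h4u : 4 ∣ u) (hu : (p : ℕ) ^ 2 ∣ (p + m) * u + 1)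
    (z : ℍ) :
    thetaSlash k (shift p f) (lowerSL (-(m : ℤ))) z =
      ((epsilon (p : ℕ))⁻¹ * ((√((p : ℕ) : ℝ)⁻¹ : ℝ) : ℂ)) ^ (2 * k + 1) * f (heckePoint p z u) := by
  obtain ⟨B, hB⟩ := hu
  have hp0 : (p : ℕ) ≠ 0 := p.2.ne_zero
  have hpC : ((p : ℕ) : ℂ) ≠ 0 := by exact_mod_cast hp0
  obtain ⟨D, hD⟩ : (p : ℕ) ∣ 1 + m * u := by
    refine (Nat.dvd_add_right (dvd_mul_right (p : ℕ) u)).1 ⟨p * B, ?_⟩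
    linear_combination hB
  have hdet : ((p : ℕ) + m : ℤ) * D - -(B : ℤ) * -((p : ℕ) * m) = 1 := by
    have hp' : ((p : ℕ) : ℤ) ≠ 0 := by exact_mod_cast hp0
    refine mul_left_cancel₀ hp' ?_
    have e1 : ((p : ℕ) + m : ℤ) * u + 1 = (p : ℕ) ^ 2 * B := by exact_mod_cast hB
    have e2 : (1 + m * u : ℤ) = (p : ℕ) * D := by exact_mod_cast hD
    linear_combination (-((p : ℕ) + m : ℤ)) * e2 + (m : ℤ) * e1
  have hDpos : 0 < D := Nat.pos_of_ne_zero (by rintro rfl; simp at hD)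
  set γ : SL(2, ℤ) := ⟨!![((p : ℕ) + m : ℤ), -(B : ℤ); -((p : ℕ) * m : ℤ), D],
    by rw [Matrix.det_fin_two_of]; exact hdet⟩ with hγ
  have g00 : γ 0 0 = (p : ℕ) + m := rfl
  have g01 : γ 0 1 = -B := rfl
  have g10 : γ 1 0 = -((p : ℕ) * m) := rfl
  have g11 : γ 1 1 = D := rfl
  have hmem : γ ∈ CongruenceSubgroup.Gamma0 (p * n) := by
    rw [mem_Gamma0_iff, g10]
    push_cast
    exact (mul_dvd_mul_left _ (by exact_mod_cast hnm)).neg_right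
  have hJ : jacobiSym (γ 1 0) (γ 1 1).natAbs = 1 := by
    rw [g10, g11, Int.natAbs_natCast]
    refine jacobiSym_neg_mul_eq_one hp2 h4m hm h4u hD.symm ⟨m * B - D, ?_⟩
    linear_combination hdet
  -- Because pD ≡ 1 mod 4, D and p agree mod 4.
  have hε : epsilon (D : ℤ) = epsilon (p : ℕ) := by
    refine epsilon_congr ?_
    have hodd : (p : ℕ) % 2 = 1 := p.2.eq_two_or_odd.resolve_left hp2
    obtain ⟨m', rfl⟩ := h4m
    have h1 : ((p : ℕ) * D) % 4 = 1 := by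
      rw [← hD, show 1 + 4 * m' * u = 1 + 4 * (m' * u) by ring]; omega
    rw [Nat.mul_mod] at h1
    have h2 : (p : ℕ) % 4 < 4 := Nat.mod_lt _ (by norm_num)
    have h3 : D % 4 < 4 := Nat.mod_lt _ (by norm_num)
    have h4 : D % 4 = (p : ℕ) % 4 := by
      revert h1 h2 h3
      generalize (p : ℕ) % 4 = a
      generalize D % 4 = b
      intro h1 h2 h3
      interval_cases a <;> interval_cases b <;> simp_all
    omega
  have hden : den γ (heckePoint p z u) =
      ((((p : ℕ) : ℝ)⁻¹ : ℝ) : ℂ) * den (lowerSL (-(m : ℤ))) z := by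
    have e2 : (1 + m * u : ℂ) = (p : ℕ) * D := by exact_mod_cast hD
    rw [den, den, g10, g11, coe_heckePoint]
    simp
    field_simp
    linear_combination -e2
  have hl : IsGamma14 (lowerSL (-(m : ℤ))) :=
    isGamma14_lower ((by exact_mod_cast h4m : (4 : ℤ) ∣ m).neg_right)
  have hd0 : den (lowerSL (-(m : ℤ))) z ≠ 0 := den_ne_zero _ _
  have hlow : thetaFactor (lowerSL (-(m : ℤ))) z =
      den (lowerSL (-(m : ℤ))) z ^ (1 / 2 : ℂ) := by
    rw [thetaFactor_eq_of_pos (by simp) (by simp)]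
    simp [epsilon]
  have hθ : thetaFactor γ (heckePoint p z u) =
      (epsilon (p : ℕ))⁻¹ * ((√((p : ℕ) : ℝ)⁻¹ : ℝ) : ℂ) * thetaFactor (lowerSL (-(m : ℤ))) z := by
    rw [thetaFactor_eq_of_pos (by rw [g11]; exact_mod_cast hDpos) hJ, g11, hε, hden,
      ofReal_mul_cpow_half (prime_inv_pos p) hd0, hlow]
    ring
  have hpt : (upperSL ((p : ℕ) : ℚ)⁻¹)⁻¹ • lowerSL (-(m : ℤ)) • z = γ • heckePoint p z u := by
    ext
    rw [upperSL_inv, coe_sl_smul, coe_sl_smul, coe_sl_smul, hden, g00, g01, coe_heckePoint]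
    have e1 : ((p : ℕ) + m : ℂ) * u + 1 = (p : ℕ) ^ 2 * B := by exact_mod_cast hB
    rw [den] at hd0
    have hd1 : (1 - (z : ℂ) * m) ≠ 0 := fun h => hd0 (by simp; linear_combination h)
    simp [den]
    rw [show -((m : ℂ) * z) + 1 = 1 - (z : ℂ) * m by ring]
    field_simp
    linear_combination -e1
  have key := congrFun (hf γ hmem) (heckePoint p z u)
  rw [slash_apply, hθ, mul_pow, mul_inv] at key
  have hc : ((epsilon (p : ℕ))⁻¹ * ((√((p : ℕ) : ℝ)⁻¹ : ℝ) : ℂ)) ^ (2 * k + 1) ≠ 0 := by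
    refine pow_ne_zero _ (mul_ne_zero (inv_ne_zero (epsilon_ne_zero _)) ?_)
    exact_mod_cast (Real.sqrt_pos.2 (prime_inv_pos p)).ne'
  rw [thetaSlash, slash_apply, shift, hpt, ← key, mul_assoc, mul_inv_cancel_left₀ hc]

theorem exists_four_dvd_mul_add_one_dvd (hp2 : (p : ℕ) ≠ 2) {a : ℕ} (ha : ¬ (p : ℕ) ∣ a) :
    ∃ u : ℕ, 4 ∣ u ∧ (p : ℕ) ^ 2 ∣ a * u + 1 := by
  have h4 : Nat.Coprime (p : ℕ) 4 := by
    rw [show (4 : ℕ) = 2 ^ 2 by norm_num]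
    exact Nat.Coprime.pow_right 2 ((Nat.coprime_primes p.2 Nat.prime_two).2 hp2)
  have hc : Nat.Coprime (a * 4) ((p : ℕ) ^ 2) :=
    Nat.Coprime.pow_right 2
      (Nat.Coprime.symm (Nat.Coprime.mul_right ((Nat.Prime.coprime_iff_not_dvd p.2).2 ha) h4))
  have : NeZero ((p : ℕ) ^ 2) := ⟨pow_ne_zero 2 p.2.ne_zero⟩
  refine ⟨4 * (-((a * 4 : ℕ) : ZMod ((p : ℕ) ^ 2))⁻¹).val, dvd_mul_right _ _, ?_⟩
  rw [← ZMod.natCast_eq_zero_iff]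
  have h := ZMod.coe_mul_inv_eq_one _ hc
  push_cast at h ⊢
  rw [ZMod.natCast_zmod_val]
  linear_combination -h

end Composition

end HalfIntegral

namespace HalfIntegral

/-! ### The operator `U_{p²}` -/

section HeckeU

variable {p : Nat.Primes} {n k : ℕ} {f : ℍ → ℂ}

theorem thetaSlash_upper (k : ℕ) (f : ℍ → ℂ) (b : ℤ) (z : ℍ) :
    thetaSlash k f (upperSL b) z = f (upperSL b • z) := by
  have h1 : thetaFactor (upperSL b) z = 1 := by
    rw [(isGamma14_upper _).thetaFactor_eq, toRat_upper, ratFactor_upper]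
  rw [thetaSlash, slash_apply, h1, one_pow, inv_one, one_mul]

theorem IsInvariant.upperSL_smul (hf : IsInvariant k n f) (b : ℤ) (z : ℍ) :
    f (upperSL b • z) = f z := by
  rw [← thetaSlash_upper k f b z]
  exact congrFun (hf _ (mem_Gamma0_iff.2 (by simp))) z

theorem IsInvariant.heckePoint_congr (hf : IsInvariant k n f) (z : ℍ) {a b : ℤ}
    (h : ((a : ℤ) : ZMod ((p : ℕ) ^ 2)) = b) : f (heckePoint p z a) = f (heckePoint p z b) := by
  obtain ⟨j, hj⟩ := (ZMod.intCast_eq_intCast_iff_dvd_sub a b _).1 h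
  have hp : ((p : ℕ) : ℂ) ≠ 0 := by exact_mod_cast p.2.ne_zero
  have hb : (b : ℂ) = a + (p : ℕ) ^ 2 * j := by
    have : b = a + ((p : ℕ) : ℤ) ^ 2 * j := by push_cast at hj; linear_combination hj
    exact_mod_cast this
  have e : heckePoint p z b = upperSL j • heckePoint p z a := by
    ext
    rw [coe_sl_smul, coe_heckePoint, coe_heckePoint, den, hb]
    simp
    field_simp
    ring
  rw [e, hf.upperSL_smul]

/-- The sum `∑_v f((z + v)/p²)` over the residues `v` modulo `p²`. -/
noncomputable def heckeSum (p : Nat.Primes) (f : ℍ → ℂ) : ℍ → ℂ := fun z =>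
  ∑ v ∈ Finset.range ((p : ℕ) ^ 2), f (heckePoint p z v)

/-- The values u r agree mod p and are distinct mod p². Then s is recovered from u r - s mod p and r
from it mod p², so the p² pairs exhaust the residues. -/
theorem IsInvariant.heckeSum_eq (hf : IsInvariant k n f) (z : ℍ) {u : ZMod p → ℤ}
    (h0 : ∀ r r', ((u r : ℤ) : ZMod p) = (u r' : ℤ))
    (hu : ∀ r r', ((u r : ℤ) : ZMod ((p : ℕ) ^ 2)) = (u r' : ℤ) → r = r') :
    ∑ s : ZMod p, ∑ r : ZMod p, f (heckePoint p z (u r - s.val)) = heckeSum p f z := by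
  have : NeZero ((p : ℕ) ^ 2) := ⟨pow_ne_zero 2 p.2.ne_zero⟩
  let φ : ZMod p × ZMod p → ZMod ((p : ℕ) ^ 2) := fun x => ((u x.2 - x.1.val : ℤ) : ZMod _)
  have hφ : Function.Injective φ := by
    rintro ⟨s, r⟩ ⟨s', r'⟩ h
    have h1 : ((u r - s.val : ℤ) : ZMod ((p : ℕ) ^ 2)) = ((u r' - s'.val : ℤ)) := h
    have h2 : ((u r - s.val : ℤ) : ZMod p) = ((u r' - s'.val : ℤ)) := by
      rw [ZMod.intCast_eq_intCast_iff_dvd_sub] at h1 ⊢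
      exact dvd_trans (by push_cast; exact dvd_pow_self _ two_ne_zero) h1
    have hs : s = s' := by
      push_cast at h2
      rw [h0 r r', ZMod.natCast_zmod_val, ZMod.natCast_zmod_val] at h2
      exact sub_right_injective h2
    subst hs
    push_cast at h1
    rw [hu r r' (sub_left_injective h1)]
  have hb : Function.Bijective φ := (Fintype.bijective_iff_injective_and_card φ).2
    ⟨hφ, by rw [Fintype.card_prod, ZMod.card, ZMod.card, sq]⟩
  rw [heckeSum, Finset.sum_range (fun v : ℕ => f (heckePoint p z v)),
    sum_fin_eq_sum_zmod (fun v : ℕ => f (heckePoint p z v)), ← Fintype.sum_prod_type']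
  refine Fintype.sum_bijective φ hb _ _ fun x => hf.heckePoint_congr z ?_
  rw [Int.cast_natCast, ZMod.natCast_zmod_val]

/-- The lower unipotents combine: y(-pnr) y(-n) x(-s) = y(-n(1 + pr)) x(-s). So
`thetaSlash_shift_lower` applies with m = n(1 + pr), and x(-s) shifts the resulting point by -s. Mod
p the solution u r is -1/n for every r, and mod p² it depends on r. -/
theorem lowerSum_opW (h4 : 4 ∣ n) (hpn : ¬ (p : ℕ) ∣ n) (hp2 : (p : ℕ) ≠ 2)
    (hf : IsInvariant k (p * n) f) : lowerSum p k n (opW p k n f) =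
      (constW p * ((epsilon (p : ℕ))⁻¹ * ((√((p : ℕ) : ℝ)⁻¹ : ℝ) : ℂ)) ^ (2 * k + 1)) •
        heckeSum p f := by
  have hn0 : 0 < n := Nat.pos_of_ne_zero (by rintro rfl; simp at hpn)
  have hn := zmod_natCast_ne_zero hpn
  have ha : ∀ r : ℕ, ¬ (p : ℕ) ∣ p + n * (1 + p * r) := by
    intro r h
    rw [show (p : ℕ) + n * (1 + p * r) = p * (1 + n * r) + n by ring,
      Nat.dvd_add_right (dvd_mul_right _ _)] at h
    exact hpn h
  choose u hu4 hu using fun r : ZMod p => exists_four_dvd_mul_add_one_dvd hp2 (ha r.val)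
  have hterm : ∀ (s r : ZMod p) (z : ℍ),
      thetaSlash k (thetaSlash k (shift p f) (lowerSL (-((p : ℕ) * (n * r.val)))))
        (lowerRep n s.val) z =
      ((epsilon (p : ℕ))⁻¹ * ((√((p : ℕ) : ℝ)⁻¹ : ℝ) : ℂ)) ^ (2 * k + 1) *
        f (heckePoint p z (u r - s.val)) := by
    intro s r z
    have h4n : (4 : ℤ) ∣ n := by exact_mod_cast h4
    have g1 : IsGamma14 (lowerSL (-((p : ℕ) * (n * r.val : ℤ)))) :=
      isGamma14_lower ((h4n.mul_right _).mul_left _).neg_right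
    have g2 : IsGamma14 (lowerSL (-(n : ℤ))) := isGamma14_lower h4n.neg_right
    rw [← g1.thetaSlash_mul (isLevel_lowerRep h4 _).isGamma14, lowerRep, mul_inv_rev, lowerSL_inv,
      upperSL_inv, ← mul_assoc, lowerSL_mul, show -((p : ℕ) * (n * r.val : ℤ)) + -(n : ℤ) =
        -((n * (1 + p * r.val) : ℕ) : ℤ) by push_cast; ring, (isGamma14_lower (Dvd.dvd.neg_right
        (by exact_mod_cast h4.mul_right _))).thetaSlash_mul (isGamma14_upper _), thetaSlash_upper,
      thetaSlash_shift_lower hp2 hf (h4.mul_right _) (dvd_mul_right _ _) (by positivity) (hu4 r)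
        (hu r)]
    congr 2
    rw [heckePoint, heckePoint, ← mul_smul, upperSL_mul, sub_eq_add_neg]
  have hmod : ∀ r, (n : ZMod p) * (u r : ZMod p) = -1 := by
    intro r
    have := (ZMod.natCast_eq_zero_iff _ _).2 (dvd_trans (dvd_pow_self (p : ℕ) two_ne_zero) (hu r))
    push_cast at this
    rw [show ((p : ℕ) : ZMod p) = 0 from ZMod.natCast_self _] at this
    linear_combination this
  funext z
  rw [Pi.smul_apply, smul_eq_mul, ← hf.heckeSum_eq z (u := fun r => (u r : ℤ)) ?_ ?_]
  · rw [lowerSum, Finset.sum_apply, mul_assoc, Finset.mul_sum, Finset.mul_sum]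
    refine Finset.sum_congr rfl fun s _ => ?_
    rw [opW, thetaSlash_smul, thetaSlash_sum, Pi.smul_apply, Finset.sum_apply, smul_eq_mul]
    congr 1
    rw [Finset.mul_sum]
    exact Finset.sum_congr rfl fun r _ => hterm s r z
  · intro r r'
    push_cast
    exact mul_left_cancel₀ hn ((hmod r).trans (hmod r').symm)
  · intro r r' h
    push_cast at h
    have e1 := (ZMod.natCast_eq_zero_iff _ _).2 (hu r)
    have e2 := (ZMod.natCast_eq_zero_iff _ _).2 (hu r')
    push_cast at e1 e2
    -- If u r = u r' mod p², subtracting their defining congruences leaves p n u (r - r') ≡ 0 mod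
    -- p², and n u is a unit mod p.
    have e3 : ((p * (n * u r' * (r.val - r'.val)) : ℤ) : ZMod ((p : ℕ) ^ 2)) = 0 := by
      push_cast
      rw [h] at e1
      linear_combination e1 - e2
    rw [ZMod.intCast_zmod_eq_zero_iff_dvd] at e3
    push_cast at e3
    rw [sq] at e3
    have e4 := Int.dvd_of_mul_dvd_mul_left (by exact_mod_cast p.2.ne_zero) e3
    rw [← ZMod.intCast_zmod_eq_zero_iff_dvd] at e4
    push_cast at e4
    rw [hmod, ZMod.natCast_zmod_val, ZMod.natCast_zmod_val] at e4
    linear_combination -e4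

/-- The powers of ε_p combine to ε_p^{-2k} = (-1/p)^k and those of p to p^{-1/2 - (2k+1)/2 + 2} =
p^{1-k}. -/
theorem constW_mul_pow (hp2 : (p : ℕ) ≠ 2) (k : ℕ) :
    constW p * ((epsilon (p : ℕ))⁻¹ * ((√((p : ℕ) : ℝ)⁻¹ : ℝ) : ℂ)) ^ (2 * k + 1) *
      ((p : ℕ) : ℂ) ^ 2 = (legendreSym p (-1) : ℂ) ^ k * ((p : ℕ) : ℂ) ^ (1 - (k : ℤ)) := by
  have hp : ((p : ℕ) : ℂ) ≠ 0 := by exact_mod_cast p.2.ne_zero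
  have hε := epsilon_ne_zero (p : ℕ)
  have h1 := sqrt_prime_mul_self p
  have h0 : ((Real.sqrt (p : ℕ) : ℝ) : ℂ) ≠ 0 := by
    exact_mod_cast (Real.sqrt_pos.2 (prime_pos p)).ne'
  have h2 : (legendreSym p (-1) : ℂ) = (epsilon (p : ℕ) * epsilon (p : ℕ))⁻¹ := by
    rw [epsilon_sq hp2, legendreSym_eq_chi]
    push_cast
    exact (inv_eq_of_mul_eq_one_left (chi_mul_self (neg_one_ne_zero_zmod p))).symm
  rw [h2, constW, Real.sqrt_inv, zpow_sub₀ hp, zpow_one, zpow_natCast, ← h1]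
  have h3 : ∀ a e : ℂ, a ≠ 0 → e ≠ 0 → a⁻¹ * e * (e⁻¹ * a⁻¹) ^ (2 * k + 1) * (a * a) ^ 2 =
      (e * e)⁻¹ ^ k * (a * a / (a * a) ^ k) := by
    intro a e ha he
    rw [pow_succ, pow_mul, show (e⁻¹ * a⁻¹) ^ 2 = (e * e)⁻¹ * (a * a)⁻¹ by field_simp, mul_pow,
      inv_pow (a * a)]
    field_simp
  rw [Complex.ofReal_inv]
  exact h3 _ _ h0 hε

/-- Orthogonality of the P-th roots of unity. -/
theorem sum_qParam_pow (P : ℕ) (hP : 0 < P) (z : ℂ) (a : ℕ) :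
    ∑ v ∈ Finset.range P, Function.Periodic.qParam 1 ((z + (v : ℕ)) / P) ^ a =
      if P ∣ a then (P : ℂ) * Function.Periodic.qParam 1 z ^ (a / P) else 0 := by
  have hPC : (P : ℂ) ≠ 0 := by exact_mod_cast hP.ne'
  have hq : ∀ v : ℕ, Function.Periodic.qParam 1 ((z + (v : ℕ)) / P) ^ a =
      Function.Periodic.qParam 1 (z / P) ^ a *
        (Complex.exp (2 * Real.pi * Complex.I / P) ^ a) ^ v := by
    intro v
    simp only [Function.Periodic.qParam]
    rw [← Complex.exp_nat_mul, ← Complex.exp_nat_mul, ← Complex.exp_nat_mul, ← Complex.exp_nat_mul,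
      ← Complex.exp_add]
    congr 1
    push_cast
    field_simp
  have hζ := Complex.isPrimitiveRoot_exp P hP.ne'
  rw [Finset.sum_congr rfl fun v _ => hq v, ← Finset.mul_sum]
  split_ifs with h
  · rw [(hζ.pow_eq_one_iff_dvd a).2 h]
    obtain ⟨b, rfl⟩ := h
    rw [Nat.mul_div_cancel_left _ hP, pow_mul]
    have : Function.Periodic.qParam 1 (z / P) ^ P = Function.Periodic.qParam 1 z := by
      simp only [Function.Periodic.qParam]
      rw [← Complex.exp_nat_mul]
      congr 1
      push_cast
      field_simp
    rw [this]
    simp [mul_comm]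
  · have h1 : Complex.exp (2 * Real.pi * Complex.I / P) ^ a ≠ 1 := fun h' =>
      h ((hζ.pow_eq_one_iff_dvd a).1 h')
    have h2 := mul_geom_sum (Complex.exp (2 * Real.pi * Complex.I / P) ^ a) P
    rw [pow_right_comm, hζ.pow_eq_one, one_pow, sub_self] at h2
    rw [(mul_eq_zero.1 h2).resolve_left (sub_ne_zero.2 h1), mul_zero]

/-- Averaging f((z + v)/p²) over v mod p² keeps exactly the terms of the q-expansion with exponent
divisible by p². Holomorphy, period 1 and boundedness at infinity guarantee that the expansion
converges to f. -/
theorem heckeUm_eq (hf : IsInvariant k n f) (hd : MDiff f)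
    (hb : UpperHalfPlane.IsBoundedAtImInfty f) :
    heckeUm ((p : ℕ) ^ 2) f = (((p : ℕ) : ℂ) ^ 2)⁻¹ • heckeSum p f := by
  have hper : Function.Periodic (f ∘ UpperHalfPlane.ofComplex) (1 : ℝ) := by
    intro w
    by_cases hw : 0 < w.im
    · have hw' : 0 < (w + (1 : ℝ)).im := by simpa using hw
      rw [Function.comp_apply, Function.comp_apply, UpperHalfPlane.ofComplex_apply_of_im_pos hw,
        UpperHalfPlane.ofComplex_apply_of_im_pos hw', ← hf.upperSL_smul 1 ⟨w, hw⟩]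
      congr 1
      ext
      rw [coe_sl_smul, den]
      simp
    · have hw' : (w + (1 : ℝ)).im ≤ 0 := by simpa using hw
      rw [Function.comp_apply, Function.comp_apply,
        UpperHalfPlane.ofComplex_apply_of_im_nonpos (not_lt.1 hw),
        UpperHalfPlane.ofComplex_apply_of_im_nonpos hw']
  have hP : 0 < (p : ℕ) ^ 2 := pow_pos p.2.pos 2
  have hPC : ((p : ℕ) : ℂ) ^ 2 ≠ 0 := by exact_mod_cast hP.ne'
  funext z
  have h1 : HasSum (fun a : ℕ => ∑ v ∈ Finset.range ((p : ℕ) ^ 2),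
      (UpperHalfPlane.qExpansion 1 f).coeff a •
        Function.Periodic.qParam 1 ((heckePoint p z v : ℍ) : ℂ) ^ a) (heckeSum p f z) :=
    hasSum_sum fun v _ => UpperHalfPlane.hasSum_qExpansion one_pos hper hd hb _
  have h2 : (fun a : ℕ => ∑ v ∈ Finset.range ((p : ℕ) ^ 2),
      (UpperHalfPlane.qExpansion 1 f).coeff a •
        Function.Periodic.qParam 1 ((heckePoint p z v : ℍ) : ℂ) ^ a) = fun a : ℕ =>
      (UpperHalfPlane.qExpansion 1 f).coeff a * if (p : ℕ) ^ 2 ∣ a then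
        (((p : ℕ) ^ 2 : ℕ) : ℂ) * Function.Periodic.qParam 1 (z : ℂ) ^ (a / (p : ℕ) ^ 2) else 0 := by
    funext a
    rw [← sum_qParam_pow _ hP, Finset.mul_sum]
    refine Finset.sum_congr rfl fun v _ => ?_
    rw [coe_heckePoint, smul_eq_mul]
    push_cast
    rfl
  rw [h2] at h1
  have hinj : Function.Injective fun b : ℕ => (p : ℕ) ^ 2 * b := fun a b h =>
    Nat.eq_of_mul_eq_mul_left hP h
  rw [← hinj.hasSum_iff] at h1
  · have h3 := h1.mul_left (((p : ℕ) : ℂ) ^ 2)⁻¹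
    rw [heckeUm, Pi.smul_apply, smul_eq_mul, ← h3.tsum_eq]
    refine tsum_congr fun b => ?_
    simp only [Function.comp_apply]
    rw [if_pos (dvd_mul_right _ _), Nat.mul_div_cancel_left _ hP]
    rw [mul_left_comm, Nat.cast_pow, inv_mul_cancel_left₀ hPC]
  · intro a ha
    rw [if_neg, mul_zero]
    rintro ⟨b, rfl⟩
    exact ha ⟨b, rfl⟩

theorem lowerSum_opW_eq_heckeUm (h4 : 4 ∣ n) (hpn : ¬ (p : ℕ) ∣ n) (hp2 : (p : ℕ) ≠ 2)
    (hf : IsInvariant k (p * n) f) (hd : MDiff f) (hb : UpperHalfPlane.IsBoundedAtImInfty f) :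
    lowerSum p k n (opW p k n f) =
      ((legendreSym p (-1) : ℂ) ^ k * ((p : ℕ) : ℂ) ^ (1 - (k : ℤ))) • heckeUm ((p : ℕ) ^ 2) f := by
  have hp : ((p : ℕ) : ℂ) ^ 2 ≠ 0 := by exact_mod_cast pow_ne_zero 2 p.2.ne_zero
  rw [lowerSum_opW h4 hpn hp2 hf, heckeUm_eq hf hd hb, smul_smul, ← constW_mul_pow hp2,
    mul_inv_cancel_right₀ hp]

end HeckeU

end HalfIntegral

namespace HalfIntegral

/-! ### Holomorphy and vanishing at the cusps -/

section Analytic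

variable {p : Nat.Primes} {n k : ℕ} {f : ℍ → ℂ}

theorem MDifferentiable.comp_smul_rat (hf : MDiff f) (α : SL(2, ℚ)) : MDiff (fun z => f (α • z)) := by
  have h := UpperHalfPlane.mdifferentiable_smul
    (g := ((Matrix.SpecialLinearGroup.map (algebraMap ℚ ℝ) α : SL(2, ℝ)) : GL (Fin 2) ℝ)) (by simp)
  exact fun z => (hf _).comp z (h z)

theorem mdifferentiable_thetaSlash (hf : MDiff f) {γ : SL(2, ℤ)} (hγ : IsGamma14 γ) :
    MDiff (thetaSlash k f γ) := by
  have h1 : MDiff (fun z => f (γ • z)) := by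
    simpa only [toRat_smul] using MDifferentiable.comp_smul_rat hf (toRat γ)
  have h2 : MDiff (fun z => (thetaFactor γ z ^ (2 * k + 1))⁻¹) := by
    intro z
    -- The denominator avoids the cut of the principal root, so the factor is holomorphic in z.
    have hs : UpperHalfPlane.denom γ z ∈ Complex.slitPlane := by
      rw [Complex.mem_slitPlane_iff_arg, denom_int]
      exact ⟨hγ.arg_den z, den_ne_zero _ _⟩
    have hd : DifferentiableAt ℂ (fun w : ℂ => (((epsilon (γ 1 1))⁻¹ *
        (shimuraSymbol (γ 1 0) (γ 1 1) : ℂ) * w ^ (1 / 2 : ℂ)) ^ (2 * k + 1))⁻¹)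
        (UpperHalfPlane.denom γ z) := by
      refine DifferentiableAt.inv (DifferentiableAt.pow (DifferentiableAt.const_mul
        (differentiableAt_id.cpow_const hs) _) _) ?_
      exact pow_ne_zero _ (hγ.thetaFactor_ne_zero z)
    exact MDifferentiableAt.comp (f := fun τ : ℍ => UpperHalfPlane.denom γ τ) z
      hd.mdifferentiableAt (UpperHalfPlane.mdifferentiable_denom _ z)
  have h3 : thetaSlash k f γ = (fun z => (thetaFactor γ z ^ (2 * k + 1))⁻¹) * fun z => f (γ • z) := by
    funext z
    rw [thetaSlash, slash_apply, Pi.mul_apply]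
  rw [h3]
  exact h2.mul h1

theorem mdifferentiable_finset_sum {ι : Type*} (t : Finset ι) {g : ι → ℍ → ℂ} (h : ∀ i ∈ t, MDiff (g i)) :
    MDiff (∑ i ∈ t, g i) := by
  classical
  induction t using Finset.induction_on with
  | empty => rw [Finset.sum_empty]; exact mdifferentiable_const
  | insert a s ha ih =>
    rw [Finset.sum_insert ha]
    exact (h a (Finset.mem_insert_self _ _)).add
      (ih fun i hi => h i (Finset.mem_insert_of_mem hi))

theorem mdifferentiable_lowerSum (h4 : 4 ∣ n) (hf : MDiff f) : MDiff (lowerSum p k n f) :=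
  mdifferentiable_finset_sum _ fun _ _ => mdifferentiable_thetaSlash hf (isLevel_lowerRep h4 _).isGamma14

theorem isGamma14_lower_mul (h4 : 4 ∣ n) (a b : ℤ) : IsGamma14 (lowerSL (-(a * (n * b)))) :=
  isGamma14_lower (((by exact_mod_cast h4 : (4 : ℤ) ∣ n).mul_right _).mul_left _).neg_right

theorem mdifferentiable_opW (h4 : 4 ∣ n) (hf : MDiff f) : MDiff (opW p k n f) :=
  (mdifferentiable_finset_sum _ fun _ _ => mdifferentiable_thetaSlash
    (MDifferentiable.comp_smul_rat hf _) (isGamma14_lower_mul h4 _ _)).const_smul _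

/-- The absolute value of `f|[α]_{k+1/2}`. -/
noncomputable def absSlash (k : ℕ) (f : ℍ → ℂ) (α : SL(2, ℚ)) : ℍ → ℝ :=
  fun z => ‖f (α • z)‖ / √‖den α z‖ ^ (2 * k + 1)

/-- The function `f` vanishes at all cusps. -/
def IsCuspidal (k : ℕ) (f : ℍ → ℂ) : Prop :=
  ∀ α : SL(2, ℚ), UpperHalfPlane.IsZeroAtImInfty (absSlash k f α)

/-- Absolute values forget all multipliers, so they obey an honest composition law for every
rational matrix. Stated in these terms for all of SL₂(ℚ), vanishing at the cusps is visibly stable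
under integral slashes and under translation by 1/p. -/
theorem absSlash_mul (α β : SL(2, ℚ)) (z : ℍ) :
    absSlash k f (α * β) z = absSlash k f α (β • z) / √‖den β z‖ ^ (2 * k + 1) := by
  rw [absSlash, absSlash, mul_smul, den_mul, norm_mul, Real.sqrt_mul (norm_nonneg _), mul_pow,
    div_div]

theorem norm_thetaFactor {γ : SL(2, ℤ)} (hγ : IsGamma14 γ) (z : ℍ) :
    ‖thetaFactor γ z‖ = √‖den γ z‖ := by
  symm
  rw [Real.sqrt_eq_iff_mul_self_eq (norm_nonneg _) (norm_nonneg _), ← norm_mul, hγ.thetaFactor_eq,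
    ratFactor, mul_mul_mul_comm, expSign_mul_self, one_mul, ← sq, lowerRoot_sq, den_toRat]

theorem absSlash_thetaSlash {γ : SL(2, ℤ)} (hγ : IsGamma14 γ) (α : SL(2, ℚ)) :
    absSlash k (thetaSlash k f γ) α = absSlash k f (toRat γ * α) := by
  funext z
  rw [absSlash_mul, absSlash, absSlash, thetaSlash, slash_apply, norm_mul, norm_inv, norm_pow,
    norm_thetaFactor hγ, den_toRat, toRat_smul]
  congr 1
  rw [div_eq_inv_mul]

theorem IsCuspidal.thetaSlash (hf : IsCuspidal k f) {γ : SL(2, ℤ)} (hγ : IsGamma14 γ) :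
    IsCuspidal k (thetaSlash k f γ) := fun α => by
  rw [absSlash_thetaSlash hγ]
  exact hf _

theorem IsCuspidal.shift (hf : IsCuspidal k f) : IsCuspidal k (shift p f) := fun α => by
  have h : absSlash k (HalfIntegral.shift p f) α =
      absSlash k f ((upperSL ((p : ℕ) : ℚ)⁻¹)⁻¹ * α) := by
    funext z
    rw [absSlash_mul, absSlash, absSlash, HalfIntegral.shift, upperSL_inv]
    simp [den]
  rw [h]
  exact hf _

theorem IsCuspidal.smul (hf : IsCuspidal k f) (a : ℂ) : IsCuspidal k (a • f) := fun α => by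
  have h : absSlash k (a • f) α = ‖a‖ • absSlash k f α := by
    funext z
    rw [absSlash, Pi.smul_apply, Pi.smul_apply, absSlash, norm_smul, smul_eq_mul, mul_div_assoc]
  rw [h]
  exact (hf α).smul _

theorem IsCuspidal.sum {ι : Type*} (t : Finset ι) {g : ι → ℍ → ℂ}
    (h : ∀ i ∈ t, IsCuspidal k (g i)) : IsCuspidal k (∑ i ∈ t, g i) := fun α => by
  have h1 : Filter.Tendsto (fun z => ∑ i ∈ t, absSlash k (g i) α z) UpperHalfPlane.atImInfty
      (nhds 0) := by
    have := tendsto_finsetSum t fun i hi => h i hi α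
    simpa using this
  refine squeeze_zero (fun z => by rw [absSlash]; positivity) (fun z => ?_) h1
  simp only [absSlash, ← Finset.sum_div, Finset.sum_apply]
  gcongr
  exact norm_sum_le _ _

theorem IsCuspidal.lowerSum (h4 : 4 ∣ n) (hf : IsCuspidal k f) :
    IsCuspidal k (lowerSum p k n f) :=
  IsCuspidal.sum _ fun _ _ => hf.thetaSlash (isLevel_lowerRep h4 _).isGamma14

theorem IsCuspidal.opW (h4 : 4 ∣ n) (hf : IsCuspidal k f) : IsCuspidal k (opW p k n f) :=
  (IsCuspidal.sum _ fun _ _ => hf.shift.thetaSlash (isGamma14_lower_mul h4 _ _)).smul _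

theorem exists_eq_toRat_mul (α : SL(2, ℚ)) :
    ∃ (γ : SL(2, ℤ)) (β : SL(2, ℚ)), α = toRat γ * β ∧ β 1 0 = 0 := by
  obtain ⟨a, c, hac, h⟩ : ∃ a c : ℤ, IsCoprime a c ∧ (a : ℚ) * α 1 0 = c * α 0 0 := by
    by_cases h0 : α 1 0 = 0
    · exact ⟨1, 0, isCoprime_one_left, by simp [h0]⟩
    · refine ⟨(α 0 0 / α 1 0).num, (α 0 0 / α 1 0).den,
        Int.isCoprime_iff_gcd_eq_one.2 (α 0 0 / α 1 0).reduced, ?_⟩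
      have h1 := Rat.num_div_den (α 0 0 / α 1 0)
      have h2 : ((α 0 0 / α 1 0).den : ℚ) ≠ 0 := by exact_mod_cast (α 0 0 / α 1 0).den_ne_zero
      rw [div_eq_div_iff h2 h0] at h1
      push_cast
      linear_combination h1
  obtain ⟨γ, h1, h2⟩ := hac.exists_SL2_col 0
  refine ⟨γ, (toRat γ)⁻¹ * α, by rw [mul_inv_cancel_left], ?_⟩
  rw [sl_mul_one_zero, sl_inv_one_zero, sl_inv_one_one, toRat_apply, toRat_apply, h1, h2]
  linear_combination h

theorem tendsto_smul_of_lower_zero {β : SL(2, ℚ)} (h : β 1 0 = 0) :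
    Filter.Tendsto (fun z : ℍ => β • z) UpperHalfPlane.atImInfty UpperHalfPlane.atImInfty :=
  UpperHalfPlane.tendsto_smul_atImInfty
    (g := ((Matrix.SpecialLinearGroup.map (algebraMap ℚ ℝ) β : SL(2, ℝ)) : GL (Fin 2) ℝ))
    (by simp [h])

theorem norm_slash_eq (γ : SL(2, ℤ)) (z : ℍ) :
    ‖slash k γ (fun z => (UpperHalfPlane.denom γ z) ^ (1 / 2 : ℂ)) f z‖ =
      absSlash k f (toRat γ) z := by
  have h : ‖UpperHalfPlane.denom γ z ^ (1 / 2 : ℂ)‖ = √‖den γ z‖ := by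
    symm
    rw [Real.sqrt_eq_iff_mul_self_eq (norm_nonneg _) (norm_nonneg _), ← norm_mul, ← sq,
      ← Complex.cpow_nat_mul, denom_int]
    norm_num
  rw [slash_apply, norm_mul, norm_inv, norm_pow, h, absSlash, toRat_smul, den_toRat, div_eq_inv_mul]

/-- Every rational matrix is an integral one times an upper triangular one. The latter preserves the
neighbourhoods of i∞ and changes the absolute slash by a constant. -/
theorem isCuspidal_iff : IsCuspidal k f ↔ ∀ γ : SL(2, ℤ), UpperHalfPlane.IsZeroAtImInfty
    (slash k γ (fun z => (UpperHalfPlane.denom γ z) ^ (1 / 2 : ℂ)) f) := by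
  have hz : ∀ γ : SL(2, ℤ), UpperHalfPlane.IsZeroAtImInfty
      (slash k γ (fun z => (UpperHalfPlane.denom γ z) ^ (1 / 2 : ℂ)) f) ↔
      UpperHalfPlane.IsZeroAtImInfty (absSlash k f (toRat γ)) := fun γ =>
    tendsto_zero_iff_norm_tendsto_zero.trans
      (Filter.tendsto_congr fun z => norm_slash_eq γ z)
  refine ⟨fun h γ => (hz γ).2 (h _), fun h α => ?_⟩
  obtain ⟨γ, β, rfl, hβ⟩ := exists_eq_toRat_mul α
  have h1 := (((hz γ).1 (h γ)).comp (tendsto_smul_of_lower_zero hβ)).div_const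
    (√‖(β 1 1 : ℂ)‖ ^ (2 * k + 1))
  rw [zero_div] at h1
  refine h1.congr fun z => ?_
  rw [absSlash_mul, Function.comp_apply]
  congr 4
  simp [den, hβ]

theorem mem_cuspForms_iff : f ∈ cuspForms k n ↔ MDiff f ∧ IsInvariant k n f ∧ IsCuspidal k f := by
  rw [isCuspidal_iff]
  rfl

theorem isBoundedAtImInfty_of_isCuspidal (hf : IsCuspidal k f) :
    UpperHalfPlane.IsBoundedAtImInfty f := by
  have h := hf 1
  have e : absSlash k f 1 = fun z => ‖f z‖ := by
    funext z
    simp [absSlash, den]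
  rw [e] at h
  exact UpperHalfPlane.IsZeroAtImInfty.isBoundedAtImInfty (tendsto_zero_iff_norm_tendsto_zero.2 h)

theorem lowerSum_mem (h4 : 4 ∣ n) (hpn : ¬ (p : ℕ) ∣ n) (hf : f ∈ cuspForms k (p * n)) :
    lowerSum p k n f ∈ cuspForms k (p * n) := by
  rw [mem_cuspForms_iff] at hf ⊢
  exact ⟨mdifferentiable_lowerSum h4 hf.1, isInvariant_lowerSum h4 hpn hf.2.1, hf.2.2.lowerSum h4⟩

theorem opW_mem (h4 : 4 ∣ n) (hpn : ¬ (p : ℕ) ∣ n) (hp2 : (p : ℕ) ≠ 2)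
    (hf : f ∈ cuspForms k (p * n)) : opW p k n f ∈ cuspForms k (p * n) := by
  rw [mem_cuspForms_iff] at hf ⊢
  exact ⟨mdifferentiable_opW h4 hf.1, isInvariant_opW h4 hpn hp2 hf.2.1, hf.2.2.opW h4⟩

theorem cuspForms_le : cuspForms k n ≤ cuspForms k (p * n) := fun f hf => by
  rw [mem_cuspForms_iff] at hf ⊢
  exact ⟨hf.1, isInvariant_mul hf.2.1, hf.2.2⟩

/-- The operator `lowerSum` on cusp forms. -/
noncomputable def lowerSumEnd (h4 : 4 ∣ n) (hpn : ¬ (p : ℕ) ∣ n) :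
    Module.End ℂ (cuspForms k (p * n)) where
  toFun f := ⟨lowerSum p k n f, lowerSum_mem h4 hpn f.2⟩
  map_add' f g := by
    ext z
    simp only [lowerSum, thetaSlash, slash, Submodule.coe_add, Pi.add_apply, Finset.sum_apply,
      add_mul, Finset.sum_add_distrib]
  map_smul' a f := by
    ext z
    simp only [lowerSum, thetaSlash_smul, Submodule.coe_smul, ← Finset.smul_sum, RingHom.id_apply]

/-- The operator `opW` on cusp forms. -/
noncomputable def opWEnd (h4 : 4 ∣ n) (hpn : ¬ (p : ℕ) ∣ n) (hp2 : (p : ℕ) ≠ 2) :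
    Module.End ℂ (cuspForms k (p * n)) where
  toFun f := ⟨opW p k n f, opW_mem h4 hpn hp2 f.2⟩
  map_add' f g := by
    ext z
    simp only [opW, thetaSlash, slash, shift, Submodule.coe_add, Pi.add_apply, Pi.smul_apply,
      Finset.sum_apply, add_mul, Finset.sum_add_distrib, smul_add]
  map_smul' a f := by
    ext z
    have : shift p (a • (f : ℍ → ℂ)) = a • shift p f := rfl
    simp only [opW, thetaSlash_smul, Submodule.coe_smul, ← Finset.smul_sum, RingHom.id_apply, this,
      smul_comm (constW p) a]

end Analytic

theorem sub_smul_one_mul_add_one {V : Type*} [AddCommGroup V] [Module ℂ V] {Q : Module.End ℂ V}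
    {a : ℂ} (h : Q * Q = a • 1 + (a - 1) • Q) : (Q - a • 1) * (Q + 1) = 0 := by
  rw [sub_mul, mul_add, h, mul_one, smul_mul_assoc, one_mul]
  module

end HalfIntegral
-- Assembly of the three operators and their relations.
theorem mainTheorem9 (k M : ℕ) (p : Nat.Primes) (hk : 0 < k) (hM : Odd M)
    (hpM : (p : ℕ) ∣ M) (hpM2 : ¬ (p : ℕ) ^ 2 ∣ M) :
    ∃ Q W U : Module.End ℂ (HalfIntegral.cuspForms k (4 * M)),
      (∀ f, (Q f : ℍ → ℂ) = HalfIntegral.Qtilde k M p f) ∧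
      (∀ f, (W f : ℍ → ℂ) = HalfIntegral.Wtilde k M p f) ∧
      (∀ f, (U f : ℍ → ℂ) = HalfIntegral.heckeUm ((p : ℕ) ^ 2) f) ∧
      W * W = 1 ∧
      (Q - ((p : ℕ) : ℂ) • 1) * (Q + 1) = 0 ∧
      Q = ((legendreSym p (-1) : ℂ) ^ k * ((p : ℕ) : ℂ) ^ (1 - (k : ℤ))) • (U * W) ∧
      HalfIntegral.cuspForms k (4 * (M / p)) ≤ HalfIntegral.cuspForms k (4 * M) ∧
      ∀ f : HalfIntegral.cuspForms k (4 * M),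
        (f : ℍ → ℂ) ∈ HalfIntegral.cuspForms k (4 * (M / p)) → Q f = ((p : ℕ) : ℂ) • f := by
  obtain ⟨m, rfl⟩ := hpM
  have hp0 : 0 < (p : ℕ) := p.2.pos
  have hp2 : (p : ℕ) ≠ 2 := fun h => by
    rw [h] at hM
    exact Nat.not_odd_iff_even.2 (even_two_mul m) hM
  have hpm : ¬ (p : ℕ) ∣ 4 * m := by
    rw [p.2.dvd_mul, show (4 : ℕ) = 2 ^ 2 by norm_num]
    rintro (h | h)
    · exact hp2 ((Nat.prime_dvd_prime_iff_eq p.2 Nat.prime_two).1 (p.2.dvd_of_dvd_pow h))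
    · exact hpM2 (by rw [sq]; exact mul_dvd_mul_left _ h)
  rw [Nat.mul_div_cancel_left _ hp0]
  have h4 : 4 ∣ 4 * m := dvd_mul_right _ _
  simp only [HalfIntegral.Qtilde, HalfIntegral.Wtilde]
  rw [show 4 * ((p : ℕ) * m) = p * (4 * m) by ring]
  -- From here on only 4 ∣ n, p ∤ n and p odd matter.
  generalize 4 * m = n at hpm h4
  have hinv : ∀ f : HalfIntegral.cuspForms k (p * n), HalfIntegral.IsInvariant k (p * n) f :=
    fun f => f.2.2.1
  set Q : Module.End ℂ (HalfIntegral.cuspForms k (p * n)) := HalfIntegral.lowerSumEnd h4 hpm with hQ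
  set W : Module.End ℂ (HalfIntegral.cuspForms k (p * n)) := HalfIntegral.opWEnd h4 hpm hp2 with hW
  set C : ℂ := (legendreSym p (-1) : ℂ) ^ k * ((p : ℕ) : ℂ) ^ (1 - (k : ℤ)) with hC
  have hC0 : C ≠ 0 := by
    have hp : ((p : ℕ) : ℂ) ≠ 0 := by exact_mod_cast p.2.ne_zero
    refine mul_ne_zero (pow_ne_zero _ ?_) (zpow_ne_zero _ hp)
    rw [HalfIntegral.legendreSym_eq_chi]
    push_cast
    exact left_ne_zero_of_mul_eq_one
      (HalfIntegral.chi_mul_self (HalfIntegral.neg_one_ne_zero_zmod p))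
  have hWW : W * W = 1 := LinearMap.ext fun f =>
    Subtype.ext (HalfIntegral.opW_opW h4 hpm hp2 (hinv f))
  -- Defining U as C⁻¹ Q W makes its stability on cusp forms automatic. The identity Q W = C U_{p²}
  -- shows that it is the classical operator, and W² = 1 gives the third relation.
  refine ⟨Q, W, C⁻¹ • (Q * W), fun f => ?_, fun f => ?_, fun f => ?_, hWW, ?_, ?_,
    HalfIntegral.cuspForms_le, fun f hf => ?_⟩
  · exact (HalfIntegral.classicalOperator_zero_eq h4 hpm hp2 (hinv f)).symm
  · exact (HalfIntegral.classicalOperator_one_eq h4 hpm hp2 (hinv f)).symm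
  · have hf := HalfIntegral.mem_cuspForms_iff.1 f.2
    have h := HalfIntegral.lowerSum_opW_eq_heckeUm h4 hpm hp2 hf.2.1 hf.1
      (HalfIntegral.isBoundedAtImInfty_of_isCuspidal hf.2.2)
    change C⁻¹ • HalfIntegral.lowerSum p k n (HalfIntegral.opW p k n f) = _
    rw [h, smul_smul, inv_mul_cancel₀ hC0, one_smul]
  · exact HalfIntegral.sub_smul_one_mul_add_one (LinearMap.ext fun f =>
      Subtype.ext (HalfIntegral.lowerSum_lowerSum h4 hpm (hinv f)))
  · rw [smul_mul_assoc, mul_assoc, hWW, mul_one, smul_smul, mul_inv_cancel₀ hC0, one_smul]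
  · exact Subtype.ext (HalfIntegral.lowerSum_of_isInvariant h4 hf.2.1)
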